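/- Let $\mathcal A$ be a finite or countable set with $|\mathcal A|>1$, with the discrete topology and $\sigma$-algebra; let $\Omega=\mathcal A^{\mathbb N}$ ($\mathbb N=\{0,1,2,\dots\}$) carry the product topology and product $\sigma$-algebra $\mathcal F$, let $T:\Omega\to\Omega$ be the left shift, and let $\mathbb P$ be a $T$-invariant probability measure on $(\Omega,\mathcal F)$. For $a_0,\dots,a_{n-1}\in\mathcal A$ write $[a_0,\dots,a_{n-1}]=\{\omega\in\Omega:\omega_j=a_j,\ 0\le j<n\}$. Assume: - $\mathbb P$ is $\psi$-mixing: there are $\psi_m\ge 0$ ($m\ge0$) with $\psi_m\to0$ such that $|\mathbb P(E\cap T^{-(n+m)}F)-\mathbb P(E)\mathbb P(F)|\le\psi_m\mathbb P(E)\mathbb P(F)$ for all $m,n\in\mathbb N$, all $E$ in the $\sigma$-algebra generated by the coordinates $0,\dots,n-1$, and all $F\in\mathcal F$. - $\mathbb P$ is not a point mass, i.e. $\mathbb P([a])<1$ for every $a\in\mathcal A$. - $S=(S_{a,b})_{a,b\in\mathcal A}$ is a matrix of $0$'s and $1$'s without zero rows or zero columns, $\Omega_S=\{\omega\in\Omega:S_{\omega_j,\omega_{j+1}}=1\text{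 for all }j\ge0\}$ satisfies $\mathbb P(\Omega_S)=1$, and $T:\Omega_S\to\Omega_S$ is topologically mixing: for all nonempty relatively open $U,V\subset\Omega_S$ there is $N(U,V)\ge1$ with $U\cap T^{-n}V\neq\emptyset$ for all $n\ge N(U,V)$. For measurable $E\subset\Omega_S$ put $\mathbb P\circ T(E)=\sum_{a\in\mathcal A}\mathbb P(T(E\cap[a]))$. This is a $\sigma$-finite measure on $\Omega_S$ with $\mathbb P\ll\mathbb P\circ T$; the inverse Jacobian of $\mathbb P$ is $\frac{d\mathbb P}{d\mathbb P\circ T}$. Assume that it has a version $J:\Omega_S\to\mathbb R$ (equal to it $\mathbb P\circ T$-almost everywhere) which is continuous on $\Omega_S$. Let $\ell\ge1$, let $1\le d_1<\dots<d_\ell$ be integers, and let $t>0$. Let $\omega$ be a point of the support of $\mathbb P$ which is periodic with minimal period $r\ge1$. For $n\ge1$ let $A_n=[\omega_0,\dots,\omega_{n-1}]$ and $N_n=\lfloor t\,\mathbb P(A_n)^{-\ell}\rfloor$, and for $\gamma\in\Omega$ let $$S_n(\gamma)=\sum_{k=1}^{N_n}\prod_{j=1}^{\ell}1_{A_n}(T^{d_jk}\gamma).$$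 Put $$\kappa=\operatorname{lcm}\Big\{\frac{r}{\gcd(r,d_j)}:1\le j\le\ell\Big\},\qquad a=\frac{\kappa}{r}\sum_{i=1}^{\ell}d_i,\qquad \rho_\omega=\Big(\prod_{j=0}^{r-1}J(T^j\omega)\Big)^{a}.$$ Then $\rho_\omega\in[0,1)$, and as $n\to\infty$ the random variables $S_n$ on $(\Omega,\mathcal F,\mathbb P)$ converge in distribution to the Pólya–Aeppli distribution $PA(t(1-\rho_\omega),\rho_\omega)$, where, for $s>0$ and $p\in[0,1)$, $PA(s,p)$ is the probability measure on $\mathbb N$ with $PA(s,p)\{0\}=e^{-s}$ and $$PA(s,p)\{k\}=e^{-s}\sum_{j=1}^{k}\binom{k-1}{j-1}\frac{s^j}{j!}\,p^{k-j}(1-p)^j\qquad(k\ge1).$$ -/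

import Mathlib

open Filter Topology MeasureTheory ProbabilityTheory

namespace ShiftRecurrence

/-! ### The one-sided shift and topological Markov shifts -/

section Shift

variable {𝒜 : Type*}

/-- The left shift on one-sided sequences. -/
def shift (ω : ℕ → 𝒜) : ℕ → 𝒜 := fun n => ω (n + 1)

/-- The sequence `a · ω`, obtained by adding the letter `a` at the beginning of `ω`. -/
def prepend (a : 𝒜) (ω : ℕ → 𝒜) : ℕ → 𝒜
  | 0 => a
  | n + 1 => ω n

/-- The topological Markov shift of the matrix `S`. -/
def markovShift (S : Matrix 𝒜 𝒜 ℕ) : Set (ℕ → 𝒜) :=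
  {ω | ∀ j, S (ω j) (ω (j + 1)) = 1}

/-- `S` is a matrix of zeros and ones without zero rows and zero columns. -/
structure IsTransitionMatrix (S : Matrix 𝒜 𝒜 ℕ) : Prop where
  zero_or_one : ∀ a b, S a b = 0 ∨ S a b = 1
  row_ne_zero : ∀ a, ∃ b, S a b ≠ 0
  col_ne_zero : ∀ b, ∃ a, S a b ≠ 0

/-- The shift is topologically mixing on the invariant set `X`, with its subspace topology:
any two nonempty relatively open sets `U ∩ X`, `V ∩ X` satisfy
`(U ∩ X) ∩ T⁻ⁿ (V ∩ X) ≠ ∅` for all large `n`. -/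
def IsTopologicallyMixingOn [TopologicalSpace 𝒜] (X : Set (ℕ → 𝒜)) : Prop :=
  ∀ U V : Set (ℕ → 𝒜), IsOpen U → IsOpen V → (U ∩ X).Nonempty → (V ∩ X).Nonempty →
    ∃ N : ℕ, 0 < N ∧ ∀ n, N ≤ n → ((U ∩ X) ∩ shift^[n] ⁻¹' (V ∩ X)).Nonempty

/-- The σ-algebra generated by the coordinates with index in `J`. -/
@[reducible] def coordSigma (J : Set ℕ) : MeasurableSpace (ℕ → 𝒜) :=
  MeasurableSpace.generateFrom {E | ∃ j ∈ J, ∃ a : 𝒜, E = {ω | ω j = a}}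

/-- `P` is `ψ`-mixing. -/
def IsPsiMixing [MeasurableSpace 𝒜] (P : Measure (ℕ → 𝒜)) : Prop :=
  ∃ ψ : ℕ → ℝ, (∀ m, 0 ≤ ψ m) ∧ Tendsto ψ atTop (𝓝 0) ∧
    ∀ (m n : ℕ) (E F : Set (ℕ → 𝒜)),
      MeasurableSet[coordSigma (Set.Iio n)] E → MeasurableSet F →
        |P.real (E ∩ shift^[n + m] ⁻¹' F) - P.real E * P.real F| ≤
          ψ m * P.real E * P.real F

theorem shift_image_inter (E : Set (ℕ → 𝒜)) (a : 𝒜) :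
    shift '' (E ∩ {ω | ω 0 = a}) = prepend a ⁻¹' E := by
  have key : ∀ ω : ℕ → 𝒜, prepend (ω 0) (shift ω) = ω := by
    intro ω
    funext n
    cases n <;> rfl
  ext γ
  constructor
  · rintro ⟨ω, ⟨hE, rfl⟩, rfl⟩
    simpa [key ω] using hE
  · intro h
    exact ⟨prepend a γ, ⟨h, rfl⟩, rfl⟩

end Shift

/-! ### The measure `P ∘ T` and the inverse Jacobian -/

section Jacobian

variable {𝒜 : Type*} [MeasurableSpace 𝒜]

/-- The measure `P ∘ T`, `E ↦ ∑ₐ P (T (E ∩ [a]))` for measurable `E ⊆ Ω_S`, regarded as a measure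
on the full sequence space which is carried by `Ω_S`. Here `T (E ∩ [a])` is written as the
preimage of `E` under `ω ↦ a · ω`; see `compShift_apply` for the formula with images. -/
noncomputable def compShift (S : Matrix 𝒜 𝒜 ℕ) (P : Measure (ℕ → 𝒜)) : Measure (ℕ → 𝒜) :=
  Measure.sum fun a : 𝒜 => (P.map (prepend a)).restrict (markovShift S)

/-- The inverse Jacobian `dP / d(P ∘ T)`, defined up to `P ∘ T`-null sets. -/
noncomputable def inverseJacobian (S : Matrix 𝒜 𝒜 ℕ) (P : Measure (ℕ → 𝒜)) : (ℕ → 𝒜) → ℝ :=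
  fun ω => (P.rnDeriv (compShift S P) ω).toReal

theorem measurable_shift : Measurable (shift : (ℕ → 𝒜) → ℕ → 𝒜) :=
  measurable_pi_lambda _ fun _ => measurable_pi_apply _

theorem measurable_prepend (a : 𝒜) : Measurable (prepend a) := by
  refine measurable_pi_lambda _ fun n => ?_
  cases n with
  | zero => exact measurable_const
  | succ n => exact measurable_pi_apply n

variable [DiscreteMeasurableSpace 𝒜] [Countable 𝒜]

theorem measurableSet_markovShift (S : Matrix 𝒜 𝒜 ℕ) : MeasurableSet (markovShift S) := by
  have : markovShift S = ⋂ j, (fun ω : ℕ → 𝒜 => (ω j, ω (j + 1))) ⁻¹' {p | S p.1 p.2 = 1} := by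
    ext ω
    simp [markovShift]
  rw [this]
  refine MeasurableSet.iInter fun j => ?_
  exact ((measurable_pi_apply j).prodMk (measurable_pi_apply (j + 1)))
    (Set.to_countable _).measurableSet

/-- The defining formula `(P ∘ T)(E) = ∑ₐ P (T (E ∩ [a]))`. -/
theorem compShift_apply (S : Matrix 𝒜 𝒜 ℕ) (P : Measure (ℕ → 𝒜)) {E : Set (ℕ → 𝒜)}
    (hE : MeasurableSet E) :
    compShift S P E = ∑' a : 𝒜, P (shift '' ((E ∩ markovShift S) ∩ {ω | ω 0 = a})) := by
  rw [compShift, Measure.sum_apply _ hE]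
  refine tsum_congr fun a => ?_
  rw [Measure.restrict_apply hE,
    Measure.map_apply (measurable_prepend a) (hE.inter (measurableSet_markovShift S)),
    shift_image_inter]

/-- `P ∘ T` is σ-finite. -/
theorem sigmaFinite_compShift (S : Matrix 𝒜 𝒜 ℕ) (P : Measure (ℕ → 𝒜)) [IsProbabilityMeasure P] :
    SigmaFinite (compShift S P) := by
  have hm : ∀ a : 𝒜, MeasurableSet {ω : ℕ → 𝒜 | ω 0 = a} := fun a =>
    (measurable_pi_apply (X := fun _ : ℕ => 𝒜) 0) (measurableSet_singleton a)
  refine ⟨⟨⟨fun n => {ω | ∃ a : 𝒜, ω 0 = a ∧ (Encodable.ofCountable 𝒜).encode a = n},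
    fun _ => trivial, fun n => ?_, ?_⟩⟩⟩
  · let _ := Encodable.ofCountable 𝒜
    by_cases h : ∃ b : 𝒜, Encodable.encode b = n
    · obtain ⟨b, hb⟩ := h
      have hset : {ω : ℕ → 𝒜 | ∃ a : 𝒜, ω 0 = a ∧ Encodable.encode a = n}
          = {ω | ω 0 = b} := by
        ext ω
        constructor
        · rintro ⟨a, h0, ha⟩
          exact h0.trans (Encodable.encode_injective (ha.trans hb.symm))
        · intro h0
          exact ⟨b, h0, hb⟩
      change compShift S P {ω : ℕ → 𝒜 | ∃ a : 𝒜, ω 0 = a ∧ Encodable.encode a = n} < ⊤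
      rw [hset, compShift_apply S P (hm b), tsum_eq_single b]
      · exact measure_lt_top P _
      · intro a hab
        have : (({ω : ℕ → 𝒜 | ω 0 = b} ∩ markovShift S) ∩ {ω | ω 0 = a}) = ∅ := by
          ext ω
          simp only [Set.mem_inter_iff, Set.mem_ofPred_eq, Set.mem_empty_iff_false, iff_false]
          rintro ⟨⟨h1, -⟩, h2⟩
          exact hab (h2.symm.trans h1)
        rw [this, Set.image_empty, measure_empty]
    · have hset : {ω : ℕ → 𝒜 | ∃ a : 𝒜, ω 0 = a ∧ Encodable.encode a = n} = ∅ := by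
        ext ω
        simp only [Set.mem_ofPred_eq, Set.mem_empty_iff_false, iff_false]
        rintro ⟨a, -, ha⟩
        exact h ⟨a, ha⟩
      change compShift S P {ω : ℕ → 𝒜 | ∃ a : 𝒜, ω 0 = a ∧ Encodable.encode a = n} < ⊤
      rw [hset, measure_empty]
      exact ENNReal.zero_lt_top
  · ext ω
    simp

/-- `P ≪ P ∘ T`, so that the inverse Jacobian makes sense. -/
theorem absolutelyContinuous_compShift (S : Matrix 𝒜 𝒜 ℕ) (P : Measure (ℕ → 𝒜))
    [IsProbabilityMeasure P] (hT : MeasurePreserving shift P P) (hS : P (markovShift S) = 1) :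
    P ≪ compShift S P := by
  refine Measure.AbsolutelyContinuous.mk fun E hE h0 => ?_
  rw [compShift_apply S P hE, ENNReal.tsum_eq_zero] at h0
  have hc : P (markovShift S)ᶜ = 0 :=
    (prob_compl_eq_zero_iff (measurableSet_markovShift S)).2 hS
  refine measure_mono_null (t := (⋃ a : 𝒜, (E ∩ markovShift S) ∩ {ω | ω 0 = a}) ∪
    (markovShift S)ᶜ) ?_ ?_
  · intro ω hω
    by_cases h : ω ∈ markovShift S
    · exact Or.inl (Set.mem_iUnion.2 ⟨ω 0, ⟨hω, h⟩, rfl⟩)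
    · exact Or.inr h
  · rw [measure_union_null_iff, measure_iUnion_null_iff]
    refine ⟨fun a => ?_, hc⟩
    have h1 := h0 a
    rw [shift_image_inter] at h1
    rw [← hT.measure_preimage
      (measurable_prepend a (hE.inter (measurableSet_markovShift S))).nullMeasurableSet] at h1
    refine measure_mono_null ?_ h1
    rw [← shift_image_inter]
    exact Set.subset_preimage_image _ _

end Jacobian

/-! ### The counts of multiple recurrences -/

section Counts

variable {𝒜 : Type*}

/-- `X_k^A = ∏ⱼ 1_A ∘ T^{d_j k}`. -/
noncomputable def recurrence {ℓ : ℕ} (d : Fin ℓ → ℕ) (A : Set (ℕ → 𝒜)) (k : ℕ) (ω : ℕ → 𝒜) : ℕ :=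
  ∏ j, A.indicator 1 (shift^[d j * k] ω)

/-- `S_N^A = ∑_{k = 1}^N X_k^A`. -/
noncomputable def recurrenceCount {ℓ : ℕ} (d : Fin ℓ → ℕ) (A : Set (ℕ → 𝒜)) (N : ℕ)
    (ω : ℕ → 𝒜) : ℕ :=
  ∑ k ∈ Finset.Icc 1 N, recurrence d A k ω

/-- `N_n^ω = [t · P(A_n^ω)^{-ℓ}]`, with the cylinder `A_n^ω = [ω₀, …, ω_{n-1}]`. -/
noncomputable def timeScale [MeasurableSpace 𝒜] (P : Measure (ℕ → 𝒜)) (t : ℝ) (ℓ : ℕ)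
    (ω : ℕ → 𝒜) (n : ℕ) : ℕ :=
  ⌊t * (P.real (PiNat.cylinder ω n) ^ ℓ)⁻¹⌋₊

/-- `κ(r) = lcm { r / gcd(r, d_j) : j }` (the divisions are exact). -/
def kappa {ℓ : ℕ} (d : Fin ℓ → ℕ) (r : ℕ) : ℕ :=
  Finset.univ.lcm fun j => r / Nat.gcd r (d j)

/-- `a = (κ(r) / r) · ∑ᵢ dᵢ`. -/
noncomputable def recurrenceExponent {ℓ : ℕ} (d : Fin ℓ → ℕ) (r : ℕ) : ℝ :=
  (kappa d r : ℝ) / (r : ℝ) * ∑ i, (d i : ℝ)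

/-- `ρ_ω = (∏_{j < r} J(T^j ω))^a`. -/
noncomputable def clusterParameter {ℓ : ℕ} (d : Fin ℓ → ℕ) (J : (ℕ → 𝒜) → ℝ) (ω : ℕ → 𝒜)
    (r : ℕ) : ℝ :=
  (∏ j ∈ Finset.range r, J (shift^[j] ω)) ^ recurrenceExponent d r

end Counts

/-! ### The Pólya–Aeppli distribution -/

section PolyaAeppli

/-- The weights of the Pólya–Aeppli distribution. -/
noncomputable def polyaAeppliWeight (t p : ℝ) (k : ℕ) : ℝ :=
  if k = 0 then Real.exp (-t)
  else Real.exp (-t) * ∑ j ∈ Finset.Icc 1 k,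
    ((k - 1).choose (j - 1) : ℝ) * (t ^ j / (j.factorial : ℝ)) * p ^ (k - j) * (1 - p) ^ j

theorem polyaAeppliWeight_nonneg {t p : ℝ} (ht : 0 < t) (hp : p ∈ Set.Ico (0 : ℝ) 1) (k : ℕ) :
    0 ≤ polyaAeppliWeight t p k := by
  have h0 := hp.1
  have h1 : 0 ≤ 1 - p := by linarith [hp.2]
  unfold polyaAeppliWeight
  split_ifs <;> positivity

theorem hasSum_polyaAeppliWeight {t p : ℝ} (ht : 0 < t) (hp : p ∈ Set.Ico (0 : ℝ) 1) :
    HasSum (polyaAeppliWeight t p) 1 := by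
  have h0 := hp.1
  have h1 : 0 < 1 - p := by linarith [hp.2]
  let f : ℕ × ℕ → ℝ := fun x =>
    (t ^ (x.1 + 1) / ((x.1 + 1).factorial : ℝ)) *
      ((1 - p) ^ (x.1 + 1) * (((x.2 + x.1).choose x.1 : ℝ) * p ^ x.2))
  have hf0 : ∀ x, 0 ≤ f x := fun x => by positivity
  have hin : ∀ i, HasSum (fun m => f (i, m)) (t ^ (i + 1) / ((i + 1).factorial : ℝ)) := by
    intro i
    have h := hasSum_choose_mul_geometric_of_norm_lt_one i (r := p)
      (by rw [Real.norm_of_nonneg h0]; exact hp.2)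
    have h' := (h.mul_left ((1 - p) ^ (i + 1))).mul_left (t ^ (i + 1) / ((i + 1).factorial : ℝ))
    have e : (1 - p) ^ (i + 1) * (1 / (1 - p) ^ (i + 1)) = 1 := by
      field_simp
    rw [e, mul_one] at h'
    exact h'
  have hexp : HasSum (fun i : ℕ => t ^ (i + 1) / ((i + 1).factorial : ℝ)) (Real.exp t - 1) := by
    have h := NormedSpace.expSeries_div_hasSum_exp (𝔸 := ℝ) t
    rw [← Real.exp_eq_exp_ℝ] at h
    rw [← hasSum_nat_add_iff' 1] at h
    simpa using h
  have hfs : Summable f := by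
    rw [summable_prod_of_nonneg hf0]
    refine ⟨fun i => (hin i).summable, ?_⟩
    simpa only [(hin _).tsum_eq] using hexp.summable
  have hfsum : HasSum f (Real.exp t - 1) := by
    have h := hfs.hasSum.prod_fiberwise hin
    rw [hexp.unique h]
    exact hfs.hasSum
  have hanti : HasSum (fun n => ∑ x ∈ Finset.HasAntidiagonal.antidiagonal n, f x) (Real.exp t - 1) := by
    have h2 := (Finset.HasAntidiagonal.sigmaAntidiagonalEquivProd (A := ℕ)).hasSum_iff.2 hfsum
    refine h2.sigma fun n => ?_
    have h3 := hasSum_fintype (fun x : Finset.HasAntidiagonal.antidiagonal n => f x)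
    rw [Finset.sum_coe_sort (Finset.HasAntidiagonal.antidiagonal n) f] at h3
    exact h3
  have hsucc : HasSum (fun n => polyaAeppliWeight t p (n + 1))
      (Real.exp (-t) * (Real.exp t - 1)) := by
    refine (hanti.mul_left (Real.exp (-t))).congr_fun ?_
    intro n
    unfold polyaAeppliWeight
    rw [if_neg (Nat.succ_ne_zero n), Finset.Nat.sum_antidiagonal_eq_sum_range_succ_mk]
    congr 1
    rw [← Finset.Ico_add_one_right_eq_Icc, Finset.sum_Ico_eq_sum_range]
    refine Finset.sum_congr (by simp) fun i hi => ?_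
    have hi' : i ≤ n := by
      have := Finset.mem_range.1 hi
      omega
    have e1 : n + 1 - 1 = n := by omega
    have e2 : i + 1 - 1 = i := by omega
    have e3 : n + 1 - (i + 1) = n - i := by omega
    have e4 : n - i + i = n := by omega
    rw [add_comm 1 i]
    simp only [f, e1, e2, e3, e4]
    ring
  rw [← hasSum_nat_add_iff' 1]
  have e : Real.exp (-t) * (Real.exp t - 1) = 1 - ∑ i ∈ Finset.range 1, polyaAeppliWeight t p i := by
    have : Real.exp (-t) * Real.exp t = 1 := by rw [← Real.exp_add]; simp
    simp only [Finset.sum_range_one, polyaAeppliWeight, if_true]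
    linarith
  rw [← e]
  exact hsucc

/-- The Pólya–Aeppli distribution `PA(t, p)` on `ℕ`, for `t > 0` and `p ∈ [0, 1)`. -/
noncomputable def polyaAeppli (t p : ℝ) (ht : 0 < t) (hp : p ∈ Set.Ico (0 : ℝ) 1) : PMF ℕ :=
  ⟨fun k => ENNReal.ofReal (polyaAeppliWeight t p k), by
    have h := hasSum_polyaAeppliWeight ht hp
    have h2 := ENNReal.ofReal_tsum_of_nonneg (polyaAeppliWeight_nonneg ht hp) h.summable
    rw [h.tsum_eq, ENNReal.ofReal_one] at h2
    rw [h2]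
    exact ENNReal.summable.hasSum⟩

end PolyaAeppli

end ShiftRecurrence

set_option linter.unusedSectionVars false

namespace ShiftRecurrence

/-! ### Events of finitely many coordinates, and ψ-mixing with a prescribed gap -/

section Local

variable {𝒜 : Type*}

/-! Write `p = P(A_n)`, call `k` a hit when all blocks at the places `d_j k` read `A_n`, let `X_k`
be its indicator and `F(z) = E z^S`. Then `F'(z) = ∑_k E[X_k z^(S-1)]`. The proof shows that `F' ≈ t
g² F` on `[0,1]` with `g = (1-ρ)/(1-ρz)`. Since `F(1) = 1`, this forces `F` to be close to
`exp(-t(1-ρ)(1-z)/(1-ρz))`, the generating function of `PA(t(1-ρ), ρ)`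
(`abs_sub_exp_le_of_approx_ode`, `integral_pow_polyaAeppli`). Convergence of generating functions on
`(0,1)` gives convergence in distribution.

Decoupling. Around a fixed `k` the other indices split into near ones (distance at most `n`), far
ones (all blocks well away from those of `k`) and the remaining ones. There are `O(n)` of the last
kind, and each is hit jointly with `k` with probability `O(p^(ℓ+1))`; as `n p → 0`, they are
negligible. Near and far coordinates are separated by at most `2ℓ` gaps of length `n`, so ψ-mixing
makes them independent up to a small relative error (`almostIndep_of_cuts`). Hence `E[X_k z^(S-1)] ≈
E[X_k z^(near hits)] F(z)`, which is `abs_integral_recurrence_mul_pow_sub_le`.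

Clusters. If two hits at distance `s ≤ n` overlap by at least `r` letters in every block, minimality
of the period forces `r ∣ d_j s` for all `j`, that is `κ ∣ s`; conversely two such hits fill in
every multiple of `κ` between them. So the near hits form one run on each side of `k`, up to lags
that cost an extra factor `P(A_{n-r})`. Hits at both `k` and `k + κq` amount to `ℓ` longer words, of
total probability about `p^ℓ ρ^q`. Both runs are thus geometric, and `E[X_k z^(near hits)] ≈ p^ℓ g²`
(`eventually_abs_integral_neighbour_sub_le`). Summing over about `t p^(-ℓ)` indices yields the
differential equation.

The ratio. Continuity of `J` gives `P[x_0..x_n] / P[x_1..x_n] → J(x)` for `x` in the support; along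
one period these limits multiply to `P(A_{n+r})/P(A_n) → θ = ∏ J(T^j ω)`. Then `ρ = θ^(∑ e_j)` with
`e_j = d_j κ / r`, and `θ < 1` because the cylinders decay geometrically. -/

theorem shift_iterate_apply (p : ℕ) (x : ℕ → 𝒜) (i : ℕ) : shift^[p] x i = x (i + p) := by
  induction p generalizing x with
  | zero => rfl
  | succ p ih =>
    rw [Function.iterate_succ_apply, ih]
    simp only [shift]
    congr 1

/-- `E` depends only on the first `n` coordinates. -/
def IsLocal (n : ℕ) (E : Set (ℕ → 𝒜)) : Prop :=
  ∀ x y : ℕ → 𝒜, (∀ i < n, x i = y i) → x ∈ E → y ∈ E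

theorem IsLocal.mono {n m : ℕ} {E : Set (ℕ → 𝒜)} (h : IsLocal n E) (hnm : n ≤ m) :
    IsLocal m E :=
  fun x y hxy hx => h x y (fun i hi => hxy i (hi.trans_le hnm)) hx

theorem IsLocal.inter {n : ℕ} {E F : Set (ℕ → 𝒜)} (hE : IsLocal n E) (hF : IsLocal n F) :
    IsLocal n (E ∩ F) :=
  fun x y hxy hx => ⟨hE x y hxy hx.1, hF x y hxy hx.2⟩

theorem IsLocal.preimage {n : ℕ} {E : Set (ℕ → 𝒜)} (hE : IsLocal n E) (p : ℕ) :
    IsLocal (p + n) (shift^[p] ⁻¹' E) := by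
  intro x y hxy hx
  refine hE _ _ (fun i hi => ?_) hx
  rw [shift_iterate_apply, shift_iterate_apply]
  exact hxy _ (by omega)

theorem isLocal_cylinder (x : ℕ → 𝒜) (n : ℕ) : IsLocal n (PiNat.cylinder x n) := by
  intro y y' hy h i hi
  rw [← hy i hi]
  exact h i hi

variable [MeasurableSpace 𝒜] [DiscreteMeasurableSpace 𝒜]

theorem coordSigma_le (J : Set ℕ) :
    coordSigma J ≤ (inferInstance : MeasurableSpace (ℕ → 𝒜)) := by
  refine MeasurableSpace.generateFrom_le ?_
  rintro _ ⟨j, -, a, rfl⟩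
  exact (measurable_pi_apply (X := fun _ : ℕ => 𝒜) j) (measurableSet_singleton a)

variable [Countable 𝒜]

/-- There are only countably many words of length `n` over a countable alphabet, so `E` is the
countable union of the cylinders of the words it realises. -/
theorem IsLocal.measurableSet_coordSigma {n : ℕ} {E : Set (ℕ → 𝒜)} (hE : IsLocal n E) :
    MeasurableSet[coordSigma (Set.Iio n)] E := by
  have h : E = ⋃ w : {w : Fin n → 𝒜 // ∃ x ∈ E, ∀ i : Fin n, x i = w i},
      ⋂ i : Fin n, {y : ℕ → 𝒜 | y i = w.1 i} := by
    ext y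
    simp only [Set.mem_iUnion, Set.mem_iInter, Set.mem_ofPred_eq]
    constructor
    · intro hy
      exact ⟨⟨fun i => y i, y, hy, fun _ => rfl⟩, fun _ => rfl⟩
    · rintro ⟨⟨w, x, hx, hxw⟩, hy⟩
      exact hE x y (fun i hi => (hxw ⟨i, hi⟩).trans (hy ⟨i, hi⟩).symm) hx
  rw [h]
  let _ : MeasurableSpace (ℕ → 𝒜) := coordSigma (Set.Iio n)
  refine MeasurableSet.iUnion fun w => MeasurableSet.iInter fun i => ?_
  exact MeasurableSpace.measurableSet_generateFrom ⟨i, i.2, w.1 i, rfl⟩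

theorem IsLocal.measurableSet {n : ℕ} {E : Set (ℕ → 𝒜)} (hE : IsLocal n E) : MeasurableSet E :=
  coordSigma_le _ _ hE.measurableSet_coordSigma

theorem measurableSet_cylinder (x : ℕ → 𝒜) (n : ℕ) : MeasurableSet (PiNat.cylinder x n) :=
  (isLocal_cylinder x n).measurableSet

/-- Events depending on the first `n` coordinates and events depending on the coordinates from
`n + m` on are independent up to a relative error `δ`. -/
def MixesAt (P : Measure (ℕ → 𝒜)) (m : ℕ) (δ : ℝ) : Prop :=
  ∀ (n : ℕ) (E F : Set (ℕ → 𝒜)), IsLocal n E → MeasurableSet F →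
    |P.real (E ∩ shift^[n + m] ⁻¹' F) - P.real E * P.real F| ≤ δ * (P.real E * P.real F)

theorem IsPsiMixing.exists_mixesAt {P : Measure (ℕ → 𝒜)} (h : IsPsiMixing P) :
    ∃ ψ : ℕ → ℝ, (∀ m, 0 ≤ ψ m) ∧ Tendsto ψ atTop (𝓝 0) ∧ ∀ m, MixesAt P m (ψ m) := by
  obtain ⟨ψ, h0, h1, h2⟩ := h
  refine ⟨ψ, h0, h1, fun m n E F hE hF => ?_⟩
  rw [← mul_assoc]
  exact h2 m n E F hE.measurableSet_coordSigma hF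

variable {P : Measure (ℕ → 𝒜)} {m : ℕ} {δ : ℝ}

/-- A gap longer than needed is absorbed by regarding `E` as depending on the first `p - m`
coordinates. -/
theorem MixesAt.abs_sub_le (h : MixesAt P m δ) {n p : ℕ} (hp : n + m ≤ p) {E F : Set (ℕ → 𝒜)}
    (hE : IsLocal n E) (hF : MeasurableSet F) :
    |P.real (E ∩ shift^[p] ⁻¹' F) - P.real E * P.real F| ≤ δ * (P.real E * P.real F) := by
  have := h (p - m) E F (hE.mono (by omega)) hF
  rwa [Nat.sub_add_cancel (by omega)] at this

theorem MixesAt.le (h : MixesAt P m δ) {n p : ℕ} (hp : n + m ≤ p) {E F : Set (ℕ → 𝒜)}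
    (hE : IsLocal n E) (hF : MeasurableSet F) :
    P.real (E ∩ shift^[p] ⁻¹' F) ≤ (1 + δ) * (P.real E * P.real F) := by
  have := (abs_le.1 (h.abs_sub_le hp hE hF)).2
  linarith

theorem MixesAt.ge (h : MixesAt P m δ) {n p : ℕ} (hp : n + m ≤ p) {E F : Set (ℕ → 𝒜)}
    (hE : IsLocal n E) (hF : MeasurableSet F) :
    (1 - δ) * (P.real E * P.real F) ≤ P.real (E ∩ shift^[p] ⁻¹' F) := by
  have := (abs_le.1 (h.abs_sub_le hp hE hF)).1
  linarith

theorem measureReal_preimage_shift_iterate (hT : MeasurePreserving shift P P) (p : ℕ)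
    {F : Set (ℕ → 𝒜)} (hF : MeasurableSet F) : P.real (shift^[p] ⁻¹' F) = P.real F :=
  (hT.iterate p).measureReal_preimage hF.nullMeasurableSet

end Local

/-! ### Decay of cylinder probabilities and their ratios along a periodic orbit -/

section Asymptotics

variable {𝒜 : Type*} [MeasurableSpace 𝒜] [DiscreteMeasurableSpace 𝒜] [Countable 𝒜]
  {P : Measure (ℕ → 𝒜)} [IsProbabilityMeasure P]

theorem cylinder_add (x : ℕ → 𝒜) (p n : ℕ) :
    PiNat.cylinder x (p + n) =
      PiNat.cylinder x p ∩ shift^[p] ⁻¹' PiNat.cylinder (shift^[p] x) n := by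
  ext y
  simp only [Set.mem_inter_iff, Set.mem_preimage, PiNat.mem_cylinder_iff, shift_iterate_apply]
  constructor
  · intro h
    exact ⟨fun i hi => h i (by omega), fun i hi => h _ (by omega)⟩
  · rintro ⟨h1, h2⟩ i hi
    by_cases hip : i < p
    · exact h1 i hip
    · have := h2 (i - p) (by omega)
      rwa [Nat.sub_add_cancel (by omega)] at this

theorem shift_iterate_mul_eq {x : ℕ → 𝒜} {r : ℕ} (hx : shift^[r] x = x) (q : ℕ) :
    shift^[r * q] x = x := by
  rw [Function.iterate_mul]
  exact Function.iterate_fixed hx q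

theorem measureReal_cylinder_anti (x : ℕ → 𝒜) {m n : ℕ} (h : m ≤ n) :
    P.real (PiNat.cylinder x n) ≤ P.real (PiNat.cylinder x m) :=
  measureReal_mono (PiNat.cylinder_anti x h)

/-- By periodicity the longer cylinder forces the first letter of `x` and, `r * e` places later, the
whole cylinder of length `n`. Mixing across the gap bounds this by `(1 + ψ g) P[x_0]` times the
shorter probability, and `P[x_0] < 1` leaves room to choose `g`. -/
theorem exists_measureReal_cylinder_decay (hψ : IsPsiMixing P)
    (hP : ∀ a : 𝒜, P {ω | ω 0 = a} < 1) {x : ℕ → 𝒜} {r : ℕ} (hr : 0 < r)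
    (hx : shift^[r] x = x) :
    ∃ (e : ℕ) (b : ℝ), 0 < e ∧ 0 ≤ b ∧ b < 1 ∧
      ∀ n, P.real (PiNat.cylinder x (n + r * e)) ≤ b * P.real (PiNat.cylinder x n) := by
  obtain ⟨ψ, h0, h1, h2⟩ := hψ.exists_mixesAt
  have hc : PiNat.cylinder x 1 = {y | y 0 = x 0} := by
    ext y
    simp [PiNat.mem_cylinder_iff]
  have hq : P.real (PiNat.cylinder x 1) < 1 := by
    rw [hc, measureReal_def, ← ENNReal.toReal_one]
    exact (ENNReal.toReal_lt_toReal (measure_ne_top _ _) ENNReal.one_ne_top).2 (hP _)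
  have hlim : Tendsto (fun g => (1 + ψ g) * P.real (PiNat.cylinder x 1)) atTop
      (𝓝 ((1 + 0) * P.real (PiNat.cylinder x 1))) := (h1.const_add 1).mul_const _
  rw [add_zero, one_mul] at hlim
  obtain ⟨g, hg⟩ := (hlim.eventually_lt_const hq).exists
  -- One letter followed by a gap of length `g` must fit into `r * e`; as `r ≥ 1`, `e = g + 1`
  -- suffices.
  refine ⟨g + 1, (1 + ψ g) * P.real (PiNat.cylinder x 1), by omega, ?_, hg, fun n => ?_⟩
  · have := h0 g
    positivity
  have hle : 1 + g ≤ r * (g + 1) := by nlinarith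
  calc P.real (PiNat.cylinder x (n + r * (g + 1)))
      ≤ P.real (PiNat.cylinder x 1 ∩ shift^[r * (g + 1)] ⁻¹' PiNat.cylinder x n) := by
        rw [add_comm, cylinder_add, shift_iterate_mul_eq hx]
        exact measureReal_mono
          (Set.inter_subset_inter_left _ (PiNat.cylinder_anti x (by omega)))
    _ ≤ _ := (h2 g).le hle (isLocal_cylinder x 1) (measurableSet_cylinder x n)
    _ = _ := by ring

theorem tendsto_mul_measureReal_cylinder (hψ : IsPsiMixing P)
    (hP : ∀ a : 𝒜, P {ω | ω 0 = a} < 1) {x : ℕ → 𝒜} {r : ℕ} (hr : 0 < r)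
    (hx : shift^[r] x = x) :
    Tendsto (fun n : ℕ => (n : ℝ) * P.real (PiNat.cylinder x n)) atTop (𝓝 0) := by
  obtain ⟨e, b, he, hb0, hb1, hdec⟩ := exists_measureReal_cylinder_decay hψ hP hr hx
  set L := r * e with hL
  have hLpos : 0 < L := Nat.mul_pos hr he
  have hpow : ∀ i : ℕ, P.real (PiNat.cylinder x (i * L)) ≤ b ^ i := by
    intro i
    induction i with
    | zero => simp
    | succ i ih =>
      rw [Nat.succ_mul, pow_succ, mul_comm (b ^ i)]
      exact (hdec _).trans (mul_le_mul_of_nonneg_left ih hb0)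
  have hlim : Tendsto (fun i : ℕ => (L : ℝ) * ((i : ℝ) * b ^ i + b ^ i)) atTop (𝓝 0) := by
    have := ((tendsto_self_mul_const_pow_of_lt_one hb0 hb1).add
      (tendsto_pow_atTop_nhds_zero_of_lt_one hb0 hb1)).const_mul (L : ℝ)
    simpa using this
  refine squeeze_zero (fun n => by positivity) (fun n => ?_)
    (hlim.comp (Nat.tendsto_div_const_atTop hLpos.ne'))
  have h1 : P.real (PiNat.cylinder x n) ≤ b ^ (n / L) :=
    (measureReal_cylinder_anti x (Nat.div_mul_le_self n L)).trans (hpow _)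
  have h2 : (n : ℝ) ≤ L * ((n / L : ℕ) + 1) := by
    have := Nat.lt_mul_div_succ n hLpos
    exact_mod_cast this.le
  calc (n : ℝ) * P.real (PiNat.cylinder x n) ≤ (L * ((n / L : ℕ) + 1)) * b ^ (n / L) := by
        gcongr
    _ = _ := by simp only [Function.comp]; ring

theorem shift_iterate_mem_markovShift {S : Matrix 𝒜 𝒜 ℕ} {x : ℕ → 𝒜} (hx : x ∈ markovShift S)
    (p : ℕ) : shift^[p] x ∈ markovShift S := by
  intro j
  rw [shift_iterate_apply, shift_iterate_apply, show j + 1 + p = j + p + 1 by omega]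
  exact hx (j + p)

variable [TopologicalSpace 𝒜] [DiscreteTopology 𝒜]

theorem isClosed_markovShift (S : Matrix 𝒜 𝒜 ℕ) : IsClosed (markovShift S) := by
  have : markovShift S = ⋂ j, (fun ω : ℕ → 𝒜 => (ω j, ω (j + 1))) ⁻¹' {p | S p.1 p.2 = 1} := by
    ext ω
    simp [markovShift]
  rw [this]
  refine isClosed_iInter fun j => IsClosed.preimage ?_ (isClosed_discrete _)
  exact (continuous_apply j).prodMk (continuous_apply (j + 1))

theorem measureReal_cylinder_pos {x : ℕ → 𝒜} (hx : x ∈ P.support) (n : ℕ) :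
    0 < P.real (PiNat.cylinder x n) := by
  rw [Measure.mem_support_iff_forall] at hx
  exact ENNReal.toReal_pos (hx _ ((PiNat.isOpen_cylinder _ x n).mem_nhds
    (PiNat.self_mem_cylinder x n))).ne' (measure_ne_top _ _)

theorem mem_markovShift_of_mem_support {S : Matrix 𝒜 𝒜 ℕ} (hPS : P (markovShift S) = 1)
    {x : ℕ → 𝒜} (hx : x ∈ P.support) : x ∈ markovShift S := by
  by_contra h
  rw [Measure.mem_support_iff_forall] at hx
  have := hx _ ((isClosed_markovShift S).isOpen_compl.mem_nhds h)
  rw [(prob_compl_eq_zero_iff (measurableSet_markovShift S)).2 hPS] at this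
  exact lt_irrefl _ this

theorem exists_cylinder_subset {x : ℕ → 𝒜} {U : Set (ℕ → 𝒜)} (hU : U ∈ 𝓝 x) :
    ∃ n, PiNat.cylinder x n ⊆ U := by
  obtain ⟨V, hV, hVo, hxV⟩ := mem_nhds_iff.1 hU
  obtain ⟨s, ⟨y, n, rfl⟩, hxs, hs⟩ :=
    (PiNat.isTopologicalBasis_cylinders (fun _ : ℕ => 𝒜)).exists_subset_of_mem_open hxV hVo
  rw [PiNat.mem_cylinder_iff_eq] at hxs
  exact ⟨n, by rw [hxs]; exact hs.trans hV⟩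

/-- The length is at least two so that the second letter is prescribed as well: prepending `x 0` to
`y` then stays in the Markov shift, because the transition from `x 0` to `y 0 = x 1` is allowed. -/
theorem compShift_cylinder {S : Matrix 𝒜 𝒜 ℕ} (hPS : P (markovShift S) = 1) {x : ℕ → 𝒜}
    (hx : x ∈ markovShift S) (n : ℕ) :
    compShift S P (PiNat.cylinder x (n + 2)) = P (PiNat.cylinder (shift x) (n + 1)) := by
  have hc : P (markovShift S)ᶜ = 0 :=
    (prob_compl_eq_zero_iff (measurableSet_markovShift S)).2 hPS
  rw [compShift_apply S P (measurableSet_cylinder x _), tsum_eq_single (x 0)]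
  · rw [shift_image_inter]
    have hset : prepend (x 0) ⁻¹' (PiNat.cylinder x (n + 2) ∩ markovShift S)
        = PiNat.cylinder (shift x) (n + 1) ∩ markovShift S := by
      ext y
      simp only [Set.mem_preimage, Set.mem_inter_iff, PiNat.mem_cylinder_iff]
      constructor
      · rintro ⟨h1, h2⟩
        exact ⟨fun i hi => h1 (i + 1) (by omega), fun j => h2 (j + 1)⟩
      · rintro ⟨h1, h2⟩
        refine ⟨fun i hi => ?_, fun j => ?_⟩
        · cases i with
          | zero => rfl
          | succ i => exact h1 i (by omega)
        · cases j with
          | zero =>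
            change S (x 0) (y 0) = 1
            rw [h1 0 (by omega)]
            exact hx 0
          | succ j => exact h2 j
    rw [hset]
    exact measure_inter_conull hc
  · intro a ha
    have : ((PiNat.cylinder x (n + 2) ∩ markovShift S) ∩ {ω | ω 0 = a}) = ∅ := by
      ext y
      simp only [Set.mem_inter_iff, PiNat.mem_cylinder_iff, Set.mem_ofPred_eq,
        Set.mem_empty_iff_false, iff_false]
      rintro ⟨⟨h1, -⟩, h2⟩
      exact ha (h2.symm.trans (h1 0 (by omega)))
    rw [this, Set.image_empty, measure_empty]

/-- The probability of a cylinder around `x` is the integral of the inverse Jacobian over it with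
respect to `P ∘ T`. On a small cylinder the integrand is close to `J x` by continuity, and the `P ∘
T`-mass is the probability of the shifted cylinder. -/
theorem tendsto_cylinder_ratio_jacobian (hT : MeasurePreserving shift P P)
    {S : Matrix 𝒜 𝒜 ℕ} (hPS : P (markovShift S) = 1)
    {J : (ℕ → 𝒜) → ℝ} (hJ : inverseJacobian S P =ᵐ[compShift S P] J)
    (hJc : ContinuousOn J (markovShift S)) {x : ℕ → 𝒜} (hx : x ∈ markovShift S)
    (hpos : ∀ n, 0 < P.real (PiNat.cylinder (shift x) n)) :
    Tendsto (fun n => P.real (PiNat.cylinder x (n + 1)) / P.real (PiNat.cylinder (shift x) n))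
      atTop (𝓝 (J x)) := by
  have hsf := sigmaFinite_compShift S P
  have hac := absolutelyContinuous_compShift S P hT hPS
  -- Continuity of `J` is only relative to the Markov shift, so it matters that `P ∘ T` is carried
  -- by it.
  have hsupp : ∀ᵐ y ∂(compShift S P), y ∈ markovShift S := by
    rw [ae_iff]
    change compShift S P (markovShift S)ᶜ = 0
    rw [compShift, Measure.sum_apply _ (measurableSet_markovShift S).compl, ENNReal.tsum_eq_zero]
    intro a
    exact Measure.restrict_apply_eq_zero' (measurableSet_markovShift S) |>.2 (by simp)
  rw [← tendsto_add_atTop_iff_nat 1, Metric.tendsto_atTop]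
  intro ε hε
  have hnear := hJc x hx (Metric.ball_mem_nhds (J x) (half_pos hε))
  rw [mem_map, mem_nhdsWithin_iff_exists_mem_nhds_inter] at hnear
  obtain ⟨u, hu, hsub⟩ := hnear
  obtain ⟨n₀, hn₀⟩ := exists_cylinder_subset hu
  refine ⟨n₀, fun n hn => ?_⟩
  set C := PiNat.cylinder x (n + 1 + 1) with hC
  have hCm : MeasurableSet C := measurableSet_cylinder x _
  have hν : compShift S P C = P (PiNat.cylinder (shift x) (n + 1)) := compShift_cylinder hPS hx n
  have hνr : (compShift S P).real C = P.real (PiNat.cylinder (shift x) (n + 1)) := by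
    rw [measureReal_def, hν, measureReal_def]
  have hνfin : compShift S P C ≠ ⊤ := by rw [hν]; exact measure_ne_top _ _
  have hint : ∫ y in C, inverseJacobian S P y ∂(compShift S P) = P.real C :=
    Measure.setIntegral_toReal_rnDeriv hac C
  have hIntble : IntegrableOn (inverseJacobian S P) C (compShift S P) :=
    (Measure.integrable_toReal_rnDeriv).integrableOn
  have hdiff : P.real C - J x * (compShift S P).real C
      = ∫ y in C, (inverseJacobian S P y - J x) ∂(compShift S P) := by
    rw [integral_sub hIntble (integrableOn_const hνfin), hint, setIntegral_const, smul_eq_mul,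
      mul_comm]
  have hb : |P.real C - J x * (compShift S P).real C| ≤ ε / 2 * (compShift S P).real C := by
    rw [hdiff, ← Real.norm_eq_abs]
    refine norm_setIntegral_le_of_norm_le_const_ae' hνfin.lt_top ?_
    filter_upwards [hJ, hsupp] with y hy hyS hyC
    rw [hy]
    have : y ∈ u ∩ markovShift S := ⟨hn₀ (PiNat.cylinder_anti x (by omega) hyC), hyS⟩
    exact (hsub this).le
  have hp := hpos (n + 1)
  rw [hνr] at hb
  rw [Real.dist_eq, show P.real C / P.real (PiNat.cylinder (shift x) (n + 1)) - J x
    = (P.real C - J x * P.real (PiNat.cylinder (shift x) (n + 1))) /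
      P.real (PiNat.cylinder (shift x) (n + 1)) by field_simp, abs_div, abs_of_pos hp,
    div_lt_iff₀ hp]
  nlinarith

theorem measureReal_cylinder_shift_iterate_pos (hT : MeasurePreserving shift P P) {x : ℕ → 𝒜}
    (hx : x ∈ P.support) (p n : ℕ) : 0 < P.real (PiNat.cylinder (shift^[p] x) n) := by
  have h := measureReal_cylinder_pos hx (p + n)
  rw [cylinder_add] at h
  rw [← measureReal_preimage_shift_iterate hT p (measurableSet_cylinder (shift^[p] x) n)]
  exact h.trans_le (measureReal_mono Set.inter_subset_right)

/-- The ratio telescopes along the orbit into one-step ratios, each converging to a value of `J`. -/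
theorem tendsto_cylinder_ratio_prod (hT : MeasurePreserving shift P P)
    {S : Matrix 𝒜 𝒜 ℕ} (hPS : P (markovShift S) = 1)
    {J : (ℕ → 𝒜) → ℝ} (hJ : inverseJacobian S P =ᵐ[compShift S P] J)
    (hJc : ContinuousOn J (markovShift S)) {x : ℕ → 𝒜} (hx : x ∈ P.support) (p : ℕ) :
    Tendsto (fun n => P.real (PiNat.cylinder x (n + p)) / P.real (PiNat.cylinder (shift^[p] x) n))
      atTop (𝓝 (∏ j ∈ Finset.range p, J (shift^[j] x))) := by
  induction p with
  | zero =>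
    refine tendsto_const_nhds.congr fun n => ?_
    simp [(measureReal_cylinder_pos hx n).ne']
  | succ p ih =>
    have hstep := tendsto_cylinder_ratio_jacobian hT hPS hJ hJc
      (shift_iterate_mem_markovShift (mem_markovShift_of_mem_support hPS hx) p) (fun n => by
        have := measureReal_cylinder_shift_iterate_pos hT hx (p + 1) n
        rwa [Function.iterate_succ_apply'] at this)
    rw [Finset.prod_range_succ]
    refine ((ih.comp (tendsto_add_atTop_nat 1)).mul hstep).congr fun n => ?_
    simp only [Function.comp]
    rw [← Function.iterate_succ_apply' shift p x, show n + 1 + p = n + (p + 1) by omega]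
    rw [div_mul_div_cancel₀ (measureReal_cylinder_shift_iterate_pos hT hx p (n + 1)).ne']

theorem tendsto_cylinder_ratio_pow {x : ℕ → 𝒜} (hx : x ∈ P.support) {r : ℕ} {θ : ℝ}
    (hθ : Tendsto (fun n => P.real (PiNat.cylinder x (n + r)) / P.real (PiNat.cylinder x n))
      atTop (𝓝 θ)) (q : ℕ) :
    Tendsto (fun n => P.real (PiNat.cylinder x (n + r * q)) / P.real (PiNat.cylinder x n))
      atTop (𝓝 (θ ^ q)) := by
  induction q with
  | zero =>
    refine tendsto_const_nhds.congr fun n => ?_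
    simp [(measureReal_cylinder_pos hx n).ne']
  | succ q ih =>
    rw [pow_succ']
    refine ((hθ.comp (tendsto_add_atTop_nat (r * q))).mul ih).congr fun n => ?_
    simp only [Function.comp]
    rw [show n + r * q + r = n + r * (q + 1) by ring,
      div_mul_div_cancel₀ (measureReal_cylinder_pos hx _).ne']

/-- The geometric decay bounds some power `θ ^ e` by a number below one. -/
theorem cylinder_ratio_limit_mem_Ico (hψ : IsPsiMixing P)
    (hP : ∀ a : 𝒜, P {ω | ω 0 = a} < 1) {x : ℕ → 𝒜} (hx : x ∈ P.support) {r : ℕ} (hr : 0 < r)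
    (hxr : shift^[r] x = x) {θ : ℝ}
    (hθ : Tendsto (fun n => P.real (PiNat.cylinder x (n + r)) / P.real (PiNat.cylinder x n))
      atTop (𝓝 θ)) : θ ∈ Set.Ico (0 : ℝ) 1 := by
  have h0 : 0 ≤ θ := ge_of_tendsto' hθ fun n => by positivity
  obtain ⟨e, b, he, hb0, hb1, hdec⟩ := exists_measureReal_cylinder_decay hψ hP hr hxr
  have h1 : θ ^ e ≤ b := le_of_tendsto' (tendsto_cylinder_ratio_pow hx hθ e) fun n => by
    rw [div_le_iff₀ (measureReal_cylinder_pos hx n)]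
    exact hdec n
  refine ⟨h0, ?_⟩
  by_contra h
  exact absurd (h1.trans_lt hb1) (not_lt.2 (one_le_pow₀ (not_lt.1 h)))

end Asymptotics

/-! ### From atoms to integrals on countable spaces -/

section CountableComparison

variable {α : Type*} [Countable α] [MeasurableSpace α] [MeasurableSingletonClass α]

theorem summable_measureReal_singleton_mul (μ : Measure α) [IsFiniteMeasure μ] {h : α → ℝ}
    (h0 : ∀ x, 0 ≤ h x) (h1 : ∀ x, h x ≤ 1) : Summable fun x => μ.real {x} * h x := by
  have hs : Summable fun x => μ.real {x} := by
    refine ENNReal.summable_toReal ?_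
    have := lintegral_countable' (μ := μ) (fun _ : α => 1)
    simp only [lintegral_const, one_mul] at this
    rw [← this]
    exact measure_ne_top _ _
  exact hs.of_nonneg_of_le (fun x => mul_nonneg measureReal_nonneg (h0 x))
    (fun x => mul_le_of_le_one_right measureReal_nonneg (h1 x))

/-- A relative error on every atom survives summation against a nonnegative function. Here `μ` will
be the joint law of two words and `ν` the product of their laws. -/
theorem abs_integral_sub_integral_le_of_singleton (μ ν : Measure α) [IsFiniteMeasure μ]
    [IsFiniteMeasure ν] {ε : ℝ} (hμν : ∀ x, |μ.real {x} - ν.real {x}| ≤ ε * ν.real {x})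
    {h : α → ℝ} (h0 : ∀ x, 0 ≤ h x) (h1 : ∀ x, h x ≤ 1) :
    |∫ x, h x ∂μ - ∫ x, h x ∂ν| ≤ ε * ∫ x, h x ∂ν := by
  have hm : Measurable h := measurable_of_countable h
  have hb : ∀ x, ‖h x‖ ≤ 1 := fun x => by rw [Real.norm_of_nonneg (h0 x)]; exact h1 x
  have hi : ∀ (η : Measure α) [IsFiniteMeasure η], Integrable h η := fun η _ =>
    Integrable.of_bound hm.aestronglyMeasurable 1 (Eventually.of_forall hb)
  have sμ := summable_measureReal_singleton_mul μ h0 h1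
  have sν := summable_measureReal_singleton_mul ν h0 h1
  rw [integral_countable (hi μ), integral_countable (hi ν)]
  simp only [smul_eq_mul]
  rw [← sμ.tsum_sub sν, ← Real.norm_eq_abs]
  refine tsum_of_norm_bounded (sν.hasSum.mul_left ε) fun x => ?_
  rw [← sub_mul, norm_mul, Real.norm_eq_abs, Real.norm_of_nonneg (h0 x), ← mul_assoc]
  exact mul_le_mul_of_nonneg_right (hμν x) (h0 x)

end CountableComparison

/-! ### Almost independence of interleaved sets of coordinates -/

section Decorrelation

variable {𝒜 : Type*}

/-- The sequences that agree with `x` on the coordinates in `U`. -/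
def coordCylinder (U : Set ℕ) (x : ℕ → 𝒜) : Set (ℕ → 𝒜) := {y | ∀ i ∈ U, y i = x i}

theorem isLocal_coordCylinder {U : Set ℕ} {n : ℕ} (hU : ∀ u ∈ U, u < n) (x : ℕ → 𝒜) :
    IsLocal n (coordCylinder U x) := by
  intro y y' hy h i hi
  rw [← hy i (hU i hi)]
  exact h i hi

theorem coordCylinder_union (U V : Set ℕ) (x : ℕ → 𝒜) :
    coordCylinder (U ∪ V) x = coordCylinder U x ∩ coordCylinder V x := by
  ext y
  simp only [coordCylinder, Set.mem_ofPred_eq, Set.mem_inter_iff, Set.mem_union]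
  exact ⟨fun h => ⟨fun i hi => h i (Or.inl hi), fun i hi => h i (Or.inr hi)⟩,
    fun h i hi => hi.elim (h.1 i) (h.2 i)⟩

theorem coordCylinder_empty (x : ℕ → 𝒜) : coordCylinder ∅ x = Set.univ := by
  simp [coordCylinder]

theorem coordCylinder_eq_preimage {U : Set ℕ} {p : ℕ} (hU : ∀ u ∈ U, p ≤ u) (x : ℕ → 𝒜) :
    coordCylinder U x = shift^[p] ⁻¹' coordCylinder {i | i + p ∈ U} (shift^[p] x) := by
  ext y
  simp only [coordCylinder, Set.mem_ofPred_eq, Set.mem_preimage, shift_iterate_apply]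
  refine ⟨fun h i hi => h _ hi, fun h i hi => ?_⟩
  have := h (i - p)
  rw [Nat.sub_add_cancel (hU i hi)] at this
  exact this hi

variable [MeasurableSpace 𝒜] [DiscreteMeasurableSpace 𝒜]

theorem measurableSet_coordCylinder (U : Set ℕ) (x : ℕ → 𝒜) :
    MeasurableSet (coordCylinder U x) := by
  have : coordCylinder U x = ⋂ i ∈ U, (fun y : ℕ → 𝒜 => y i) ⁻¹' {x i} := by
    ext y
    simp [coordCylinder]
  rw [this]
  exact MeasurableSet.biInter (Set.to_countable _) fun i _ =>
    measurable_pi_apply i (measurableSet_singleton _)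

variable [Countable 𝒜] {P : Measure (ℕ → 𝒜)} [IsProbabilityMeasure P] {m : ℕ} {δ : ℝ}

theorem MixesAt.coordCylinder_le (hT : MeasurePreserving shift P P) (h : MixesAt P m δ)
    {E : Set (ℕ → 𝒜)} {b : ℕ} (hE : IsLocal b E) {U : Set ℕ} (hU : ∀ u ∈ U, b + m ≤ u)
    (x : ℕ → 𝒜) :
    P.real (E ∩ coordCylinder U x) ≤ (1 + δ) * (P.real E * P.real (coordCylinder U x)) ∧
    (1 - δ) * (P.real E * P.real (coordCylinder U x)) ≤ P.real (E ∩ coordCylinder U x) := by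
  have hm := measurableSet_coordCylinder {i | i + (b + m) ∈ U} (shift^[b + m] x)
  rw [coordCylinder_eq_preimage hU x, measureReal_preimage_shift_iterate hT _ hm]
  exact ⟨h.le le_rfl hE hm, h.ge le_rfl hE hm⟩

/-- Relative comparison of a joint probability with the product of the marginals. -/
def AlmostIndep (P : Measure (ℕ → 𝒜)) (δ : ℝ) (q : ℕ) (E F : Set (ℕ → 𝒜)) : Prop :=
  (1 - δ) ^ q * P.real (E ∩ F) ≤ (1 + δ) ^ q * (P.real E * P.real F) ∧
  (1 - δ) ^ q * (P.real E * P.real F) ≤ (1 + δ) ^ q * P.real (E ∩ F)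

theorem AlmostIndep.symm {q : ℕ} {E F : Set (ℕ → 𝒜)} (h : AlmostIndep P δ q E F) :
    AlmostIndep P δ q F E := by
  unfold AlmostIndep
  rw [Set.inter_comm, mul_comm (P.real F)]
  exact h

/-- Beyond the cut `b` only `U` has coordinates. That part factors out of the joint probability and
out of the probability of `U` alone, each time up to `1 ± δ`, so the comparison below `b` carries
over with one more factor on each side. -/
theorem almostIndep_of_last_cut (hT : MeasurePreserving shift P P) (h : MixesAt P m δ) (h0 : 0 ≤ δ)
    (h1 : δ ≤ 1) {q b : ℕ} {U V : Set ℕ} {x y : ℕ → 𝒜} (hU : ∀ u ∈ U, u < b ∨ b + m ≤ u)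
    (hV : ∀ v ∈ V, v < b)
    (ih : AlmostIndep P δ q (coordCylinder (U ∩ Set.Iio b) x) (coordCylinder V y)) :
    AlmostIndep P δ (q + 1) (coordCylinder U x) (coordCylinder V y) := by
  set U₀ := coordCylinder (U ∩ Set.Iio b) x with hU₀
  set U₁ := coordCylinder (U ∩ Set.Ici b) x with hU₁
  set W := coordCylinder V y with hW
  have hsplit : coordCylinder U x = U₀ ∩ U₁ := by
    rw [hU₀, hU₁, ← coordCylinder_union, ← Set.inter_union_distrib_left, Set.Iio_union_Ici,
      Set.inter_univ]
  have hU₁' : ∀ u ∈ U ∩ Set.Ici b, b + m ≤ u := by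
    rintro u ⟨hu, hub⟩
    exact (hU u hu).resolve_left (not_lt.2 hub)
  have hl₀ : IsLocal b U₀ := isLocal_coordCylinder (fun u hu => hu.2) x
  have hlW : IsLocal b W := isLocal_coordCylinder hV y
  obtain ⟨a1, a2⟩ := h.coordCylinder_le hT hl₀ hU₁' x
  obtain ⟨b1, b2⟩ := h.coordCylinder_le hT (hl₀.inter hlW) hU₁' x
  obtain ⟨c1, c2⟩ := ih
  rw [← hU₁] at a1 a2 b1 b2
  have hint : coordCylinder U x ∩ W = U₀ ∩ W ∩ U₁ := by
    rw [hsplit, Set.inter_right_comm]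
  unfold AlmostIndep
  rw [hint, hsplit]
  set pU := P.real (U₀ ∩ U₁)
  set pV := P.real W
  set p0 := P.real U₀
  set p1 := P.real U₁
  set p0V := P.real (U₀ ∩ W)
  set pall := P.real (U₀ ∩ W ∩ U₁)
  have n1 : 0 ≤ p1 := measureReal_nonneg
  have nV : 0 ≤ pV := measureReal_nonneg
  have e0 : 0 ≤ 1 - δ := by linarith
  have e1 : 0 ≤ 1 + δ := by linarith
  have f0 : 0 ≤ (1 - δ) ^ q := by positivity
  have f1 : 0 ≤ (1 + δ) ^ q := by positivity
  constructor
  · calc (1 - δ) ^ (q + 1) * pall ≤ (1 - δ) ^ (q + 1) * ((1 + δ) * (p0V * p1)) := by gcongr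
      _ = ((1 - δ) ^ q * p0V) * ((1 - δ) * (1 + δ) * p1) := by ring
      _ ≤ ((1 + δ) ^ q * (p0 * pV)) * ((1 - δ) * (1 + δ) * p1) :=
        mul_le_mul_of_nonneg_right c1 (by positivity)
      _ = (1 + δ) ^ (q + 1) * pV * ((1 - δ) * (p0 * p1)) := by ring
      _ ≤ (1 + δ) ^ (q + 1) * pV * pU := by gcongr
      _ = _ := by ring
  · calc (1 - δ) ^ (q + 1) * (pU * pV) ≤ (1 - δ) ^ (q + 1) * ((1 + δ) * (p0 * p1) * pV) := by
          gcongr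
      _ = ((1 - δ) ^ q * (p0 * pV)) * ((1 - δ) * (1 + δ) * p1) := by ring
      _ ≤ ((1 + δ) ^ q * p0V) * ((1 - δ) * (1 + δ) * p1) :=
        mul_le_mul_of_nonneg_right c2 (by positivity)
      _ = (1 + δ) ^ (q + 1) * ((1 - δ) * (p0V * p1)) := by ring
      _ ≤ _ := by gcongr

/-- Two sets of coordinates that are separated by the gaps of length `m` after the points
of `B` are almost independent. -/
theorem almostIndep_of_cuts (hT : MeasurePreserving shift P P) (h : MixesAt P m δ) (h0 : 0 ≤ δ)
    (h1 : δ ≤ 1) (B : Finset ℕ) (x y : ℕ → 𝒜) :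
    ∀ U V : Set ℕ, (∀ b ∈ B, ∀ u ∈ U, u < b ∨ b + m ≤ u) →
      (∀ b ∈ B, ∀ v ∈ V, v < b ∨ b + m ≤ v) →
      (∀ u ∈ U, ∀ v ∈ V, ∃ b ∈ B, (u < b ∧ b ≤ v) ∨ (v < b ∧ b ≤ u)) →
      AlmostIndep P δ B.card (coordCylinder U x) (coordCylinder V y) := by
  -- The largest cut is peeled off. Coordinates of `U` and `V` both lying beyond it would have no
  -- cut between them, so at most one of the two sets reaches past it, and that set is truncated
  -- there.
  induction B using Finset.induction_on_max with
  | empty =>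
    intro U V _ _ hsep
    have : U = ∅ ∨ V = ∅ := by
      by_contra! hne
      obtain ⟨u, hu⟩ := hne.1
      obtain ⟨v, hv⟩ := hne.2
      obtain ⟨b, hb, -⟩ := hsep u hu v hv
      simp at hb
    rcases this with rfl | rfl <;> simp [AlmostIndep, coordCylinder_empty]
  | insert b B hB ih =>
    intro U V hU hV hsep
    have hbB : b ∉ B := fun hb => lt_irrefl _ (hB b hb)
    rw [Finset.card_insert_of_notMem hbB]
    have hone : (∀ u ∈ U, u < b) ∨ (∀ v ∈ V, v < b) := by
      by_contra! hne
      obtain ⟨⟨u, hu, hub⟩, v, hv, hvb⟩ := hne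
      obtain ⟨c, hc, hcc⟩ := hsep u hu v hv
      have hcb : c ≤ b := by
        rcases Finset.mem_insert.1 hc with rfl | hc
        · exact le_rfl
        · exact (hB c hc).le
      omega
    have hsep' : ∀ u ∈ U, ∀ v ∈ V, u < b → v < b →
        ∃ c ∈ B, (u < c ∧ c ≤ v) ∨ (v < c ∧ c ≤ u) := by
      intro u hu v hv hub hvb
      obtain ⟨c, hc, hcc⟩ := hsep u hu v hv
      rcases Finset.mem_insert.1 hc with rfl | hc
      · omega
      · exact ⟨c, hc, hcc⟩
    have hUB : ∀ c ∈ B, ∀ u ∈ U, u < c ∨ c + m ≤ u :=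
      fun c hc => hU c (Finset.mem_insert_of_mem hc)
    have hVB : ∀ c ∈ B, ∀ v ∈ V, v < c ∨ c + m ≤ v :=
      fun c hc => hV c (Finset.mem_insert_of_mem hc)
    rcases hone with hUb | hVb
    · refine (almostIndep_of_last_cut hT h h0 h1 (hV b (Finset.mem_insert_self _ _)) hUb ?_).symm
      refine (ih U (V ∩ Set.Iio b) hUB (fun c hc v hv => hVB c hc v hv.1) ?_).symm
      exact fun u hu v hv => hsep' u hu v hv.1 (hUb u hu) hv.2
    · refine almostIndep_of_last_cut hT h h0 h1 (hU b (Finset.mem_insert_self _ _)) hVb ?_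
      refine ih (U ∩ Set.Iio b) V (fun c hc u hu => hUB c hc u hu.1) hVB ?_
      exact fun u hu v hv => hsep' u hu.1 v hv hu.2 (hVb v hv)

/-- The word formed by the coordinates in `U`. -/
def restrictWord (U : Finset ℕ) (x : ℕ → 𝒜) : U → 𝒜 := fun i => x i

theorem measurable_restrictWord (U : Finset ℕ) :
    Measurable (restrictWord U : (ℕ → 𝒜) → U → 𝒜) :=
  measurable_pi_lambda _ fun i => measurable_pi_apply (i : ℕ)

/-- Extend a word on the coordinates in `U` to a sequence. -/
noncomputable def extendWord [Nonempty 𝒜] (U : Finset ℕ) (w : U → 𝒜) : ℕ → 𝒜 :=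
  fun i => if h : i ∈ U then w ⟨i, h⟩ else Classical.arbitrary 𝒜

theorem apply_extendWord_restrictWord [Nonempty 𝒜] {U : Finset ℕ} {f : (ℕ → 𝒜) → ℝ}
    (hf : DependsOn f (U : Set ℕ)) (x : ℕ → 𝒜) : f (extendWord U (restrictWord U x)) = f x := by
  refine hf fun i hi => ?_
  have hi' : i ∈ U := hi
  simp [extendWord, restrictWord, hi']

theorem preimage_restrictWord_singleton [Nonempty 𝒜] (U : Finset ℕ) (w : U → 𝒜) :
    restrictWord U ⁻¹' {w} = coordCylinder (U : Set ℕ) (extendWord U w) := by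
  ext y
  simp only [Set.mem_preimage, Set.mem_singleton_iff, coordCylinder, Set.mem_ofPred_eq,
    Finset.mem_coe, funext_iff, Subtype.forall, restrictWord]
  refine forall_congr' fun i => forall_congr' fun hi => ?_
  simp [extendWord, hi]

/-- Functions of finitely many coordinates live on the countable space of words, where the atoms are
exactly the coordinate cylinders; almost independence of cylinders is thus a comparison of atoms of
the joint law and the product law. -/
theorem abs_integral_mul_sub_le [Nonempty 𝒜] {ε : ℝ} {U V : Finset ℕ} {f g : (ℕ → 𝒜) → ℝ}
    (hf : DependsOn f (U : Set ℕ)) (hg : DependsOn g (V : Set ℕ))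
    (f0 : ∀ x, 0 ≤ f x) (f1 : ∀ x, f x ≤ 1) (g0 : ∀ x, 0 ≤ g x) (g1 : ∀ x, g x ≤ 1)
    (hind : ∀ x y : ℕ → 𝒜,
      |P.real (coordCylinder (U : Set ℕ) x ∩ coordCylinder (V : Set ℕ) y) -
        P.real (coordCylinder (U : Set ℕ) x) * P.real (coordCylinder (V : Set ℕ) y)| ≤
      ε * (P.real (coordCylinder (U : Set ℕ) x) * P.real (coordCylinder (V : Set ℕ) y))) :
    |∫ x, f x * g x ∂P - (∫ x, f x ∂P) * ∫ x, g x ∂P| ≤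
      ε * ((∫ x, f x ∂P) * ∫ x, g x ∂P) := by
  have mU : Measurable (restrictWord U : (ℕ → 𝒜) → U → 𝒜) := measurable_restrictWord U
  have mV : Measurable (restrictWord V : (ℕ → 𝒜) → V → 𝒜) := measurable_restrictWord V
  have mUV : Measurable fun x : ℕ → 𝒜 => (restrictWord U x, restrictWord V x) := mU.prodMk mV
  have hPU : IsProbabilityMeasure (P.map (restrictWord U)) :=
    Measure.isProbabilityMeasure_map mU.aemeasurable
  have hPV : IsProbabilityMeasure (P.map (restrictWord V)) :=
    Measure.isProbabilityMeasure_map mV.aemeasurable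
  have hPUV : IsProbabilityMeasure (P.map fun x : ℕ → 𝒜 => (restrictWord U x, restrictWord V x)) :=
    Measure.isProbabilityMeasure_map mUV.aemeasurable
  have key := abs_integral_sub_integral_le_of_singleton
    (P.map fun x : ℕ → 𝒜 => (restrictWord U x, restrictWord V x))
    ((P.map (restrictWord U)).prod (P.map (restrictWord V))) (ε := ε) (fun w => ?_)
    (h := fun w => f (extendWord U w.1) * g (extendWord V w.2))
    (fun w => mul_nonneg (f0 _) (g0 _)) (fun w => mul_le_one₀ (f1 _) (g0 _) (g1 _))
  · rw [integral_prod_mul (fun u => f (extendWord U u)) (fun v => g (extendWord V v)),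
      integral_map mUV.aemeasurable (measurable_of_countable _).aestronglyMeasurable,
      integral_map mU.aemeasurable (measurable_of_countable _).aestronglyMeasurable,
      integral_map mV.aemeasurable (measurable_of_countable _).aestronglyMeasurable] at key
    simpa only [apply_extendWord_restrictWord hf, apply_extendWord_restrictWord hg] using key
  · obtain ⟨u, v⟩ := w
    have e1 : ((fun x : ℕ → 𝒜 => (restrictWord U x, restrictWord V x)) ⁻¹' {(u, v)}) =
        restrictWord U ⁻¹' {u} ∩ restrictWord V ⁻¹' {v} := by
      ext y
      simp [Prod.ext_iff]
    rw [map_measureReal_apply mUV (measurableSet_singleton _), e1,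
      ← Set.singleton_prod_singleton, measureReal_prod_prod,
      map_measureReal_apply mU (measurableSet_singleton _),
      map_measureReal_apply mV (measurableSet_singleton _),
      preimage_restrictWord_singleton, preimage_restrictWord_singleton]
    exact hind _ _

end Decorrelation

/-! ### Probabilities of hits and overlaps of two hits -/

section Blocks

variable {𝒜 : Type*} [MeasurableSpace 𝒜] [DiscreteMeasurableSpace 𝒜] [Countable 𝒜]
  {P : Measure (ℕ → 𝒜)} [IsProbabilityMeasure P]

theorem isLocal_biInter {ι : Type*} {s : Finset ι} {E : ι → Set (ℕ → 𝒜)} {n : ℕ}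
    (h : ∀ i ∈ s, IsLocal n (E i)) : IsLocal n (⋂ i ∈ s, E i) := by
  intro x y hxy hx
  simp only [Set.mem_iInter] at hx ⊢
  exact fun i hi => h i hi x y hxy (hx i hi)

/-- The blocks are added from left to right, and each new block costs one mixing factor. -/
theorem MixesAt.measureReal_biInter_bounds (hT : MeasurePreserving shift P P) {m : ℕ} {δ : ℝ}
    (h : MixesAt P m δ) (h0 : 0 ≤ δ) {ι : Type*} [LinearOrder ι] (s : Finset ι) {pos len : ι → ℕ}
    {E : ι → Set (ℕ → 𝒜)} (hE : ∀ i, IsLocal (len i) (E i))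
    (hsep : ∀ i j, i < j → pos i + len i + m ≤ pos j) :
    P.real (⋂ i ∈ s, shift^[pos i] ⁻¹' E i) ≤ (1 + δ) ^ s.card * ∏ i ∈ s, P.real (E i) ∧
    (δ ≤ 1 → (1 - δ) ^ s.card * ∏ i ∈ s, P.real (E i) ≤
      P.real (⋂ i ∈ s, shift^[pos i] ⁻¹' E i)) := by
  induction s using Finset.induction_on_max with
  | empty => simp
  | insert a s hs ih =>
    have ha : a ∉ s := fun h => lt_irrefl _ (hs a h)
    rw [Finset.card_insert_of_notMem ha, Finset.prod_insert ha, Finset.set_biInter_insert,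
      Set.inter_comm]
    have hstep : P.real ((⋂ i ∈ s, shift^[pos i] ⁻¹' E i) ∩ shift^[pos a] ⁻¹' E a) ≤
          (1 + δ) * (P.real (⋂ i ∈ s, shift^[pos i] ⁻¹' E i) * P.real (E a)) ∧
        (1 - δ) * (P.real (⋂ i ∈ s, shift^[pos i] ⁻¹' E i) * P.real (E a)) ≤
          P.real ((⋂ i ∈ s, shift^[pos i] ⁻¹' E i) ∩ shift^[pos a] ⁻¹' E a) := by
      -- The first block has no past and may start before `m`, where `pos a - m` would be truncated;
      -- invariance replaces mixing there.
      rcases s.eq_empty_or_nonempty with rfl | ⟨i₀, hi₀⟩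
      · have hn : 0 ≤ P.real (E a) := measureReal_nonneg
        simp only [Finset.notMem_empty, Set.iInter_of_empty, Set.iInter_univ, Set.univ_inter,
          probReal_univ, one_mul]
        rw [measureReal_preimage_shift_iterate hT _ (hE a).measurableSet]
        constructor <;> nlinarith
      · have hl : IsLocal (pos a - m) (⋂ i ∈ s, shift^[pos i] ⁻¹' E i) := by
          refine isLocal_biInter fun i hi => ((hE i).preimage (pos i)).mono ?_
          have := hsep i a (hs i hi)
          omega
        have hle : pos a - m + m ≤ pos a := by
          have := hsep i₀ a (hs i₀ hi₀)
          omega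
        exact ⟨h.le hle hl (hE a).measurableSet, h.ge hle hl (hE a).measurableSet⟩
    have hprod : 0 ≤ ∏ i ∈ s, P.real (E i) := Finset.prod_nonneg fun _ _ => measureReal_nonneg
    have hEa : 0 ≤ P.real (E a) := measureReal_nonneg
    refine ⟨hstep.1.trans ?_, fun h1 => le_trans ?_ hstep.2⟩
    · calc _ ≤ (1 + δ) * (((1 + δ) ^ s.card * ∏ i ∈ s, P.real (E i)) * P.real (E a)) := by
            gcongr
            exact ih.1
        _ = _ := by ring
    · have : 0 ≤ 1 - δ := by linarith
      calc _ = (1 - δ) * (((1 - δ) ^ s.card * ∏ i ∈ s, P.real (E i)) * P.real (E a)) := by ring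
        _ ≤ _ := by
            gcongr
            exact ih.2 h1

variable {ℓ : ℕ} {d : Fin ℓ → ℕ}

/-- The event that the blocks at the places `d j * k` satisfy `E j`. -/
def blockEvent (d : Fin ℓ → ℕ) (E : Fin ℓ → Set (ℕ → 𝒜)) (k : ℕ) : Set (ℕ → 𝒜) :=
  {y | ∀ j, shift^[d j * k] y ∈ E j}

theorem blockEvent_eq_biInter (E : Fin ℓ → Set (ℕ → 𝒜)) (k : ℕ) :
    blockEvent d E k = ⋂ j ∈ Finset.univ, shift^[d j * k] ⁻¹' E j := by
  ext y
  simp [blockEvent]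

theorem strictMono_mul_add_le (hd : StrictMono d) {i j : Fin ℓ} (hij : i < j) (k : ℕ) :
    d i * k + k ≤ d j * k := by
  have := hd hij
  nlinarith

theorem isLocal_blockEvent {E : Fin ℓ → Set (ℕ → 𝒜)} {k n : ℕ} {len : Fin ℓ → ℕ}
    (hE : ∀ i, IsLocal (len i) (E i)) (hn : ∀ i, d i * k + len i ≤ n) :
    IsLocal n (blockEvent d E k) := by
  rw [blockEvent_eq_biInter]
  exact isLocal_biInter fun i _ => ((hE i).preimage _).mono (hn i)

theorem MixesAt.measureReal_blockEvent_le (hT : MeasurePreserving shift P P) {m : ℕ} {δ : ℝ}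
    (h : MixesAt P m δ) (h0 : 0 ≤ δ) (hd : StrictMono d) {E : Fin ℓ → Set (ℕ → 𝒜)}
    {len : Fin ℓ → ℕ} (hE : ∀ i, IsLocal (len i) (E i)) {k : ℕ} (hk : ∀ i, len i + m ≤ k) :
    P.real (blockEvent d E k) ≤ (1 + δ) ^ ℓ * ∏ i, P.real (E i) := by
  rw [blockEvent_eq_biInter]
  have := (h.measureReal_biInter_bounds hT h0 Finset.univ (pos := fun j => d j * k) hE
    (fun i j hij => by
      have h1 := strictMono_mul_add_le hd hij k
      have h2 := hk i
      omega)).1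
  simpa using this

theorem MixesAt.le_measureReal_blockEvent (hT : MeasurePreserving shift P P) {m : ℕ} {δ : ℝ}
    (h : MixesAt P m δ) (h0 : 0 ≤ δ) (h1 : δ ≤ 1) (hd : StrictMono d) {E : Fin ℓ → Set (ℕ → 𝒜)}
    {len : Fin ℓ → ℕ} (hE : ∀ i, IsLocal (len i) (E i)) {k : ℕ} (hk : ∀ i, len i + m ≤ k) :
    (1 - δ) ^ ℓ * ∏ i, P.real (E i) ≤ P.real (blockEvent d E k) := by
  rw [blockEvent_eq_biInter]
  have := (h.measureReal_biInter_bounds hT h0 Finset.univ (pos := fun j => d j * k) hE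
    (fun i j hij => by
      have h1 := strictMono_mul_add_le hd hij k
      have h2 := hk i
      omega)).2 h1
  simpa using this

theorem measurableSet_blockEvent {E : Fin ℓ → Set (ℕ → 𝒜)} (hE : ∀ j, MeasurableSet (E j))
    (k : ℕ) : MeasurableSet (blockEvent d E k) := by
  rw [blockEvent_eq_biInter]
  exact Finset.measurableSet_biInter _ fun j _ => (measurable_shift.iterate _) (hE j)

/-- The event that all the words of length `n` at the places `d j * k` agree with that of `x`. -/
def hitEvent (d : Fin ℓ → ℕ) (x : ℕ → 𝒜) (n k : ℕ) : Set (ℕ → 𝒜) :=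
  blockEvent d (fun _ => PiNat.cylinder x n) k

theorem mem_hitEvent_iff {x y : ℕ → 𝒜} {n k : ℕ} :
    y ∈ hitEvent d x n k ↔ ∀ j, ∀ i < n, y (i + d j * k) = x i := by
  simp only [hitEvent, blockEvent, Set.mem_ofPred_eq, PiNat.mem_cylinder_iff, shift_iterate_apply]

theorem measurableSet_hitEvent (x : ℕ → 𝒜) (n k : ℕ) : MeasurableSet (hitEvent d x n k) :=
  measurableSet_blockEvent (fun _ => measurableSet_cylinder x n) k

theorem recurrence_eq_indicator (x y : ℕ → 𝒜) (n k : ℕ) :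
    recurrence d (PiNat.cylinder x n) k y = (hitEvent d x n k).indicator 1 y := by
  classical
  unfold recurrence
  by_cases h : y ∈ hitEvent d x n k
  · rw [Set.indicator_of_mem h]
    exact Finset.prod_eq_one fun j _ => Set.indicator_of_mem (h j) _
  · rw [Set.indicator_of_notMem h]
    have : ∃ j, shift^[d j * k] y ∉ PiNat.cylinder x n := by
      by_contra! hc
      exact h hc
    obtain ⟨j, hj⟩ := this
    exact Finset.prod_eq_zero (Finset.mem_univ j) (Set.indicator_of_notMem hj _)

variable {δ : ℝ} {x : ℕ → 𝒜}

theorem MixesAt.measureReal_hitEvent_le (hT : MeasurePreserving shift P P) (h : MixesAt P 0 δ)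
    (h0 : 0 ≤ δ) (hd : StrictMono d) {n k : ℕ} (hk : n ≤ k) :
    P.real (hitEvent d x n k) ≤ (1 + δ) ^ ℓ * P.real (PiNat.cylinder x n) ^ ℓ := by
  have := h.measureReal_blockEvent_le hT h0 hd (fun _ => isLocal_cylinder x n) (k := k)
    (fun _ => by omega)
  simpa [hitEvent] using this

/-- Of the second hit only the block with the largest multiplier is kept: it starts after all blocks
of the first hit and contributes one extra factor. -/
theorem MixesAt.measureReal_hitEvent_inter_le_of_far (hT : MeasurePreserving shift P P)
    (h : MixesAt P 0 δ) (h0 : 0 ≤ δ) (hℓ : 0 < ℓ) (hd1 : ∀ j, 1 ≤ d j) (hd : StrictMono d)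
    {n k k' : ℕ} (hk : n ≤ k) (hkk : k + n ≤ k') :
    P.real (hitEvent d x n k ∩ hitEvent d x n k') ≤
      (1 + δ) ^ (ℓ + 1) * P.real (PiNat.cylinder x n) ^ (ℓ + 1) := by
  let j₀ : Fin ℓ := ⟨ℓ - 1, by omega⟩
  have hmax : ∀ i, d i ≤ d j₀ := fun i => hd.monotone (by
    rw [Fin.le_def]
    have := i.2
    simp only [j₀]
    omega)
  have hloc : IsLocal (d j₀ * k + n) (hitEvent d x n k) :=
    isLocal_blockEvent (fun _ => isLocal_cylinder x n) fun i => by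
      have := Nat.mul_le_mul_right k (hmax i)
      omega
  have hpos : d j₀ * k + n + 0 ≤ d j₀ * k' := by
    have := hd1 j₀
    nlinarith
  calc P.real (hitEvent d x n k ∩ hitEvent d x n k')
      ≤ P.real (hitEvent d x n k ∩ shift^[d j₀ * k'] ⁻¹' PiNat.cylinder x n) :=
        measureReal_mono (Set.inter_subset_inter_right _ fun y hy => hy j₀)
    _ ≤ (1 + δ) * (P.real (hitEvent d x n k) * P.real (PiNat.cylinder x n)) :=
        h.le hpos hloc (measurableSet_cylinder x n)
    _ ≤ (1 + δ) * (((1 + δ) ^ ℓ * P.real (PiNat.cylinder x n) ^ ℓ) *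
          P.real (PiNat.cylinder x n)) := by
        gcongr
        exact h.measureReal_hitEvent_le hT h0 hd hk
    _ = _ := by ring

theorem cylinder_subset_preimage_of_periodic {r : ℕ} (hxr : shift^[r] x = x) {n : ℕ}
    (hrn : r ≤ n) :
    PiNat.cylinder x n ⊆ shift^[r] ⁻¹' PiNat.cylinder x (n - r) := by
  have := cylinder_add x r (n - r)
  rw [Nat.add_sub_cancel' hrn, hxr] at this
  rw [this]
  exact Set.inter_subset_right

/-- In block `j₀` the two words overlap in fewer than `r` letters. Without its first `r` letters,
the second word is still an initial word of `x`, of length `n - r`, and now starts after the first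
word has ended; this gives the extra factor. The rest of the second hit is discarded. -/
theorem MixesAt.measureReal_hitEvent_inter_le_of_overhang (hT : MeasurePreserving shift P P)
    (h : MixesAt P 0 δ) (h0 : 0 ≤ δ) (hd : StrictMono d)
    {r : ℕ} (hxr : shift^[r] x = x) {D : ℕ} (hD : ∀ j, d j ≤ D)
    {n k s : ℕ} (hk : (D + 1) * n ≤ k) (hs : s ≤ n) (hrn : r ≤ n) {j₀ : Fin ℓ}
    (hj₀ : n < d j₀ * s + r) :
    P.real (hitEvent d x n k ∩ hitEvent d x n (k + s)) ≤
      (1 + δ) ^ (ℓ + 1) * P.real (PiNat.cylinder x n) ^ ℓ *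
        P.real (PiNat.cylinder x (n - r)) := by
  classical
  set p := P.real (PiNat.cylinder x n) with hp
  set G := PiNat.cylinder x n ∩ shift^[d j₀ * s + r] ⁻¹' PiNat.cylinder x (n - r) with hG
  -- The enlarged block has length `d j₀ * s + n ≤ (D + 1) * n`, which is why `k` is assumed at
  -- least that large.
  let E : Fin ℓ → Set (ℕ → 𝒜) := fun j => if j = j₀ then G else PiNat.cylinder x n
  have hds : ∀ j, d j * s ≤ D * n := fun j => Nat.mul_le_mul (hD j) hs
  have hE : ∀ j, IsLocal ((D + 1) * n) (E j) := by
    intro j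
    by_cases hj : j = j₀
    · simp only [E, hj, if_true]
      refine ((isLocal_cylinder x n).mono (by nlinarith)).inter ?_
      refine ((isLocal_cylinder x (n - r)).preimage _).mono ?_
      have := hds j₀
      rw [Nat.succ_mul]
      omega
    · simp only [E, hj, if_false]
      exact (isLocal_cylinder x n).mono (by nlinarith)
  have hPG : P.real G ≤ (1 + δ) * (p * P.real (PiNat.cylinder x (n - r))) :=
    h.le (n := n) (by omega) (isLocal_cylinder x n) (measurableSet_cylinder x _)
  have hsub : hitEvent d x n k ∩ hitEvent d x n (k + s) ⊆ blockEvent d E k := by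
    rintro y ⟨h1, h2⟩ j
    by_cases hj : j = j₀
    · subst hj
      simp only [E, if_true]
      refine ⟨h1 j, ?_⟩
      have h3 := cylinder_subset_preimage_of_periodic hxr hrn (h2 j)
      rw [Set.mem_preimage, ← Function.iterate_add_apply] at h3 ⊢
      convert h3 using 2
      ring_nf
    · simp only [E, hj, if_false]
      exact h1 j
  have hprod : ∏ j, P.real (E j) = P.real G * p ^ (ℓ - 1) := by
    rw [← Finset.mul_prod_erase _ _ (Finset.mem_univ j₀)]
    congr 1
    · simp [E]
    · rw [Finset.prod_congr rfl (g := fun _ => p) fun j hj => by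
        simp [E, (Finset.mem_erase.1 hj).1, hp]]
      simp
  have hℓ : ℓ - 1 + 1 = ℓ := by
    have := j₀.2
    omega
  have hp0 : 0 ≤ p := measureReal_nonneg
  calc _ ≤ P.real (blockEvent d E k) := measureReal_mono hsub
    _ ≤ (1 + δ) ^ ℓ * ∏ j, P.real (E j) :=
        h.measureReal_blockEvent_le hT h0 hd hE fun _ => by simpa using hk
    _ = (1 + δ) ^ ℓ * (P.real G * p ^ (ℓ - 1)) := by rw [hprod]
    _ ≤ (1 + δ) ^ ℓ * (((1 + δ) * (p * P.real (PiNat.cylinder x (n - r)))) * p ^ (ℓ - 1)) := by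
        gcongr
    _ = (1 + δ) ^ (ℓ + 1) * p ^ (ℓ - 1 + 1) * P.real (PiNat.cylinder x (n - r)) := by ring
    _ = _ := by rw [hℓ]

/-- If the initial word of a point of minimal period `r` overlaps with itself over at least `r`
letters, then the displacement is a multiple of `r`. -/
theorem minimalPeriod_dvd_of_overlap {r : ℕ} (hr : Function.minimalPeriod shift x = r)
    (hr0 : 0 < r) {n u : ℕ} (hu : u + r ≤ n) (h : ∀ i, i + u < n → x (i + u) = x i) : r ∣ u := by
  have hxr : shift^[r] x = x := hr ▸ Function.iterate_minimalPeriod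
  have hper : ∀ q i, x (i + r * q) = x i := fun q i => by
    rw [← shift_iterate_apply (r * q) x i, shift_iterate_mul_eq hxr]
  rw [← hr]
  refine Function.IsPeriodicPt.minimalPeriod_dvd ?_
  change shift^[u] x = x
  funext i
  rw [shift_iterate_apply]
  -- Reducing `i` modulo `r` brings it into the overlap, since `i % r + u < r + u ≤ n`.
  have e1 := hper (i / r) (i % r + u)
  have e2 := hper (i / r) (i % r)
  have e3 := Nat.mod_add_div i r
  have e4 := h (i % r) (by have := Nat.mod_lt i hr0; omega)
  rw [show i % r + u + r * (i / r) = i + u by omega] at e1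
  rw [e3] at e2
  rw [e1, e4, e2]

theorem dvd_of_mem_hitEvent_inter {r : ℕ} (hr : Function.minimalPeriod shift x = r)
    (hr0 : 0 < r) {n k s : ℕ} {y : ℕ → 𝒜} (hy : y ∈ hitEvent d x n k)
    (hy' : y ∈ hitEvent d x n (k + s)) {j : Fin ℓ} (hj : d j * s + r ≤ n) : r ∣ d j * s := by
  rw [mem_hitEvent_iff] at hy hy'
  refine minimalPeriod_dvd_of_overlap hr hr0 hj fun i hi => ?_
  rw [← hy' j i (by omega), ← hy j _ hi]
  congr 1
  ring

/-- Two hits at distance `s` with `r ∣ d j * s` and full overlap fill the blocks in between. -/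
theorem hitEvent_inter_eq {r : ℕ} (hxr : shift^[r] x = x) {n k s : ℕ}
    (hs : ∀ j, r ∣ d j * s) (hn : ∀ j, d j * s ≤ n) :
    hitEvent d x n k ∩ hitEvent d x n (k + s) =
      blockEvent d (fun j => PiNat.cylinder x (n + d j * s)) k := by
  have hper : ∀ j, shift^[d j * s] x = x := fun j => by
    obtain ⟨q, hq⟩ := hs j
    rw [hq, shift_iterate_mul_eq hxr]
  ext y
  simp only [Set.mem_inter_iff, hitEvent, blockEvent, Set.mem_ofPred_eq]
  rw [← forall_and]
  refine forall_congr' fun j => ?_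
  rw [mul_add, add_comm (d j * k), Function.iterate_add_apply]
  constructor
  · rintro ⟨h1, h2⟩
    rw [add_comm n, cylinder_add, hper j]
    exact ⟨PiNat.cylinder_anti x (hn j) h1, h2⟩
  · intro h
    refine ⟨PiNat.cylinder_anti x (by omega) h, ?_⟩
    rw [add_comm n, cylinder_add, hper j] at h
    exact h.2

/-- Both hits together fill the whole stretch of each block with the periodic word, which already
contains the intermediate hits. This is why clusters are runs without holes. -/
theorem hitEvent_inter_subset {r : ℕ} (hxr : shift^[r] x = x) {n k s s' : ℕ}
    (hs : ∀ j, r ∣ d j * s) (hs' : ∀ j, r ∣ d j * s') (hn : ∀ j, d j * s ≤ n) (hss : s' ≤ s) :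
    hitEvent d x n k ∩ hitEvent d x n (k + s) ⊆ hitEvent d x n (k + s') := by
  have hle : ∀ j, d j * s' ≤ d j * s := fun j => Nat.mul_le_mul_left _ hss
  rw [hitEvent_inter_eq hxr hs hn]
  intro y hy
  have : y ∈ blockEvent d (fun j => PiNat.cylinder x (n + d j * s')) k := fun j =>
    PiNat.cylinder_anti x (by have := hle j; omega) (hy j)
  rw [← hitEvent_inter_eq hxr hs' fun j => (hle j).trans (hn j)] at this
  exact this.2

/-- For each `j`, `r / gcd(r, d j)` is coprime to `d j / gcd(r, d j)`, so it divides `s` exactly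
when `r` divides `d j * s`. -/
theorem dvd_kappa_mul_iff {r : ℕ} (hr : 0 < r) (s : ℕ) :
    kappa d r ∣ s ↔ ∀ j, r ∣ d j * s := by
  rw [kappa, Finset.lcm_dvd_iff]
  simp only [Finset.mem_univ, true_implies]
  refine forall_congr' fun j => ?_
  have hg : 0 < Nat.gcd r (d j) := Nat.gcd_pos_of_pos_left _ hr
  obtain ⟨a, ha⟩ := Nat.gcd_dvd_left r (d j)
  obtain ⟨b, hb⟩ := Nat.gcd_dvd_right r (d j)
  have hcop := Nat.coprime_div_gcd_div_gcd hg
  set g := Nat.gcd r (d j) with hgdef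
  have ea : r / g = a := by
    nth_rewrite 1 [ha]
    exact Nat.mul_div_cancel_left a hg
  have eb : d j / g = b := by
    nth_rewrite 1 [hb]
    exact Nat.mul_div_cancel_left b hg
  rw [ea, eb] at hcop
  rw [ea]
  have : r ∣ d j * s ↔ g * a ∣ g * (b * s) := by rw [← ha, ← mul_assoc, ← hb]
  rw [this, Nat.mul_dvd_mul_iff_left hg]
  exact ⟨fun h => h.mul_left b, fun h => hcop.dvd_of_dvd_mul_left h⟩

theorem kappa_pos {r : ℕ} (hr : 0 < r) : 0 < kappa d r := by
  refine Nat.pos_of_ne_zero fun h => ?_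
  rw [kappa, Finset.lcm_eq_zero_iff] at h
  obtain ⟨j, -, hj⟩ := h
  have hle := Nat.le_of_dvd hr (Nat.gcd_dvd_left r (d j))
  exact (Nat.div_pos hle (Nat.gcd_pos_of_pos_left _ hr)).ne' hj

end Blocks

/-! ### Linearising powers of run lengths -/

section RunCounts

/-- The coefficients with `z ^ j = ∑ m ≤ j, runCoeff z m`. -/
noncomputable def runCoeff (z : ℝ) : ℕ → ℝ
  | 0 => 1
  | m + 1 => -((1 - z) * z ^ m)

theorem abs_runCoeff_le {z : ℝ} (hz : z ∈ Set.Icc (0 : ℝ) 1) (m : ℕ) : |runCoeff z m| ≤ 1 := by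
  cases m with
  | zero => simp [runCoeff]
  | succ m =>
    have h1 : 0 ≤ 1 - z := by linarith [hz.2]
    have h2 : 0 ≤ z ^ m := pow_nonneg hz.1 m
    rw [runCoeff, abs_neg, abs_of_nonneg (mul_nonneg h1 h2)]
    exact mul_le_one₀ (by linarith [hz.1]) h2 (pow_le_one₀ hz.1 hz.2)

/-- The `u m` are ones up to the end of the run and zeros afterwards, so the sum telescopes to `z`
to the run length. It expresses a power linearly in the indicators, whose expectations are joint hit
probabilities. -/
theorem sum_runCoeff_mul_eq_pow (z : ℝ) {u : ℕ → ℕ} (hu : ∀ m, u m = 0 ∨ u m = 1)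
    (h0 : u 0 = 1) (M : ℕ) (hanti : ∀ m m', m' ≤ m → m ≤ M → u m = 1 → u m' = 1) :
    ∑ m ∈ Finset.range (M + 1), runCoeff z m * u m = z ^ ∑ m ∈ Finset.Icc 1 M, u m := by
  induction M with
  | zero => simp [runCoeff, h0]
  | succ M ih =>
    rw [Finset.sum_range_succ, ih fun m m' h1 h2 => hanti m m' h1 (by omega),
      Finset.sum_Icc_succ_top (by omega)]
    rcases hu (M + 1) with h | h
    · simp [h]
    · have hs : ∑ m ∈ Finset.Icc 1 M, u m = M := by
        rw [Finset.sum_congr rfl (g := fun _ => 1) fun m hm =>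
          hanti (M + 1) m (by have := Finset.mem_Icc.1 hm; omega) le_rfl h]
        simp
      rw [h, hs, runCoeff]
      push_cast
      ring

theorem sum_Icc_eq_sum_multiples {κ n M : ℕ} (hκ : 0 < κ) (hM : κ * M ≤ n) {u : ℕ → ℕ}
    (hsupp : ∀ s ∈ Finset.Icc 1 n, u s ≠ 0 → κ ∣ s ∧ s ≤ κ * M) :
    ∑ s ∈ Finset.Icc 1 n, u s = ∑ m ∈ Finset.Icc 1 M, u (κ * m) := by
  rw [← Finset.sum_image (f := u) (s := Finset.Icc 1 M) (g := fun m => κ * m)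
    fun a _ b _ hab => Nat.eq_of_mul_eq_mul_left hκ hab]
  symm
  refine Finset.sum_subset (fun s hs => ?_) fun s hs hns => ?_
  · obtain ⟨m, hm, rfl⟩ := Finset.mem_image.1 hs
    rw [Finset.mem_Icc] at hm ⊢
    exact ⟨Nat.mul_pos hκ hm.1, (Nat.mul_le_mul_left κ hm.2).trans hM⟩
  · by_contra hne
    obtain ⟨⟨m, rfl⟩, h2⟩ := hsupp s hs hne
    refine hns (Finset.mem_image.2 ⟨m, Finset.mem_Icc.2 ⟨?_, Nat.le_of_mul_le_mul_left h2 hκ⟩, rfl⟩)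
    have := (Finset.mem_Icc.1 hs).1
    exact Nat.pos_of_ne_zero fun h => by simp [h] at this

/-- In the limit of large `M` the sum is the generating function `(1 - ρ) / (1 - ρ z)` of a
geometric run length; the remainder is explicit and at most `ρ ^ (M + 1)`. The square accounts for
the runs on both sides of a hit. -/
theorem abs_sum_runCoeff_pow_sub_le {z ρ : ℝ} (hz : z ∈ Set.Icc (0 : ℝ) 1)
    (hρ : ρ ∈ Set.Ico (0 : ℝ) 1) (M : ℕ) :
    |(∑ m ∈ Finset.range (M + 1), runCoeff z m * ρ ^ m) ^ 2 - ((1 - ρ) / (1 - ρ * z)) ^ 2| ≤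
      3 * ρ ^ (M + 1) := by
  obtain ⟨z0, z1⟩ := hz
  obtain ⟨r0, r1⟩ := hρ
  have hrz : ρ * z ≤ ρ := mul_le_of_le_one_right r0 z1
  have hpos : 0 < 1 - ρ * z := by linarith
  have hclosed : ∑ m ∈ Finset.range (M + 1), runCoeff z m * ρ ^ m =
      (1 - ρ) / (1 - ρ * z) + (1 - z) * ρ * (ρ * z) ^ M / (1 - ρ * z) := by
    induction M with
    | zero =>
      simp only [zero_add, Finset.sum_range_one, runCoeff, pow_zero, mul_one]
      field_simp
      ring
    | succ M ih =>
      rw [Finset.sum_range_succ, ih, runCoeff]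
      field_simp
      ring
  set g := (1 - ρ) / (1 - ρ * z) with hg
  set η := (1 - z) * ρ * (ρ * z) ^ M / (1 - ρ * z) with hη
  have g0 : 0 ≤ g := div_nonneg (by linarith) hpos.le
  have g1 : g ≤ 1 := (div_le_one hpos).2 (by linarith)
  have η0 : 0 ≤ η := by
    have : 0 ≤ 1 - z := by linarith
    positivity
  have η1 : η ≤ ρ ^ (M + 1) := by
    rw [hη, div_le_iff₀ hpos]
    have a1 : (ρ * z) ^ M ≤ ρ ^ M := pow_le_pow_left₀ (by positivity) hrz M
    have a2 : 1 - z ≤ 1 - ρ * z := by nlinarith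
    calc (1 - z) * ρ * (ρ * z) ^ M ≤ (1 - ρ * z) * ρ * ρ ^ M := by gcongr
      _ = _ := by ring
  have η2 : η ≤ 1 := η1.trans (pow_le_one₀ r0 r1.le)
  rw [hclosed, show (g + η) ^ 2 - g ^ 2 = η * (2 * g + η) by ring, abs_of_nonneg (by positivity)]
  nlinarith

end RunCounts

/-! ### The cluster around a hit -/

section NearbyHits

variable {𝒜 : Type*} [MeasurableSpace 𝒜] [DiscreteMeasurableSpace 𝒜] [Countable 𝒜]
  {P : Measure (ℕ → 𝒜)} [IsProbabilityMeasure P] {ℓ : ℕ} {d : Fin ℓ → ℕ} {x : ℕ → 𝒜}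

theorem tendsto_prod_cylinder_ratio {r κ : ℕ} {θ : ℝ}
    (hθ : ∀ q, Tendsto (fun n => P.real (PiNat.cylinder x (n + r * q)) /
      P.real (PiNat.cylinder x n)) atTop (𝓝 (θ ^ q)))
    {e : Fin ℓ → ℕ} (he : ∀ j, d j * κ = r * e j) (q : ℕ) :
    Tendsto (fun n => (∏ j, P.real (PiNat.cylinder x (n + d j * (κ * q)))) /
      P.real (PiNat.cylinder x n) ^ ℓ) atTop (𝓝 ((θ ^ ∑ j, e j) ^ q)) := by
  have : (θ ^ ∑ j, e j) ^ q = ∏ j, θ ^ (e j * q) := by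
    rw [← pow_mul, Finset.sum_mul, Finset.prod_pow_eq_pow_sum]
  rw [this]
  refine (tendsto_finsetProd Finset.univ fun j _ => hθ (e j * q)).congr fun n => ?_
  rw [Finset.prod_div_distrib]
  congr 1
  · refine Finset.prod_congr rfl fun j _ => ?_
    rw [← mul_assoc, ← mul_assoc, he j]
  · simp

theorem eventually_abs_measureReal_blockEvent_sub_le (hT : MeasurePreserving shift P P)
    {ψ : ℕ → ℝ} (ψ0 : ∀ m, 0 ≤ ψ m) (ψlim : Tendsto ψ atTop (𝓝 0)) (hψ : ∀ m, MixesAt P m (ψ m))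
    (hd : StrictMono d) (hpos : ∀ n, 0 < P.real (PiNat.cylinder x n)) {r κ : ℕ} {θ : ℝ}
    (hθ : ∀ q, Tendsto (fun n => P.real (PiNat.cylinder x (n + r * q)) /
      P.real (PiNat.cylinder x n)) atTop (𝓝 (θ ^ q)))
    {e : Fin ℓ → ℕ} (he : ∀ j, d j * κ = r * e j) (q : ℕ) {ε : ℝ} (hε : 0 < ε) :
    ∀ᶠ n in atTop, ∀ k, 3 * n ≤ k →
      |P.real (blockEvent d (fun j => PiNat.cylinder x (n + d j * (κ * q))) k) -
        P.real (PiNat.cylinder x n) ^ ℓ * (θ ^ ∑ j, e j) ^ q| ≤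
      ε * P.real (PiNat.cylinder x n) ^ ℓ := by
  set R := fun n => (∏ j, P.real (PiNat.cylinder x (n + d j * (κ * q)))) /
      P.real (PiNat.cylinder x n) ^ ℓ with hR
  set L := (θ ^ ∑ j, e j) ^ q with hL
  have hlim : Tendsto R atTop (𝓝 L) := tendsto_prod_cylinder_ratio hθ he q
  have hup : Tendsto (fun n => (1 + ψ n) ^ ℓ * R n) atTop (𝓝 L) := by
    simpa using ((ψlim.const_add 1).pow ℓ).mul hlim
  have hlow : Tendsto (fun n => (1 - ψ n) ^ ℓ * R n) atTop (𝓝 L) := by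
    simpa using ((ψlim.const_sub 1).pow ℓ).mul hlim
  have hfit : ∀ᶠ n : ℕ in atTop, ∀ j, d j * (κ * q) ≤ n :=
    eventually_all.2 fun j => eventually_ge_atTop _
  filter_upwards [hup.eventually_le_const (show L < L + ε by linarith),
    hlow.eventually_const_le (show L - ε < L by linarith),
    ψlim.eventually_le_const (show (0 : ℝ) < 1 by norm_num), hfit] with n h1 h2 h3 h4 k hk
  have hp : 0 < P.real (PiNat.cylinder x n) ^ ℓ := pow_pos (hpos n) ℓ
  -- For fixed `q` the words eventually have length at most `2 * n`; together with a mixing gap of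
  -- length `n` they fit below `3 * n ≤ k`.
  have hlen : ∀ i, n + d i * (κ * q) + n ≤ k := fun i => by
    have := h4 i
    omega
  have b1 := (hψ n).measureReal_blockEvent_le hT (ψ0 n) hd
    (fun i => isLocal_cylinder x (n + d i * (κ * q))) hlen
  have b2 := (hψ n).le_measureReal_blockEvent hT (ψ0 n) h3 hd
    (fun i => isLocal_cylinder x (n + d i * (κ * q))) hlen
  have hRp : ∏ j, P.real (PiNat.cylinder x (n + d j * (κ * q))) =
      R n * P.real (PiNat.cylinder x n) ^ ℓ := by
    rw [hR]
    field_simp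
  rw [hRp, ← mul_assoc] at b1 b2
  have c1 := b1.trans (mul_le_mul_of_nonneg_right h1 hp.le)
  have c2 := (mul_le_mul_of_nonneg_right h2 hp.le).trans b2
  rw [abs_le]
  constructor <;> nlinarith

theorem recurrence_eq_zero_or_one (n k : ℕ) (y : ℕ → 𝒜) :
    recurrence d (PiNat.cylinder x n) k y = 0 ∨ recurrence d (PiNat.cylinder x n) k y = 1 := by
  rw [recurrence_eq_indicator]
  by_cases h : y ∈ hitEvent d x n k <;> simp [h]

theorem recurrence_eq_one_iff {n k : ℕ} {y : ℕ → 𝒜} :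
    recurrence d (PiNat.cylinder x n) k y = 1 ↔ y ∈ hitEvent d x n k := by
  rw [recurrence_eq_indicator]
  by_cases h : y ∈ hitEvent d x n k <;> simp [h]

theorem measurable_recurrence (n k : ℕ) :
    Measurable (recurrence d (PiNat.cylinder x n) k) := by
  have : recurrence d (PiNat.cylinder x n) k = (hitEvent d x n k).indicator 1 :=
    funext fun y => recurrence_eq_indicator x y n k
  rw [this]
  exact measurable_one.indicator (measurableSet_hitEvent x n k)

theorem integral_recurrence_mul (n k k' : ℕ) :
    ∫ y, (recurrence d (PiNat.cylinder x n) k y : ℝ) * recurrence d (PiNat.cylinder x n) k' y ∂P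
      = P.real (hitEvent d x n k ∩ hitEvent d x n k') := by
  rw [← integral_indicator_one ((measurableSet_hitEvent x n k).inter (measurableSet_hitEvent x n k'))]
  refine integral_congr_ae (Eventually.of_forall fun y => ?_)
  simp only [recurrence_eq_indicator]
  by_cases h : y ∈ hitEvent d x n k <;> by_cases h' : y ∈ hitEvent d x n k' <;> simp [h, h']

theorem integral_recurrence (n k : ℕ) :
    ∫ y, (recurrence d (PiNat.cylinder x n) k y : ℝ) ∂P = P.real (hitEvent d x n k) := by
  rw [← integral_indicator_one (measurableSet_hitEvent x n k)]
  refine integral_congr_ae (Eventually.of_forall fun y => ?_)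
  simp only [recurrence_eq_indicator]
  by_cases h : y ∈ hitEvent d x n k <;> simp [h]

/-- The number of hits at distance between `1` and `n` from `k`. -/
noncomputable def neighbourCount (d : Fin ℓ → ℕ) (x : ℕ → 𝒜) (n k : ℕ) (y : ℕ → 𝒜) : ℕ :=
  ∑ s ∈ Finset.Icc 1 n, recurrence d (PiNat.cylinder x n) (k + s) y +
    ∑ s ∈ Finset.Icc 1 n, recurrence d (PiNat.cylinder x n) (k - s) y

/-- The shifts `s` for which a second hit at distance `s` is unlikely. -/
def IsBadLag (d : Fin ℓ → ℕ) (r κ n s : ℕ) : Prop := ¬ κ ∣ s ∨ ∃ j, n < d j * s + r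

open Classical in
/-- The bad lags up to `n`. -/
noncomputable def badLags (d : Fin ℓ → ℕ) (r κ n : ℕ) : Finset ℕ :=
  (Finset.Icc 1 n).filter (IsBadLag d r κ n)

/-- Either some block overlaps too little, which costs a factor `P(A_{n-r})`, or all overlaps have
at least `r` letters while `κ ∤ s`, and then the two hits are incompatible. -/
theorem measureReal_hitEvent_inter_le_of_isBadLag (hT : MeasurePreserving shift P P) {δ : ℝ}
    (h : MixesAt P 0 δ) (h0 : 0 ≤ δ) (hd : StrictMono d) {r : ℕ}
    (hr : Function.minimalPeriod shift x = r) (hr0 : 0 < r) {D : ℕ} (hD : ∀ j, d j ≤ D)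
    {κ : ℕ} (hκ : ∀ s, κ ∣ s ↔ ∀ j, r ∣ d j * s) {n k s : ℕ} (hk : (D + 1) * n ≤ k)
    (hrn : r ≤ n) (hs : s ∈ badLags d r κ n) :
    P.real (hitEvent d x n k ∩ hitEvent d x n (k + s)) ≤
      (1 + δ) ^ (ℓ + 1) * P.real (PiNat.cylinder x n) ^ ℓ *
        P.real (PiNat.cylinder x (n - r)) := by
  classical
  have hxr : shift^[r] x = x := hr ▸ Function.iterate_minimalPeriod
  obtain ⟨hs1, hs2⟩ := Finset.mem_filter.1 hs
  by_cases hov : ∃ j, n < d j * s + r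
  · obtain ⟨j, hj⟩ := hov
    exact h.measureReal_hitEvent_inter_le_of_overhang hT h0 hd hxr hD hk
      (Finset.mem_Icc.1 hs1).2 hrn hj
  · have hnd := hs2.resolve_right hov
    push Not at hov
    have hempty : hitEvent d x n k ∩ hitEvent d x n (k + s) = ∅ := by
      rw [Set.eq_empty_iff_forall_notMem]
      rintro y ⟨h1, h2⟩
      exact hnd ((hκ s).2 fun j => dvd_of_mem_hitEvent_inter hr hr0 h1 h2 (hov j))
    rw [hempty, measureReal_empty]
    positivity

theorem abs_pow_sub_pow_le_one {z : ℝ} (hz : z ∈ Set.Icc (0 : ℝ) 1) (a b : ℕ) :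
    |z ^ a - z ^ b| ≤ 1 := by
  have h1 := pow_nonneg hz.1 a
  have h2 := pow_nonneg hz.1 b
  have h3 := pow_le_one₀ (n := a) hz.1 hz.2
  have h4 := pow_le_one₀ (n := b) hz.1 hz.2
  rw [abs_le]
  constructor <;> linarith

variable {r κ : ℕ}

theorem hitEvent_antitone_right (hxr : shift^[r] x = x) (hκ : ∀ s, κ ∣ s ↔ ∀ j, r ∣ d j * s)
    {n k m m' : ℕ} {y : ℕ → 𝒜} (hfit : ∀ j, d j * (κ * m) ≤ n) (hmm : m' ≤ m)
    (hk : y ∈ hitEvent d x n k) (hm : y ∈ hitEvent d x n (k + κ * m)) :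
    y ∈ hitEvent d x n (k + κ * m') :=
  hitEvent_inter_subset hxr ((hκ _).1 (dvd_mul_right κ m)) ((hκ _).1 (dvd_mul_right κ m'))
    hfit (Nat.mul_le_mul_left κ hmm) ⟨hk, hm⟩

theorem hitEvent_antitone_left (hxr : shift^[r] x = x) (hκ : ∀ s, κ ∣ s ↔ ∀ j, r ∣ d j * s)
    {n k m m' : ℕ} {y : ℕ → 𝒜} (hfit : ∀ j, d j * (κ * m) ≤ n) (hmm : m' ≤ m) (hkm : κ * m ≤ k)
    (hk : y ∈ hitEvent d x n k) (hm : y ∈ hitEvent d x n (k - κ * m)) :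
    y ∈ hitEvent d x n (k - κ * m') := by
  have hle := Nat.mul_le_mul_left κ hmm
  have h1 : k - κ * m + κ * (m - m') = k - κ * m' := by
    rw [Nat.mul_sub]
    omega
  rw [← h1]
  refine hitEvent_antitone_right hxr hκ hfit (Nat.sub_le m m') hm ?_
  rwa [Nat.sub_add_cancel hkm]

/-- If there is no hit at a bad lag or at lag `κ(M+1)` on either side, the neighbours of a hit at
`k` are exactly two runs of length at most `M`, and the linearised expression is exact. Otherwise
both quantities are powers of `z`, and the right side is at least one. -/
theorem abs_pow_neighbourCount_sub_le (hxr : shift^[r] x = x)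
    (hκ : ∀ s, κ ∣ s ↔ ∀ j, r ∣ d j * s) (hκ0 : 0 < κ) {n k M : ℕ}
    (hκn : κ * (M + 1) ≤ n) (hfit : ∀ j, d j * (κ * (M + 1)) + r ≤ n) (hnk : n ≤ k) {z : ℝ}
    (hz : z ∈ Set.Icc (0 : ℝ) 1) (y : ℕ → 𝒜) :
    |(recurrence d (PiNat.cylinder x n) k y : ℝ) * z ^ neighbourCount d x n k y -
      ∑ m ∈ Finset.range (M + 1), ∑ m' ∈ Finset.range (M + 1), runCoeff z m * runCoeff z m' *
        (recurrence d (PiNat.cylinder x n) (k - κ * m') y *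
          recurrence d (PiNat.cylinder x n) k y *
          recurrence d (PiNat.cylinder x n) (k + κ * m) y : ℕ)| ≤
      ∑ s ∈ insert (κ * (M + 1)) (badLags d r κ n),
        ((recurrence d (PiNat.cylinder x n) k y : ℝ) *
            recurrence d (PiNat.cylinder x n) (k + s) y +
          (recurrence d (PiNat.cylinder x n) k y : ℝ) *
            recurrence d (PiNat.cylinder x n) (k - s) y) := by
  classical
  set X := fun k => recurrence d (PiNat.cylinder x n) k y with hX
  have hX01 : ∀ k, X k = 0 ∨ X k = 1 := fun k => recurrence_eq_zero_or_one n k y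
  have hX1 : ∀ k, X k = 1 ↔ y ∈ hitEvent d x n k := fun k => recurrence_eq_one_iff
  have hXnn : ∀ k, (0 : ℝ) ≤ X k := fun k => Nat.cast_nonneg _
  change |(X k : ℝ) * z ^ neighbourCount d x n k y -
      ∑ m ∈ Finset.range (M + 1), ∑ m' ∈ Finset.range (M + 1), runCoeff z m * runCoeff z m' *
        (X (k - κ * m') * X k * X (k + κ * m) : ℕ)| ≤
      ∑ s ∈ insert (κ * (M + 1)) (badLags d r κ n),
        ((X k : ℝ) * X (k + s) + (X k : ℝ) * X (k - s))
  have hnc : neighbourCount d x n k y =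
    ∑ s ∈ Finset.Icc 1 n, X (k + s) + ∑ s ∈ Finset.Icc 1 n, X (k - s) := rfl
  have hsum0 : 0 ≤ ∑ s ∈ insert (κ * (M + 1)) (badLags d r κ n),
      ((X k : ℝ) * X (k + s) + (X k : ℝ) * X (k - s)) :=
    Finset.sum_nonneg fun s _ =>
      add_nonneg (mul_nonneg (hXnn _) (hXnn _)) (mul_nonneg (hXnn _) (hXnn _))
  rcases hX01 k with hk | hk
  · simp [hk]
  have hky := (hX1 k).1 hk
  have hle : ∀ m, m ≤ M + 1 → κ * m ≤ κ * (M + 1) := fun m hm => Nat.mul_le_mul_left κ hm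
  have hfit' : ∀ m, m ≤ M + 1 → ∀ j, d j * (κ * m) ≤ n := fun m hm j =>
    (Nat.mul_le_mul_left (d j) (hle m hm)).trans ((Nat.le_add_right _ _).trans (hfit j))
  have hR := sum_runCoeff_mul_eq_pow z (u := fun m => X (k + κ * m)) (fun m => hX01 _)
    (by simpa using hk) M fun m m' h1 h2 h3 =>
      (hX1 _).2 (hitEvent_antitone_right hxr hκ (hfit' m (by omega)) h1 hky ((hX1 _).1 h3))
  have hL := sum_runCoeff_mul_eq_pow z (u := fun m => X (k - κ * m)) (fun m => hX01 _)
    (by simpa using hk) M fun m m' h1 h2 h3 =>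
      (hX1 _).2 (hitEvent_antitone_left hxr hκ (hfit' m (by omega)) h1
        (by have := hle m (by omega); omega) hky ((hX1 _).1 h3))
  have hprod : ∑ m ∈ Finset.range (M + 1), ∑ m' ∈ Finset.range (M + 1),
      runCoeff z m * runCoeff z m' * ((X (k - κ * m') * X k * X (k + κ * m) : ℕ) : ℝ) =
      z ^ (∑ m ∈ Finset.Icc 1 M, X (k + κ * m) + ∑ m ∈ Finset.Icc 1 M, X (k - κ * m)) := by
    rw [pow_add, ← hR, ← hL, Finset.sum_mul_sum]
    refine Finset.sum_congr rfl fun m _ => Finset.sum_congr rfl fun m' _ => ?_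
    rw [hk]
    push_cast
    ring
  rw [hprod, hk, hnc]
  simp only [Nat.cast_one, one_mul]
  by_cases hex : ∃ s ∈ insert (κ * (M + 1)) (badLags d r κ n), X (k + s) = 1 ∨ X (k - s) = 1
  · obtain ⟨s, hs, hs1⟩ := hex
    refine (abs_pow_sub_pow_le_one hz _ _).trans ?_
    have h1 : (1 : ℝ) ≤ (X (k + s) : ℝ) + X (k - s) := by
      rcases hs1 with h | h
      · have := hXnn (k - s)
        rw [h, Nat.cast_one]
        linarith
      · have := hXnn (k + s)
        rw [h, Nat.cast_one]
        linarith
    exact h1.trans (Finset.single_le_sum (f := fun s => (X (k + s) : ℝ) + X (k - s))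
      (fun s _ => add_nonneg (hXnn _) (hXnn _)) hs)
  · push Not at hex
    have hgood : ∀ s ∈ Finset.Icc 1 n, (X (k + s) ≠ 0 ∨ X (k - s) ≠ 0) →
        κ ∣ s ∧ s ≤ κ * M := by
      intro s hs hne
      have hone : X (k + s) = 1 ∨ X (k - s) = 1 :=
        hne.imp (fun h => (hX01 _).resolve_left h) fun h => (hX01 _).resolve_left h
      have hnb : s ∉ badLags d r κ n := fun hb => by
        obtain ⟨a, b⟩ := hex s (Finset.mem_insert_of_mem hb)
        tauto
      have hnb' : ¬ IsBadLag d r κ n s := fun hb => hnb (Finset.mem_filter.2 ⟨hs, hb⟩)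
      unfold IsBadLag at hnb'
      push Not at hnb'
      obtain ⟨⟨m, rfl⟩, hov⟩ := hnb'
      refine ⟨dvd_mul_right κ m, Nat.mul_le_mul_left κ ?_⟩
      -- A good lag beyond `κ * M` belongs to a run that also contains lag `κ * (M + 1)`, which is
      -- excluded.
      by_contra hm
      obtain ⟨a, b⟩ := hex _ (Finset.mem_insert_self _ _)
      have hov' : ∀ j, d j * (κ * m) ≤ n := fun j => (Nat.le_add_right _ _).trans (hov j)
      have hkm : κ * m ≤ k := (Finset.mem_Icc.1 hs).2.trans hnk
      rcases hone with h | h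
      · exact a ((hX1 _).2 (hitEvent_antitone_right hxr hκ hov' (by omega) hky ((hX1 _).1 h)))
      · exact b ((hX1 _).2
          (hitEvent_antitone_left hxr hκ hov' (by omega) hkm hky ((hX1 _).1 h)))
    have hM : κ * M ≤ n := (hle M (by omega)).trans hκn
    rw [sum_Icc_eq_sum_multiples hκ0 hM (u := fun s => X (k + s))
        fun s hs h => hgood s hs (Or.inl h),
      sum_Icc_eq_sum_multiples hκ0 hM (u := fun s => X (k - s))
        fun s hs h => hgood s hs (Or.inr h), sub_self, abs_zero]
    simpa [hk] using hsum0

end NearbyHits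

/-! ### The expected weight of the cluster around a hit -/

section

variable {𝒜 : Type*} [MeasurableSpace 𝒜] [DiscreteMeasurableSpace 𝒜] [Countable 𝒜]
  {P : Measure (ℕ → 𝒜)} [IsProbabilityMeasure P] {ℓ : ℕ} {d : Fin ℓ → ℕ} {x : ℕ → 𝒜}

/-- The quantitative facts on which the compound Poisson limit at a periodic point `x` rests:
`ψ`-mixing, the values `κ` and `e j` with `d j * κ = r * e j`, and the ratio limit `θ` of the
probabilities of the cylinders of lengths `n + r` and `n`. -/
structure PeriodicHitting (P : Measure (ℕ → 𝒜)) (d : Fin ℓ → ℕ) (x : ℕ → 𝒜) (ψ : ℕ → ℝ)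
    (r κ D : ℕ) (e : Fin ℓ → ℕ) (θ : ℝ) : Prop where
  measurePreserving : MeasurePreserving shift P P
  psi_nonneg : ∀ m, 0 ≤ ψ m
  psi_tendsto : Tendsto ψ atTop (𝓝 0)
  mixesAt : ∀ m, MixesAt P m (ψ m)
  card_pos : 0 < ℓ
  one_le : ∀ j, 1 ≤ d j
  strictMono : StrictMono d
  le_bound : ∀ j, d j ≤ D
  cylinder_pos : ∀ n, 0 < P.real (PiNat.cylinder x n)
  ratio_tendsto : ∀ q, Tendsto (fun n => P.real (PiNat.cylinder x (n + r * q)) /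
      P.real (PiNat.cylinder x n)) atTop (𝓝 (θ ^ q))
  mul_period : ∀ j, d j * κ = r * e j
  minimalPeriod_eq : Function.minimalPeriod shift x = r
  period_pos : 0 < r
  dvd_iff : ∀ s, κ ∣ s ↔ ∀ j, r ∣ d j * s
  lag_pos : 0 < κ
  decay : Tendsto (fun n : ℕ => (n : ℝ) * P.real (PiNat.cylinder x n)) atTop (𝓝 0)
  rho_mem : θ ^ ∑ j, e j ∈ Set.Ico (0 : ℝ) 1

theorem integrable_of_abs_le {f : (ℕ → 𝒜) → ℝ} (hf : Measurable f) {C : ℝ}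
    (hC : ∀ y, |f y| ≤ C) : Integrable f P :=
  Integrable.of_bound hf.aestronglyMeasurable C (Eventually.of_forall hC)

theorem measurable_recurrence_cast (n k : ℕ) :
    Measurable fun y => (recurrence d (PiNat.cylinder x n) k y : ℝ) :=
  (measurable_of_countable (Nat.cast : ℕ → ℝ)).comp (measurable_recurrence n k)

theorem recurrence_cast_mem_Icc (n k : ℕ) (y : ℕ → 𝒜) :
    (recurrence d (PiNat.cylinder x n) k y : ℝ) ∈ Set.Icc (0 : ℝ) 1 := by
  rcases recurrence_eq_zero_or_one (d := d) (x := x) n k y with h | h <;> simp [h]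

theorem integrable_recurrence (n k : ℕ) :
    Integrable (fun y => (recurrence d (PiNat.cylinder x n) k y : ℝ)) P :=
  integrable_of_abs_le (measurable_recurrence_cast n k) (C := 1) fun y => by
    have := recurrence_cast_mem_Icc (d := d) (x := x) n k y
    rw [abs_of_nonneg this.1]
    exact this.2

theorem integrable_recurrence_mul (n k k' : ℕ) :
    Integrable (fun y => (recurrence d (PiNat.cylinder x n) k y : ℝ) *
      recurrence d (PiNat.cylinder x n) k' y) P :=
  integrable_of_abs_le ((measurable_recurrence_cast n k).mul (measurable_recurrence_cast n k'))
    (C := 1) fun y => by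
      have h1 := recurrence_cast_mem_Icc (d := d) (x := x) n k y
      have h2 := recurrence_cast_mem_Icc (d := d) (x := x) n k' y
      rw [abs_of_nonneg (mul_nonneg h1.1 h2.1)]
      exact mul_le_one₀ h1.2 h2.1 h2.2

theorem measurable_neighbourCount (n k : ℕ) : Measurable (neighbourCount d x n k) := by
  unfold neighbourCount
  exact (Finset.measurable_fun_sum _ fun s _ => measurable_recurrence n _).add
    (Finset.measurable_fun_sum _ fun s _ => measurable_recurrence n _)

theorem measurable_pow_of_nat {f : (ℕ → 𝒜) → ℕ} (hf : Measurable f) (z : ℝ) :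
    Measurable fun y => z ^ f y :=
  (measurable_of_countable fun j : ℕ => z ^ j).comp hf

theorem pow_mem_Icc {z : ℝ} (hz : z ∈ Set.Icc (0 : ℝ) 1) (j : ℕ) : z ^ j ∈ Set.Icc (0 : ℝ) 1 :=
  ⟨pow_nonneg hz.1 j, pow_le_one₀ hz.1 hz.2⟩

/-- Hits at the two ends force the hit in the middle, so a triple product reduces to a pair at lag
`κ(m + m')`. -/
theorem recurrence_triple_eq {r κ : ℕ} (hxr : shift^[r] x = x)
    (hκ : ∀ s, κ ∣ s ↔ ∀ j, r ∣ d j * s) {n k m m' : ℕ}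
    (hfit : ∀ j, d j * (κ * (m + m')) ≤ n) (hk : κ * m' ≤ k) (y : ℕ → 𝒜) :
    recurrence d (PiNat.cylinder x n) (k - κ * m') y * recurrence d (PiNat.cylinder x n) k y *
        recurrence d (PiNat.cylinder x n) (k + κ * m) y =
      recurrence d (PiNat.cylinder x n) (k - κ * m') y *
        recurrence d (PiNat.cylinder x n) (k - κ * m' + κ * (m + m')) y := by
  have h1 : k - κ * m' + κ * (m + m') = k + κ * m := by
    rw [Nat.mul_add]
    omega
  have h2 : k - κ * m' + κ * m' = k := Nat.sub_add_cancel hk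
  have himp : y ∈ hitEvent d x n (k - κ * m') → y ∈ hitEvent d x n (k + κ * m) →
      y ∈ hitEvent d x n k := fun ha hb => by
    rw [← h1] at hb
    have := hitEvent_antitone_right hxr hκ hfit (Nat.le_add_left m' m) ha hb
    rwa [h2] at this
  rw [h1]
  simp only [recurrence_eq_indicator]
  by_cases ha : y ∈ hitEvent d x n (k - κ * m') <;>
    by_cases hb : y ∈ hitEvent d x n (k + κ * m) <;> simp [ha, hb]
  exact Set.indicator_of_mem (himp ha hb) _

namespace PeriodicHitting

variable {ψ : ℕ → ℝ} {r κ D : ℕ} {e : Fin ℓ → ℕ} {θ : ℝ}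

theorem iterate_period (H : PeriodicHitting P d x ψ r κ D e θ) : shift^[r] x = x :=
  H.minimalPeriod_eq ▸ Function.iterate_minimalPeriod

theorem tendsto_cylinder (H : PeriodicHitting P d x ψ r κ D e θ) :
    Tendsto (fun n => P.real (PiNat.cylinder x n)) atTop (𝓝 0) := by
  refine squeeze_zero' (Eventually.of_forall fun n => measureReal_nonneg) ?_ H.decay
  filter_upwards [eventually_ge_atTop 1] with n hn
  have h1 : (1 : ℝ) ≤ n := by exact_mod_cast hn
  have h2 : 0 ≤ P.real (PiNat.cylinder x n) := measureReal_nonneg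
  nlinarith

theorem tendsto_mul_cylinder_sub (H : PeriodicHitting P d x ψ r κ D e θ) :
    Tendsto (fun n : ℕ => (n : ℝ) * P.real (PiNat.cylinder x (n - r))) atTop (𝓝 0) := by
  rw [← tendsto_add_atTop_iff_nat r]
  have h := H.decay.add (H.tendsto_cylinder.const_mul (r : ℝ))
  rw [mul_zero, add_zero] at h
  refine h.congr fun n => ?_
  rw [Nat.add_sub_cancel]
  push_cast
  ring

theorem eventually_abs_measureReal_hitEvent_inter_sub_le
    (H : PeriodicHitting P d x ψ r κ D e θ) (q : ℕ) {ε : ℝ} (hε : 0 < ε) :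
    ∀ᶠ n in atTop, ∀ k, 3 * n ≤ k →
      |P.real (hitEvent d x n k ∩ hitEvent d x n (k + κ * q)) -
        P.real (PiNat.cylinder x n) ^ ℓ * (θ ^ ∑ j, e j) ^ q| ≤
      ε * P.real (PiNat.cylinder x n) ^ ℓ := by
  have hfit : ∀ᶠ n : ℕ in atTop, ∀ j, d j * (κ * q) ≤ n :=
    eventually_all.2 fun j => eventually_ge_atTop _
  filter_upwards [eventually_abs_measureReal_blockEvent_sub_le H.measurePreserving H.psi_nonneg
    H.psi_tendsto H.mixesAt H.strictMono H.cylinder_pos H.ratio_tendsto H.mul_period q hε, hfit]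
    with n hn hf k hk
  rw [hitEvent_inter_eq H.iterate_period ((H.dvd_iff _).1 (dvd_mul_right κ q)) hf]
  exact hn k hk

/-- The expected weight of the neighbours of a hit, up to the truncation of the runs at `M`. -/
theorem eventually_abs_integral_neighbour_sub_le_of_trunc
    (H : PeriodicHitting P d x ψ r κ D e θ) (M : ℕ) {ε : ℝ} (hε : 0 < ε) :
    ∀ᶠ n in atTop, ∀ k, (D + 4) * n ≤ k → ∀ z ∈ Set.Icc (0 : ℝ) 1,
      |∫ y, (recurrence d (PiNat.cylinder x n) k y : ℝ) * z ^ neighbourCount d x n k y ∂P -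
        P.real (PiNat.cylinder x n) ^ ℓ *
          (∑ m ∈ Finset.range (M + 1), runCoeff z m * (θ ^ ∑ j, e j) ^ m) ^ 2| ≤
      (2 * (θ ^ ∑ j, e j) ^ (M + 1) + ε) * P.real (PiNat.cylinder x n) ^ ℓ := by
  classical
  set ρ := θ ^ ∑ j, e j with hρ
  set K := (1 + ψ 0) ^ (ℓ + 1) with hK
  have hK0 : 0 ≤ K := pow_nonneg (by linarith [H.psi_nonneg 0]) _
  -- `ε₁` is spent twice on the lag `κ(M+1)` and `(M+1)²` times in the double sum, altogether `ε /
  -- 2`; the other half pays for the bad lags.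
  set ε₁ := ε / (2 * (2 + ((M : ℝ) + 1) ^ 2)) with hε₁
  have hε₁pos : 0 < ε₁ := by positivity
  -- The range covers the sums `m + m' ≤ 2M` and also `M + 1`, which exceeds `2M` when `M = 0`.
  have hq : ∀ᶠ n in atTop, ∀ q ∈ Finset.range (2 * M + 2), ∀ k, 3 * n ≤ k →
      |P.real (hitEvent d x n k ∩ hitEvent d x n (k + κ * q)) -
        P.real (PiNat.cylinder x n) ^ ℓ * ρ ^ q| ≤ ε₁ * P.real (PiNat.cylinder x n) ^ ℓ :=
    (Filter.eventually_all_finset _).2 fun q _ =>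
      H.eventually_abs_measureReal_hitEvent_inter_sub_le q hε₁pos
  have hfit : ∀ᶠ n : ℕ in atTop, ∀ j, d j * (κ * (2 * M + 1)) + r ≤ n :=
    eventually_all.2 fun j => eventually_ge_atTop _
  have hbad : Tendsto (fun n : ℕ => 2 * K * ((n : ℝ) * P.real (PiNat.cylinder x (n - r)))) atTop
      (𝓝 0) := by
    simpa using H.tendsto_mul_cylinder_sub.const_mul (2 * K)
  filter_upwards [hq, hfit, hbad.eventually_le_const (show 0 < ε / 2 by linarith),
    eventually_ge_atTop (κ * (2 * M + 1)), eventually_ge_atTop r]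
    with n hq hfit hbad hκn hrn k hk z hz
  set p := P.real (PiNat.cylinder x n) with hp
  have hp0 : 0 ≤ p ^ ℓ := pow_nonneg measureReal_nonneg ℓ
  set X : ℕ → (ℕ → 𝒜) → ℕ := fun k => recurrence d (PiNat.cylinder x n) k with hX
  -- Moving back from `k` by a lag of at most `n` still leaves `(D + 1) * n` and `3 * n`.
  have hk' : D * n + 4 * n ≤ k := by rwa [← Nat.add_mul]
  have hDn : (D + 1) * n = D * n + n := by ring
  have hMκ : ∀ m, m ≤ 2 * M + 1 → κ * m ≤ κ * (2 * M + 1) := fun m hm =>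
    Nat.mul_le_mul_left κ hm
  have hfitm : ∀ m, m ≤ 2 * M + 1 → ∀ j, d j * (κ * m) ≤ d j * (κ * (2 * M + 1)) :=
    fun m hm j => Nat.mul_le_mul_left (d j) (hMκ m hm)
  have hpt := abs_pow_neighbourCount_sub_le H.iterate_period H.dvd_iff H.lag_pos
    (n := n) (k := k) (M := M) ((hMκ _ (by omega)).trans hκn)
    (fun j => (Nat.add_le_add_right (hfitm _ (by omega) j) r).trans (hfit j))
    (by omega) hz
  have htriple : ∀ m ∈ Finset.range (M + 1), ∀ m' ∈ Finset.range (M + 1), ∀ y,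
      ((X (k - κ * m') y * X k y * X (k + κ * m) y : ℕ) : ℝ) =
        (X (k - κ * m') y : ℝ) * X (k - κ * m' + κ * (m + m')) y := by
    intro m hm m' hm' y
    rw [Finset.mem_range] at hm hm'
    rw [← Nat.cast_mul]
    congr 1
    refine recurrence_triple_eq H.iterate_period H.dvd_iff (fun j => ?_) ?_ y
    · exact (hfitm _ (by omega) j).trans ((Nat.le_add_right _ _).trans (hfit j))
    · have := hMκ m' (by omega)
      omega
  set Qf : (ℕ → 𝒜) → ℝ := fun y => (X k y : ℝ) * z ^ neighbourCount d x n k y with hQf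
  set Sf : (ℕ → 𝒜) → ℝ := fun y => ∑ m ∈ Finset.range (M + 1), ∑ m' ∈ Finset.range (M + 1),
    runCoeff z m * runCoeff z m' * ((X (k - κ * m') y : ℝ) *
      X (k - κ * m' + κ * (m + m')) y) with hSf
  set Bf : (ℕ → 𝒜) → ℝ := fun y => ∑ s ∈ insert (κ * (M + 1)) (badLags d r κ n),
    ((X k y : ℝ) * X (k + s) y + (X k y : ℝ) * X (k - s) y) with hBf
  have hptw : ∀ y, |Qf y - Sf y| ≤ Bf y := by
    intro y
    have := hpt y
    rw [Finset.sum_congr rfl fun m hm => Finset.sum_congr rfl fun m' hm' => by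
      rw [htriple m hm m' hm' y]] at this
    exact this
  have iQ : Integrable Qf P := integrable_of_abs_le (C := 1)
    ((measurable_recurrence_cast n k).mul
      (measurable_pow_of_nat (measurable_neighbourCount n k) z)) fun y => by
      have h1 := recurrence_cast_mem_Icc (d := d) (x := x) n k y
      have h2 := pow_mem_Icc hz (neighbourCount d x n k y)
      rw [abs_of_nonneg (mul_nonneg h1.1 h2.1)]
      exact mul_le_one₀ h1.2 h2.1 h2.2
  have iS : Integrable Sf P := integrable_finsetSum _ fun m _ => integrable_finsetSum _ fun m' _ =>
    (integrable_recurrence_mul n _ _).const_mul _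
  have iX : ∀ s, Integrable (fun y => (X k y : ℝ) * X (k + s) y + (X k y : ℝ) * X (k - s) y) P :=
    fun s => (integrable_recurrence_mul n _ _).add (integrable_recurrence_mul n _ _)
  have iB : Integrable Bf P := integrable_finsetSum _ fun s _ => iX s
  have hQS : |∫ y, Qf y ∂P - ∫ y, Sf y ∂P| ≤ ∫ y, Bf y ∂P := by
    rw [← integral_sub iQ iS]
    exact (abs_integral_le_integral_abs).trans (integral_mono (iQ.sub iS).abs iB hptw)
  have hSint : ∫ y, Sf y ∂P = ∑ m ∈ Finset.range (M + 1), ∑ m' ∈ Finset.range (M + 1),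
      runCoeff z m * runCoeff z m' * P.real (hitEvent d x n (k - κ * m') ∩
        hitEvent d x n (k - κ * m' + κ * (m + m'))) := by
    rw [hSf, integral_finsetSum _ fun m _ => integrable_finsetSum _ fun m' _ =>
      (integrable_recurrence_mul n _ _).const_mul _]
    refine Finset.sum_congr rfl fun m _ => ?_
    rw [integral_finsetSum _ fun m' _ => (integrable_recurrence_mul n _ _).const_mul _]
    refine Finset.sum_congr rfl fun m' _ => ?_
    rw [integral_const_mul, integral_recurrence_mul]
  have hBint : ∫ y, Bf y ∂P ≤ (2 * ρ ^ (M + 1) + 2 * ε₁ + ε / 2) * p ^ ℓ := by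
    have hBeq : ∫ y, Bf y ∂P = ∑ s ∈ insert (κ * (M + 1)) (badLags d r κ n),
        (P.real (hitEvent d x n k ∩ hitEvent d x n (k + s)) +
          P.real (hitEvent d x n k ∩ hitEvent d x n (k - s))) := by
      rw [hBf, integral_finsetSum _ fun s _ => iX s]
      refine Finset.sum_congr rfl fun s _ => ?_
      rw [integral_add (integrable_recurrence_mul n _ _) (integrable_recurrence_mul n _ _),
        integral_recurrence_mul, integral_recurrence_mul]
    have hleft : ∀ s, s ≤ k → hitEvent d x n k ∩ hitEvent d x n (k - s) =
        hitEvent d x n (k - s) ∩ hitEvent d x n (k - s + s) := fun s hs => by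
      rw [Nat.sub_add_cancel hs, Set.inter_comm]
    have hnot : κ * (M + 1) ∉ badLags d r κ n := by
      intro hmem
      rcases (Finset.mem_filter.1 hmem).2 with h | ⟨j, hj⟩
      · exact h (dvd_mul_right κ _)
      · have h1 := hfitm (M + 1) (by omega) j
        have h2 := hfit j
        omega
    have hκM : κ * (M + 1) ≤ n := (hMκ _ (by omega)).trans hκn
    rw [hBeq, Finset.sum_insert hnot]
    have hfirst : P.real (hitEvent d x n k ∩ hitEvent d x n (k + κ * (M + 1))) +
        P.real (hitEvent d x n k ∩ hitEvent d x n (k - κ * (M + 1))) ≤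
        2 * ((ρ ^ (M + 1) + ε₁) * p ^ ℓ) := by
      have h1 := (abs_le.1 (hq (M + 1) (Finset.mem_range.2 (by omega)) k (by omega))).2
      have h2 := (abs_le.1 (hq (M + 1) (Finset.mem_range.2 (by omega)) (k - κ * (M + 1))
        (by omega))).2
      rw [hleft _ (by omega)]
      linarith
    have hsecond : ∑ s ∈ badLags d r κ n,
        (P.real (hitEvent d x n k ∩ hitEvent d x n (k + s)) +
          P.real (hitEvent d x n k ∩ hitEvent d x n (k - s))) ≤ ε / 2 * p ^ ℓ := by
      have hterm : ∀ s ∈ badLags d r κ n,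
          P.real (hitEvent d x n k ∩ hitEvent d x n (k + s)) +
            P.real (hitEvent d x n k ∩ hitEvent d x n (k - s)) ≤
          2 * (K * p ^ ℓ * P.real (PiNat.cylinder x (n - r))) := by
        intro s hs
        have hsn : s ≤ n := (Finset.mem_Icc.1 (Finset.mem_filter.1 hs).1).2
        have h1 := measureReal_hitEvent_inter_le_of_isBadLag H.measurePreserving (H.mixesAt 0)
          (H.psi_nonneg 0) H.strictMono H.minimalPeriod_eq H.period_pos H.le_bound H.dvd_iff
          (k := k) (by omega) hrn hs
        have h2 := measureReal_hitEvent_inter_le_of_isBadLag H.measurePreserving (H.mixesAt 0)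
          (H.psi_nonneg 0) H.strictMono H.minimalPeriod_eq H.period_pos H.le_bound H.dvd_iff
          (k := k - s) (by omega) hrn hs
        rw [hleft s (by omega)]
        linarith
      have hcard : ((badLags d r κ n).card : ℝ) ≤ n := by
        have := Finset.card_filter_le (Finset.Icc 1 n) (IsBadLag d r κ n)
        rw [Nat.card_Icc, Nat.add_sub_cancel] at this
        exact_mod_cast this
      have hPr : 0 ≤ P.real (PiNat.cylinder x (n - r)) := measureReal_nonneg
      calc _ ≤ ∑ s ∈ badLags d r κ n, 2 * (K * p ^ ℓ * P.real (PiNat.cylinder x (n - r))) :=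
            Finset.sum_le_sum hterm
        _ = (badLags d r κ n).card * (2 * (K * p ^ ℓ * P.real (PiNat.cylinder x (n - r)))) := by
            rw [Finset.sum_const, nsmul_eq_mul]
        _ ≤ n * (2 * (K * p ^ ℓ * P.real (PiNat.cylinder x (n - r)))) := by gcongr
        _ = 2 * K * (n * P.real (PiNat.cylinder x (n - r))) * p ^ ℓ := by ring
        _ ≤ ε / 2 * p ^ ℓ := mul_le_mul_of_nonneg_right hbad hp0
    linarith
  have hSlim : |∫ y, Sf y ∂P - p ^ ℓ * (∑ m ∈ Finset.range (M + 1), runCoeff z m * ρ ^ m) ^ 2| ≤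
      ((M : ℝ) + 1) ^ 2 * ε₁ * p ^ ℓ := by
    have hsq : p ^ ℓ * (∑ m ∈ Finset.range (M + 1), runCoeff z m * ρ ^ m) ^ 2 =
        ∑ m ∈ Finset.range (M + 1), ∑ m' ∈ Finset.range (M + 1),
          runCoeff z m * runCoeff z m' * (p ^ ℓ * ρ ^ (m + m')) := by
      rw [sq, Finset.sum_mul_sum, Finset.mul_sum]
      refine Finset.sum_congr rfl fun m _ => ?_
      rw [Finset.mul_sum]
      refine Finset.sum_congr rfl fun m' _ => ?_
      ring
    rw [hSint, hsq, ← Finset.sum_sub_distrib]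
    have hterm : ∀ m ∈ Finset.range (M + 1), |∑ m' ∈ Finset.range (M + 1),
          runCoeff z m * runCoeff z m' * P.real (hitEvent d x n (k - κ * m') ∩
            hitEvent d x n (k - κ * m' + κ * (m + m'))) -
          ∑ m' ∈ Finset.range (M + 1), runCoeff z m * runCoeff z m' * (p ^ ℓ * ρ ^ (m + m'))| ≤
        ((M : ℝ) + 1) * (ε₁ * p ^ ℓ) := by
      intro m hm
      rw [← Finset.sum_sub_distrib]
      refine (Finset.abs_sum_le_sum_abs _ _).trans ?_
      have : ((M : ℝ) + 1) * (ε₁ * p ^ ℓ) = ∑ _m' ∈ Finset.range (M + 1), ε₁ * p ^ ℓ := by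
        rw [Finset.sum_const, Finset.card_range, nsmul_eq_mul]
        push_cast
        ring
      rw [this]
      refine Finset.sum_le_sum fun m' hm' => ?_
      rw [Finset.mem_range] at hm hm'
      have hκm' := hMκ m' (by omega)
      rw [← mul_sub, abs_mul, abs_mul]
      refine (mul_le_of_le_one_left (abs_nonneg _) (mul_le_one₀ (abs_runCoeff_le hz m)
        (abs_nonneg _) (abs_runCoeff_le hz m'))).trans ?_
      exact hq (m + m') (Finset.mem_range.2 (by omega)) (k - κ * m') (by omega)
    refine (Finset.abs_sum_le_sum_abs _ _).trans ((Finset.sum_le_sum hterm).trans ?_)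
    rw [Finset.sum_const, Finset.card_range, nsmul_eq_mul]
    push_cast
    exact le_of_eq (by ring)
  have hε₁eq : (2 + ((M : ℝ) + 1) ^ 2) * ε₁ = ε / 2 := by
    rw [hε₁]
    field_simp
  have hfinal := (abs_sub_le _ _ _).trans (add_le_add (hQS.trans hBint) hSlim)
  refine hfinal.trans (le_of_eq ?_)
  have : (2 * ρ ^ (M + 1) + 2 * ε₁ + ε / 2) * p ^ ℓ + ((M : ℝ) + 1) ^ 2 * ε₁ * p ^ ℓ =
    (2 * ρ ^ (M + 1) + (2 + ((M : ℝ) + 1) ^ 2) * ε₁ + ε / 2) * p ^ ℓ := by ring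
  rw [this, hε₁eq]
  ring

theorem eventually_abs_integral_neighbour_sub_le
    (H : PeriodicHitting P d x ψ r κ D e θ) {ε : ℝ} (hε : 0 < ε) :
    ∀ᶠ n in atTop, ∀ k, (D + 4) * n ≤ k → ∀ z ∈ Set.Icc (0 : ℝ) 1,
      |∫ y, (recurrence d (PiNat.cylinder x n) k y : ℝ) * z ^ neighbourCount d x n k y ∂P -
        P.real (PiNat.cylinder x n) ^ ℓ *
          ((1 - θ ^ ∑ j, e j) / (1 - θ ^ (∑ j, e j) * z)) ^ 2| ≤
      ε * P.real (PiNat.cylinder x n) ^ ℓ := by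
  have hρ := H.rho_mem
  set ρ := θ ^ ∑ j, e j with hρdef
  -- Truncating the runs costs `2 ρ^(M+1)`, and replacing the finite sum by its limit costs `3
  -- ρ^(M+1)`.
  have hlim : Tendsto (fun M : ℕ => 5 * ρ ^ (M + 1)) atTop (𝓝 0) := by
    simpa using ((tendsto_pow_atTop_nhds_zero_of_lt_one hρ.1 hρ.2).comp
      (tendsto_add_atTop_nat 1)).const_mul 5
  obtain ⟨M, hM⟩ := (hlim.eventually_le_const (show 0 < ε / 2 by linarith)).exists
  filter_upwards [H.eventually_abs_integral_neighbour_sub_le_of_trunc M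
    (show 0 < ε / 2 by linarith)] with n hn k hk z hz
  have h1 := hn k hk z hz
  have h2 := abs_sum_runCoeff_pow_sub_le hz hρ M
  have hp0 : 0 ≤ P.real (PiNat.cylinder x n) ^ ℓ := pow_nonneg measureReal_nonneg ℓ
  have h3 : |P.real (PiNat.cylinder x n) ^ ℓ *
      (∑ m ∈ Finset.range (M + 1), runCoeff z m * ρ ^ m) ^ 2 -
      P.real (PiNat.cylinder x n) ^ ℓ * ((1 - ρ) / (1 - ρ * z)) ^ 2| ≤
      3 * ρ ^ (M + 1) * P.real (PiNat.cylinder x n) ^ ℓ := by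
    rw [← mul_sub, abs_mul, abs_of_nonneg hp0, mul_comm]
    exact mul_le_mul_of_nonneg_right h2 hp0
  refine (abs_sub_le _ _ _).trans ((add_le_add h1 h3).trans ?_)
  rw [← add_mul]
  exact mul_le_mul_of_nonneg_right (by linarith) hp0

end PeriodicHitting

end

/-! ### Decoupling a hit and its neighbours from the far hits -/

section

variable {𝒜 : Type*} [MeasurableSpace 𝒜] [DiscreteMeasurableSpace 𝒜] [Countable 𝒜]
  {P : Measure (ℕ → 𝒜)} [IsProbabilityMeasure P] {ℓ : ℕ} {d : Fin ℓ → ℕ} {x : ℕ → 𝒜}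

theorem AlmostIndep.abs_sub_le {δ : ℝ} (h0 : 0 ≤ δ) (h1 : δ < 1) {q Q : ℕ} (hq : q ≤ Q)
    {E F : Set (ℕ → 𝒜)} (h : AlmostIndep P δ q E F) :
    |P.real (E ∩ F) - P.real E * P.real F| ≤
      (((1 + δ) / (1 - δ)) ^ Q - 1) * (P.real E * P.real F) := by
  obtain ⟨a, b⟩ := h
  set u := P.real (E ∩ F)
  set v := P.real E * P.real F
  have hv : 0 ≤ v := mul_nonneg measureReal_nonneg measureReal_nonneg
  have hδ : 0 < 1 - δ := by linarith
  set c := (1 + δ) / (1 - δ) with hc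
  have hc1 : 1 ≤ c := (one_le_div hδ).2 (by linarith)
  have hcq : c ^ q = (1 + δ) ^ q / (1 - δ) ^ q := div_pow _ _ _
  have hpow : c ^ q ≤ c ^ Q := pow_le_pow_right₀ hc1 hq
  have hq1 : 1 ≤ c ^ q := one_le_pow₀ hc1
  have hd : 0 < (1 - δ) ^ q := pow_pos hδ q
  have a' : u ≤ c ^ q * v := by
    rw [hcq, div_mul_eq_mul_div, le_div_iff₀ hd]
    linarith
  have b' : v ≤ c ^ q * u := by
    rw [hcq, div_mul_eq_mul_div, le_div_iff₀ hd]
    linarith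
  have hu : 0 ≤ u := measureReal_nonneg
  rw [abs_le]
  constructor
  -- If `u ≤ v`, then `v - u ≤ (c^q - 1) u`, and `u` may be replaced by `v`.
  · by_cases huv : u ≤ v
    · nlinarith
    · nlinarith
  · nlinarith

theorem recurrence_congr {n k : ℕ} {y y' : ℕ → 𝒜}
    (h : ∀ j, ∀ i < n, y (d j * k + i) = y' (d j * k + i)) :
    recurrence d (PiNat.cylinder x n) k y = recurrence d (PiNat.cylinder x n) k y' := by
  have : y ∈ hitEvent d x n k ↔ y' ∈ hitEvent d x n k := by
    simp only [mem_hitEvent_iff]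
    refine forall_congr' fun j => forall_congr' fun i => forall_congr' fun hi => ?_
    rw [add_comm i, h j i hi]
  simp only [recurrence_eq_indicator]
  by_cases hy : y ∈ hitEvent d x n k
  · rw [Set.indicator_of_mem hy, Set.indicator_of_mem (this.1 hy)]
    rfl
  · rw [Set.indicator_of_notMem hy, Set.indicator_of_notMem fun h => hy (this.2 h)]

/-- The blocks belonging to `k'` are far from the blocks belonging to `k`. -/
def IsFar (d : Fin ℓ → ℕ) (D n k k' : ℕ) : Prop :=
  ∀ i j, d i * k' + (D + 2) * n ≤ d j * k ∨ d j * k + (D + 2) * n ≤ d i * k'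

/-- The number of hits with index in `s`. -/
noncomputable def hitCount (d : Fin ℓ → ℕ) (x : ℕ → 𝒜) (n : ℕ) (s : Finset ℕ) (y : ℕ → 𝒜) : ℕ :=
  ∑ k ∈ s, recurrence d (PiNat.cylinder x n) k y

theorem measurable_hitCount (n : ℕ) (s : Finset ℕ) : Measurable (hitCount d x n s) :=
  Finset.measurable_fun_sum _ fun _ _ => measurable_recurrence n _

/-- The coordinates of the blocks close to those of `k`. -/
def nearCoords (d : Fin ℓ → ℕ) (D n k : ℕ) : Finset ℕ :=
  Finset.univ.biUnion fun j => Finset.Ico (d j * k - D * n) (d j * k + D * n + n)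

/-- The coordinates of the blocks with index in `s`. -/
def blockCoords (d : Fin ℓ → ℕ) (n : ℕ) (s : Finset ℕ) : Finset ℕ :=
  s.biUnion fun k => Finset.univ.biUnion fun j => Finset.Ico (d j * k) (d j * k + n)

theorem dependsOn_hitCount (n : ℕ) (s : Finset ℕ) (z : ℝ) :
    DependsOn (fun y => z ^ hitCount d x n s y) (blockCoords d n s : Set ℕ) := by
  intro y y' h
  have : hitCount d x n s y = hitCount d x n s y' := by
    refine Finset.sum_congr rfl fun k hk => recurrence_congr fun j i hi => h _ ?_
    simp only [blockCoords, Finset.coe_biUnion, Set.mem_iUnion, Finset.mem_coe, Finset.mem_univ,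
      Finset.mem_Ico]
    exact ⟨k, hk, j, trivial, by omega, by omega⟩
  simp only [this]

theorem dependsOn_neighbour {D n k : ℕ} (hD : ∀ j, d j ≤ D) (hnk : n ≤ k) (z : ℝ) :
    DependsOn (fun y => (recurrence d (PiNat.cylinder x n) k y : ℝ) *
      z ^ neighbourCount d x n k y) (nearCoords d D n k : Set ℕ) := by
  intro y y' h
  have key : ∀ k', k ≤ k' + n → k' ≤ k + n →
      recurrence d (PiNat.cylinder x n) k' y = recurrence d (PiNat.cylinder x n) k' y' := by
    intro k' h1 h2
    refine recurrence_congr fun j i hi => h _ ?_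
    simp only [nearCoords, Finset.coe_biUnion, Set.mem_iUnion, Finset.mem_coe, Finset.mem_univ,
      Finset.mem_Ico]
    have e1 : d j * k ≤ d j * k' + d j * n := by
      rw [← Nat.mul_add]
      exact Nat.mul_le_mul_left _ h1
    have e2 : d j * k' ≤ d j * k + d j * n := by
      rw [← Nat.mul_add]
      exact Nat.mul_le_mul_left _ h2
    have e3 : d j * n ≤ D * n := Nat.mul_le_mul_right _ (hD j)
    exact ⟨j, trivial, by omega, by omega⟩
  have hn : neighbourCount d x n k y = neighbourCount d x n k y' := by
    unfold neighbourCount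
    congr 1
    · refine Finset.sum_congr rfl fun s hs => ?_
      rw [Finset.mem_Icc] at hs
      exact key _ (by omega) (by omega)
    · refine Finset.sum_congr rfl fun s hs => ?_
      rw [Finset.mem_Icc] at hs
      exact key _ (by omega) (by omega)
  simp only [hn, key k (by omega) (by omega)]

/-- Each of the `ℓ` windows around the blocks of `k` is flanked by two empty gaps of length `n`, so
`2ℓ` cuts separate near from far coordinates, however these interleave. -/
theorem almostIndep_near_far (hT : MeasurePreserving shift P P) {n : ℕ} {δ : ℝ}
    (hmix : MixesAt P n δ) (h0 : 0 ≤ δ) (h1 : δ < 1) (hd1 : ∀ j, 1 ≤ d j) (hd : StrictMono d)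
    {D k : ℕ} (hk : (2 * D + 5) * n ≤ k) {s : Finset ℕ} (hs : ∀ k' ∈ s, IsFar d D n k k')
    (y y' : ℕ → 𝒜) :
    |P.real (coordCylinder (nearCoords d D n k : Set ℕ) y ∩
        coordCylinder (blockCoords d n s : Set ℕ) y') -
      P.real (coordCylinder (nearCoords d D n k : Set ℕ) y) *
        P.real (coordCylinder (blockCoords d n s : Set ℕ) y')| ≤
      (((1 + δ) / (1 - δ)) ^ (2 * ℓ) - 1) *
        (P.real (coordCylinder (nearCoords d D n k : Set ℕ) y) *
          P.real (coordCylinder (blockCoords d n s : Set ℕ) y')) := by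
  classical
  set w := D * n with hw
  have hk' : 2 * w + 5 * n ≤ k := by
    rw [hw, ← mul_assoc, ← Nat.add_mul]
    exact hk
  have hR : (D + 2) * n = w + 2 * n := by rw [Nat.add_mul]
  -- The left gap ends where the window `[d j * k - w, d j * k + w + n)` begins, and the right gap
  -- starts where it ends. The radius `(D + 2) * n = w + 2n` in `IsFar` keeps far blocks out of both
  -- gaps.
  let B : Finset ℕ := (Finset.univ.image fun j => d j * k - (w + n)) ∪
    Finset.univ.image fun j => d j * k + (w + n)
  have hcard : B.card ≤ 2 * ℓ := by
    refine (Finset.card_union_le _ _).trans ?_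
    have h1 := Finset.card_image_le (s := Finset.univ) (f := fun j => d j * k - (w + n))
    have h2 := Finset.card_image_le (s := Finset.univ) (f := fun j => d j * k + (w + n))
    rw [Finset.card_univ, Fintype.card_fin] at h1 h2
    omega
  have hB : ∀ b ∈ B, ∃ j, b = d j * k - (w + n) ∨ b = d j * k + (w + n) := by
    intro b hb
    rcases Finset.mem_union.1 hb with hb | hb
    · obtain ⟨j, -, rfl⟩ := Finset.mem_image.1 hb
      exact ⟨j, Or.inl rfl⟩
    · obtain ⟨j, -, rfl⟩ := Finset.mem_image.1 hb
      exact ⟨j, Or.inr rfl⟩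
  have hBl : ∀ j, d j * k - (w + n) ∈ B := fun j =>
    Finset.mem_union_left _ (Finset.mem_image_of_mem _ (Finset.mem_univ j))
  have hBr : ∀ j, d j * k + (w + n) ∈ B := fun j =>
    Finset.mem_union_right _ (Finset.mem_image.2 ⟨j, Finset.mem_univ j, rfl⟩)
  have hdk : ∀ j, k ≤ d j * k := fun j => Nat.le_mul_of_pos_left k (hd1 j)
  have hsep : ∀ i j, i = j ∨ d i * k + k ≤ d j * k ∨ d j * k + k ≤ d i * k := by
    intro i j
    rcases lt_trichotomy i j with h | h | h
    · exact Or.inr (Or.inl (strictMono_mul_add_le hd h k))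
    · exact Or.inl h
    · exact Or.inr (Or.inr (strictMono_mul_add_le hd h k))
  have hU : ∀ u ∈ (nearCoords d D n k : Set ℕ), ∃ j, d j * k - w ≤ u ∧ u < d j * k + w + n := by
    intro u hu
    simpa [nearCoords] using hu
  have hV : ∀ v ∈ (blockCoords d n s : Set ℕ), ∀ j,
      v + (w + n) < d j * k ∨ d j * k + w + 2 * n ≤ v := by
    intro v hv j
    simp only [blockCoords, Finset.coe_biUnion, Set.mem_iUnion, Finset.mem_coe, Finset.mem_univ,
      Finset.mem_Ico] at hv
    obtain ⟨k', hk's, i, -, hv1, hv2⟩ := hv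
    have := hs k' hk's i j
    rw [hR] at this
    omega
  refine (almostIndep_of_cuts hT hmix h0 h1.le B y y' _ _ ?_ ?_ ?_).abs_sub_le h0 h1 hcard
  · intro b hb u hu
    obtain ⟨i, hi1, hi2⟩ := hU u hu
    obtain ⟨j, hj⟩ := hB b hb
    have h1 := hdk i
    have h2 := hdk j
    rcases hsep i j with rfl | h | h <;> omega
  · intro b hb v hv
    obtain ⟨j, hj⟩ := hB b hb
    have h1 := hV v hv j
    have h2 := hdk j
    omega
  · intro u hu v hv
    obtain ⟨j, hj1, hj2⟩ := hU u hu
    have h2 := hdk j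
    rcases hV v hv j with h | h
    · exact ⟨_, hBl j, Or.inr (by omega)⟩
    · exact ⟨_, hBr j, Or.inl (by omega)⟩

/-- For each pair of multipliers, `k' ↦ d i * k'` is injective into an interval of length at most
`2(D+2)n` around `d j * k`. -/
theorem card_filter_not_isFar_le (hd1 : ∀ j, 1 ≤ d j) (D n k : ℕ) (s : Finset ℕ)
    [DecidablePred fun k' => ¬ IsFar d D n k k'] :
    (s.filter fun k' => ¬ IsFar d D n k k').card ≤ ℓ * ℓ * (2 * ((D + 2) * n)) := by
  classical
  set R := (D + 2) * n with hR
  have hsub : (s.filter fun k' => ¬ IsFar d D n k k') ⊆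
      (Finset.univ : Finset (Fin ℓ × Fin ℓ)).biUnion fun ij =>
        s.filter fun k' => d ij.2 * k < d ij.1 * k' + R ∧ d ij.1 * k' < d ij.2 * k + R := by
    intro k' hk'
    obtain ⟨h1, h2⟩ := Finset.mem_filter.1 hk'
    unfold IsFar at h2
    push Not at h2
    obtain ⟨i, j, hij⟩ := h2
    exact Finset.mem_biUnion.2 ⟨(i, j), Finset.mem_univ _, Finset.mem_filter.2 ⟨h1, hij⟩⟩
  refine (Finset.card_le_card hsub).trans (Finset.card_biUnion_le.trans ?_)
  have hone : ∀ ij ∈ (Finset.univ : Finset (Fin ℓ × Fin ℓ)),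
      (s.filter fun k' => d ij.2 * k < d ij.1 * k' + R ∧ d ij.1 * k' < d ij.2 * k + R).card ≤
        2 * R := by
    rintro ⟨i, j⟩ -
    have hc : (Finset.Ico (d j * k - R) (d j * k + R)).card ≤ 2 * R := by
      rw [Nat.card_Ico]
      omega
    refine (Finset.card_le_card_of_injOn (fun k' => d i * k') (fun k' hk' => ?_)
      (fun a _ b _ hab => Nat.eq_of_mul_eq_mul_left (hd1 i) hab)).trans hc
    have hlt : d j * k < d i * k' + R ∧ d i * k' < d j * k + R := (Finset.mem_filter.1 hk').2
    change d i * k' ∈ _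
    rw [Finset.mem_coe, Finset.mem_Ico]
    exact ⟨by omega, hlt.2⟩
  refine (Finset.sum_le_sum hone).trans (le_of_eq ?_)
  simp

theorem sum_Icc_symm_eq (f : ℕ → ℕ) (k n : ℕ) (hnk : n ≤ k) :
    ∑ i ∈ Finset.Icc (k - n) (k + n), f i =
      f k + (∑ s ∈ Finset.Icc 1 n, f (k + s) + ∑ s ∈ Finset.Icc 1 n, f (k - s)) := by
  induction n with
  | zero => simp
  | succ n ih =>
    have h1 : k - (n + 1) + 1 = k - n := by omega
    rw [Finset.sum_Icc_succ_top (by omega), Finset.sum_Icc_succ_top (by omega),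
      ← add_assoc k n 1, Finset.sum_Icc_succ_top (by omega),
      ← Finset.Ico_add_one_right_eq_Icc (k - (n + 1)),
      Finset.sum_eq_sum_Ico_succ_bot (by omega), h1, Finset.Ico_add_one_right_eq_Icc,
      ih (by omega)]
    ring

theorem abs_pow_add_sub_pow_le {z : ℝ} (hz : z ∈ Set.Icc (0 : ℝ) 1) (a b : ℕ) :
    |z ^ (a + b) - z ^ a| ≤ b := by
  rcases Nat.eq_zero_or_pos b with rfl | hb
  · simp
  · exact (abs_pow_sub_pow_le_one hz _ _).trans (by exact_mod_cast hb)

theorem hitCount_union_of_disjoint {n : ℕ} {s t : Finset ℕ} (hst : Disjoint s t) (y : ℕ → 𝒜) :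
    hitCount d x n (s ∪ t) y = hitCount d x n s y + hitCount d x n t y :=
  Finset.sum_union hst

theorem integrable_pow_hitCount {z : ℝ} (hz : z ∈ Set.Icc (0 : ℝ) 1) (n : ℕ) (s : Finset ℕ) :
    Integrable (fun y => z ^ hitCount d x n s y) P :=
  integrable_of_abs_le (measurable_pow_of_nat (measurable_hitCount n s) z) (C := 1) fun y => by
    have := pow_mem_Icc hz (hitCount d x n s y)
    rw [abs_of_nonneg this.1]
    exact this.2

theorem integrable_recurrence_mul_pow {z : ℝ} (hz : z ∈ Set.Icc (0 : ℝ) 1) (n k : ℕ)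
    {f : (ℕ → 𝒜) → ℕ} (hf : Measurable f) :
    Integrable (fun y => (recurrence d (PiNat.cylinder x n) k y : ℝ) * z ^ f y) P :=
  integrable_of_abs_le ((measurable_recurrence_cast n k).mul (measurable_pow_of_nat hf z))
    (C := 1) fun y => by
      have h1 := recurrence_cast_mem_Icc (d := d) (x := x) n k y
      have h2 := pow_mem_Icc hz (f y)
      rw [abs_of_nonneg (mul_nonneg h1.1 h2.1)]
      exact mul_le_one₀ h1.2 h2.1 h2.2

theorem integral_recurrence_mul_pow_mem {z : ℝ} (hz : z ∈ Set.Icc (0 : ℝ) 1) (n k : ℕ)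
    {f : (ℕ → 𝒜) → ℕ} (hf : Measurable f) :
    0 ≤ ∫ y, (recurrence d (PiNat.cylinder x n) k y : ℝ) * z ^ f y ∂P ∧
    ∫ y, (recurrence d (PiNat.cylinder x n) k y : ℝ) * z ^ f y ∂P ≤
      P.real (hitEvent d x n k) := by
  constructor
  · exact integral_nonneg fun y =>
      mul_nonneg (recurrence_cast_mem_Icc n k y).1 (pow_mem_Icc hz _).1
  · rw [← integral_recurrence]
    exact integral_mono (integrable_recurrence_mul_pow hz n k hf) (integrable_recurrence n k)
      fun y => mul_le_of_le_one_right (recurrence_cast_mem_Icc n k y).1 (pow_mem_Icc hz _).2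

theorem integral_pow_hitCount_mem {z : ℝ} (hz : z ∈ Set.Icc (0 : ℝ) 1) (n : ℕ) (s : Finset ℕ) :
    ∫ y, z ^ hitCount d x n s y ∂P ∈ Set.Icc (0 : ℝ) 1 := by
  constructor
  · exact integral_nonneg fun y => (pow_mem_Icc hz _).1
  · have := integral_mono (μ := P) (integrable_pow_hitCount (d := d) (x := x) hz n s)
      (integrable_const 1) fun y => (pow_mem_Icc hz _).2
    simpa using this

theorem abs_integral_pow_hitCount_union_sub_le {z : ℝ} (hz : z ∈ Set.Icc (0 : ℝ) 1) (n : ℕ)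
    {s t : Finset ℕ} (hst : Disjoint s t) {c : ℝ}
    (hc : ∀ k ∈ t, P.real (hitEvent d x n k) ≤ c) :
    |∫ y, z ^ hitCount d x n s y ∂P - ∫ y, z ^ hitCount d x n (s ∪ t) y ∂P| ≤ t.card * c := by
  rw [← integral_sub (integrable_pow_hitCount hz n s) (integrable_pow_hitCount hz n (s ∪ t))]
  have hi : Integrable (fun y => ∑ k ∈ t, (recurrence d (PiNat.cylinder x n) k y : ℝ)) P :=
    integrable_finsetSum _ fun k _ => integrable_recurrence n k
  refine abs_integral_le_integral_abs.trans ((integral_mono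
    ((integrable_pow_hitCount hz n s).sub (integrable_pow_hitCount hz n (s ∪ t))).abs hi
    fun y => ?_).trans ?_)
  · simp only [Pi.sub_apply]
    rw [hitCount_union_of_disjoint hst, abs_sub_comm]
    refine (abs_pow_add_sub_pow_le hz _ _).trans (le_of_eq ?_)
    simp [hitCount]
  · rw [integral_finsetSum _ fun k _ => integrable_recurrence n k]
    simp only [integral_recurrence]
    exact (Finset.sum_le_card_nsmul t _ c hc).trans (by simp)

namespace PeriodicHitting

variable {ψ : ℕ → ℝ} {r κ D : ℕ} {e : Fin ℓ → ℕ} {θ : ℝ}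

theorem measureReal_hitEvent_le (H : PeriodicHitting P d x ψ r κ D e θ) {n k : ℕ} (hk : n ≤ k) :
    P.real (hitEvent d x n k) ≤ (1 + ψ 0) ^ (ℓ + 1) * P.real (PiNat.cylinder x n) ^ ℓ := by
  refine ((H.mixesAt 0).measureReal_hitEvent_le H.measurePreserving (H.psi_nonneg 0)
    H.strictMono hk).trans ?_
  have := H.psi_nonneg 0
  gcongr
  · linarith
  · omega

/-- The four error terms come from dropping the intermediate indices, decoupling near from far,
putting the non-far indices back to recover the full generating function, and inserting the cluster
weight `g`. -/
theorem abs_integral_recurrence_mul_pow_sub_le (H : PeriodicHitting P d x ψ r κ D e θ)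
    {n k N : ℕ} (hn : 1 ≤ n) (hψn : ψ n < 1) (hk : (2 * D + 5) * n + n ≤ k) (hkN : k + n ≤ N)
    {z g η : ℝ} (hz : z ∈ Set.Icc (0 : ℝ) 1)
    (hη : |∫ y, (recurrence d (PiNat.cylinder x n) k y : ℝ) * z ^ neighbourCount d x n k y ∂P -
        P.real (PiNat.cylinder x n) ^ ℓ * g| ≤ η * P.real (PiNat.cylinder x n) ^ ℓ) :
    |∫ y, (recurrence d (PiNat.cylinder x n) k y : ℝ) *
        z ^ (hitCount d x n (Finset.Icc ((2 * D + 5) * n) N) y - 1) ∂P -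
      P.real (PiNat.cylinder x n) ^ ℓ * g *
        ∫ y, z ^ hitCount d x n (Finset.Icc ((2 * D + 5) * n) N) y ∂P| ≤
    ((ℓ * ℓ * (2 * ((D + 2) * n)) : ℕ) * (1 + ψ 0) ^ (ℓ + 1) * P.real (PiNat.cylinder x n) +
      (((1 + ψ n) / (1 - ψ n)) ^ (2 * ℓ) - 1) * (1 + ψ 0) ^ (ℓ + 1) +
      (1 + ψ 0) ^ (ℓ + 1) * ((ℓ * ℓ * (2 * ((D + 2) * n)) : ℕ) * (1 + ψ 0) ^ (ℓ + 1) *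
        P.real (PiNat.cylinder x n)) + η) * P.real (PiNat.cylinder x n) ^ ℓ := by
  classical
  set a := (2 * D + 5) * n with ha
  set p := P.real (PiNat.cylinder x n) with hp
  set K := (1 + ψ 0) ^ (ℓ + 1) with hK
  set B := ℓ * ℓ * (2 * ((D + 2) * n)) with hB
  set β := ((1 + ψ n) / (1 - ψ n)) ^ (2 * ℓ) - 1 with hβ
  have hp0 : 0 ≤ p := measureReal_nonneg
  have hp1 : p ≤ 1 := measureReal_le_one
  have hK0 : 0 ≤ K := pow_nonneg (by linarith [H.psi_nonneg 0]) _
  have hna : n ≤ a := Nat.le_mul_of_pos_left n (by omega)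
  have hβ0 : 0 ≤ β := by
    have h1 : 0 < 1 - ψ n := by linarith
    have : 1 ≤ (1 + ψ n) / (1 - ψ n) := (one_le_div h1).2 (by linarith [H.psi_nonneg n])
    exact sub_nonneg.2 (one_le_pow₀ this)
  have hpℓ : p ^ ℓ ≤ p := by
    have := pow_le_pow_of_le_one hp0 hp1 (show 1 ≤ ℓ from H.card_pos)
    simpa using this
  set s := Finset.Icc a N with hs
  set far := s.filter (IsFar d D n k) with hfar
  set nf := s.filter (fun k' => ¬ IsFar d D n k k') with hnf
  set near := Finset.Icc (k - n) (k + n) with hnear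
  set mid := nf \ near with hmid
  have hsfn : far ∪ nf = s := Finset.filter_union_filter_not_eq _ _
  have hdisj : Disjoint far nf := Finset.disjoint_filter_filter_not _ _ _
  have hcard : (nf.card : ℝ) ≤ B := by
    exact_mod_cast card_filter_not_isFar_le H.one_le D n k s
  have hnearsub : near ⊆ nf := by
    intro k' hk'
    rw [hnear, Finset.mem_Icc] at hk'
    refine Finset.mem_filter.2 ⟨Finset.mem_Icc.2 ⟨by omega, by omega⟩, fun hf => ?_⟩
    let j₀ : Fin ℓ := ⟨0, H.card_pos⟩
    have h1 := hf j₀ j₀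
    have h2 : d j₀ * n ≤ D * n := Nat.mul_le_mul_right n (H.le_bound j₀)
    have h3 : d j₀ * k' ≤ d j₀ * k + d j₀ * n := by
      rw [← Nat.mul_add]
      exact Nat.mul_le_mul_left _ hk'.2
    have h4 : d j₀ * k ≤ d j₀ * k' + d j₀ * n := by
      rw [← Nat.mul_add]
      exact Nat.mul_le_mul_left _ (by omega)
    rw [Nat.add_mul] at h1
    omega
  have hnfeq : near ∪ mid = nf := Finset.union_sdiff_of_subset hnearsub
  have hnmdisj : Disjoint near mid := Finset.disjoint_sdiff
  set X : ℕ → (ℕ → 𝒜) → ℕ := fun k => recurrence d (PiNat.cylinder x n) k with hX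
  have hnearcount : ∀ y, hitCount d x n near y = X k y + neighbourCount d x n k y := fun y =>
    sum_Icc_symm_eq (fun k => X k y) k n (by omega)
  have hcount : ∀ y, hitCount d x n s y =
      X k y + (neighbourCount d x n k y + hitCount d x n far y + hitCount d x n mid y) := by
    intro y
    rw [← hsfn, hitCount_union_of_disjoint hdisj, ← hnfeq, hitCount_union_of_disjoint hnmdisj,
      hnearcount]
    ring
  set Q : (ℕ → 𝒜) → ℝ := fun y => (X k y : ℝ) * z ^ neighbourCount d x n k y with hQ
  set G : (ℕ → 𝒜) → ℝ := fun y => z ^ hitCount d x n far y with hG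
  have hQG : ∀ y, Q y * G y =
      (X k y : ℝ) * z ^ (neighbourCount d x n k y + hitCount d x n far y) := fun y => by
    simp only [hQ, hG, pow_add]
    ring
  -- Indices outside the near range are more than `n` away from `k`, so the second hit brings an
  -- extra factor `p`.
  have hmidP : ∀ k' ∈ mid, P.real (hitEvent d x n k ∩ hitEvent d x n k') ≤ K * p ^ (ℓ + 1) := by
    intro k' hk'
    obtain ⟨hk1, hk2⟩ := Finset.mem_sdiff.1 hk'
    have hk3 := (Finset.mem_Icc.1 (Finset.mem_filter.1 hk1).1).1
    rw [hnear, Finset.mem_Icc] at hk2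
    rcases le_total k k' with hkk | hkk
    · exact (H.mixesAt 0).measureReal_hitEvent_inter_le_of_far H.measurePreserving
        (H.psi_nonneg 0) H.card_pos H.one_le H.strictMono (by omega) (by omega)
    · rw [Set.inter_comm]
      exact (H.mixesAt 0).measureReal_hitEvent_inter_le_of_far H.measurePreserving
        (H.psi_nonneg 0) H.card_pos H.one_le H.strictMono (by omega) (by omega)
  have step1 : |∫ y, (X k y : ℝ) * z ^ (hitCount d x n s y - 1) ∂P - ∫ y, Q y * G y ∂P| ≤
      B * K * p * p ^ ℓ := by
    have i1 : Integrable (fun y => (X k y : ℝ) * z ^ (hitCount d x n s y - 1)) P :=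
      integrable_recurrence_mul_pow hz n k
        ((measurable_of_countable fun j : ℕ => j - 1).comp (measurable_hitCount n s))
    have i2 : Integrable (fun y => Q y * G y) P := by
      simp only [hQG]
      exact integrable_recurrence_mul_pow hz n k
        ((measurable_neighbourCount n k).add (measurable_hitCount n far))
    have i3 : Integrable (fun y => ∑ k' ∈ mid, (X k y : ℝ) * X k' y) P :=
      integrable_finsetSum _ fun k' _ => integrable_recurrence_mul n k k'
    rw [← integral_sub i1 i2]
    refine abs_integral_le_integral_abs.trans ((integral_mono (i1.sub i2).abs i3
      fun y => ?_).trans ?_)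
    · simp only [Pi.sub_apply]
      rw [hQG, hcount y, ← Finset.mul_sum, ← mul_sub, abs_mul]
      rcases recurrence_eq_zero_or_one (d := d) (x := x) n k y with h | h
      · simp [hX, h]
      · have hx1 : X k y = 1 := h
        -- The exponent `S - 1` is the number of the other hits, because `k` itself is one.
        rw [hx1, Nat.add_sub_cancel_left]
        simp only [Nat.cast_one, abs_one, one_mul]
        refine (abs_pow_add_sub_pow_le hz _ _).trans (le_of_eq ?_)
        simp [hitCount, hX]
    · rw [integral_finsetSum _ fun k' _ => integrable_recurrence_mul n k k']
      simp only [integral_recurrence_mul]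
      have hmc : (mid.card : ℝ) ≤ B :=
        le_trans (by exact_mod_cast Finset.card_le_card Finset.sdiff_subset) hcard
      calc _ ≤ (mid.card : ℝ) * (K * p ^ (ℓ + 1)) := by
            simpa using Finset.sum_le_card_nsmul mid _ _ hmidP
        _ ≤ B * (K * p ^ (ℓ + 1)) := by gcongr
        _ = _ := by ring
  have hQmem := integral_recurrence_mul_pow_mem (P := P) (d := d) (x := x) hz n k
    (measurable_neighbourCount (d := d) (x := x) n k)
  have hQK : ∫ y, Q y ∂P ≤ K * p ^ ℓ :=
    hQmem.2.trans (H.measureReal_hitEvent_le (by omega))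
  have hGmem : ∫ y, G y ∂P ∈ Set.Icc (0 : ℝ) 1 := integral_pow_hitCount_mem hz n far
  have hFmem : ∫ y, z ^ hitCount d x n s y ∂P ∈ Set.Icc (0 : ℝ) 1 :=
    integral_pow_hitCount_mem hz n s
  have step2 : |∫ y, Q y * G y ∂P - (∫ y, Q y ∂P) * ∫ y, G y ∂P| ≤ β * K * p ^ ℓ := by
    have hne : Nonempty 𝒜 := ⟨x 0⟩
    have := abs_integral_mul_sub_le (P := P) (ε := β) (dependsOn_neighbour (d := d) (x := x)
      (k := k) (n := n) H.le_bound (by omega) z) (dependsOn_hitCount (d := d) (x := x) n far z)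
      (fun y => mul_nonneg (recurrence_cast_mem_Icc n k y).1 (pow_mem_Icc hz _).1)
      (fun y => mul_le_one₀ (recurrence_cast_mem_Icc n k y).2 (pow_mem_Icc hz _).1
        (pow_mem_Icc hz _).2)
      (fun y => (pow_mem_Icc hz _).1) (fun y => (pow_mem_Icc hz _).2)
      (almostIndep_near_far H.measurePreserving (H.mixesAt n) (H.psi_nonneg n) hψn H.one_le
        H.strictMono (by omega) fun k' hk' => (Finset.mem_filter.1 hk').2)
    refine this.trans ?_
    rw [mul_assoc β K]
    refine mul_le_mul_of_nonneg_left ?_ hβ0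
    exact (mul_le_of_le_one_right hQmem.1 hGmem.2).trans hQK
  have step3 : |∫ y, G y ∂P - ∫ y, z ^ hitCount d x n s y ∂P| ≤ B * K * p := by
    have := abs_integral_pow_hitCount_union_sub_le (P := P) (d := d) (x := x) hz n hdisj
      (c := K * p ^ ℓ) fun k' hk' => H.measureReal_hitEvent_le (by
        have := (Finset.mem_Icc.1 (Finset.mem_filter.1 hk').1).1
        omega)
    rw [hsfn] at this
    refine this.trans ?_
    calc (nf.card : ℝ) * (K * p ^ ℓ) ≤ B * (K * p) := by gcongr
      _ = _ := by ring
  set I1 := ∫ y, (X k y : ℝ) * z ^ (hitCount d x n s y - 1) ∂P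
  set I2 := ∫ y, Q y * G y ∂P
  set IQ := ∫ y, Q y ∂P
  set IG := ∫ y, G y ∂P
  set F := ∫ y, z ^ hitCount d x n s y ∂P
  have hdecomp : I1 - p ^ ℓ * g * F =
      (I1 - I2) + (I2 - IQ * IG) + IQ * (IG - F) + (IQ - p ^ ℓ * g) * F := by ring
  have step3' : |IQ * (IG - F)| ≤ K * p ^ ℓ * (B * K * p) := by
    rw [abs_mul, abs_of_nonneg hQmem.1]
    exact mul_le_mul hQK step3 (abs_nonneg _) (by positivity)
  have step4 : |(IQ - p ^ ℓ * g) * F| ≤ η * p ^ ℓ := by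
    rw [abs_mul, abs_of_nonneg hFmem.1]
    exact (mul_le_of_le_one_right (abs_nonneg _) hFmem.2).trans hη
  rw [hdecomp]
  refine (abs_add_le _ _).trans ((add_le_add ((abs_add_le _ _).trans (add_le_add
    ((abs_add_le _ _).trans (add_le_add step1 step2)) step3')) step4).trans (le_of_eq ?_))
  ring

end PeriodicHitting

end

/-! ### Generating functions and convergence in distribution -/

section GeneratingFunctions

theorem integrable_pow_nat (μ : Measure ℕ) [IsProbabilityMeasure μ] {z : ℝ}
    (hz : z ∈ Set.Icc (0 : ℝ) 1) : Integrable (fun j : ℕ => z ^ j) μ :=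
  Integrable.of_bound (measurable_of_countable _).aestronglyMeasurable 1
    (Eventually.of_forall fun j => by
      rw [Real.norm_of_nonneg (pow_nonneg hz.1 j)]
      exact pow_le_one₀ hz.1 hz.2)

/-- Taylor bounds for a probability generating function. -/
theorem pgf_taylor_bounds (μ : Measure ℕ) [IsProbabilityMeasure μ] {z : ℝ}
    (hz : z ∈ Set.Icc (0 : ℝ) 1) (k : ℕ) :
    0 ≤ ∫ j, z ^ j ∂μ - ∑ i ∈ Finset.range (k + 1), μ.real {i} * z ^ i ∧
    ∫ j, z ^ j ∂μ - ∑ i ∈ Finset.range (k + 1), μ.real {i} * z ^ i ≤ z ^ (k + 1) := by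
  have hi : ∀ i ∈ Finset.range (k + 1),
      Integrable (fun j : ℕ => (({i} : Set ℕ).indicator 1 j : ℝ) * z ^ i) μ := fun i _ =>
    ((integrable_const (1 : ℝ)).indicator (measurableSet_singleton i)).mul_const _
  have hsum : ∑ i ∈ Finset.range (k + 1), μ.real {i} * z ^ i =
      ∫ j, ∑ i ∈ Finset.range (k + 1), (({i} : Set ℕ).indicator 1 j : ℝ) * z ^ i ∂μ := by
    rw [integral_finsetSum _ hi]
    refine Finset.sum_congr rfl fun i _ => ?_
    rw [integral_mul_const, integral_indicator_one (measurableSet_singleton i)]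
  have hpt : ∀ j : ℕ, ∑ i ∈ Finset.range (k + 1), (({i} : Set ℕ).indicator 1 j : ℝ) * z ^ i =
      if j ∈ Finset.range (k + 1) then z ^ j else 0 := by
    intro j
    rw [← Finset.sum_ite_eq (Finset.range (k + 1)) j fun i => z ^ i]
    refine Finset.sum_congr rfl fun i _ => ?_
    by_cases h : j = i <;> simp [h]
  have hint := integrable_finsetSum _ hi
  rw [hsum, ← integral_sub (integrable_pow_nat μ hz) hint]
  have hbound : ∀ j : ℕ, 0 ≤ z ^ j - ∑ i ∈ Finset.range (k + 1),
        (({i} : Set ℕ).indicator 1 j : ℝ) * z ^ i ∧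
      z ^ j - ∑ i ∈ Finset.range (k + 1), (({i} : Set ℕ).indicator 1 j : ℝ) * z ^ i ≤
        z ^ (k + 1) := by
    intro j
    rw [hpt j]
    split_ifs with h
    · simpa using pow_nonneg hz.1 (k + 1)
    · rw [Finset.mem_range, not_lt] at h
      rw [sub_zero]
      exact ⟨pow_nonneg hz.1 j, pow_le_pow_of_le_one hz.1 hz.2 h⟩
  refine ⟨integral_nonneg fun j => (hbound j).1, ?_⟩
  have := integral_mono ((integrable_pow_nat μ hz).sub hint) (integrable_const (z ^ (k + 1)))
    fun j => (hbound j).2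
  simpa using this

/-- Once the masses below `k` converge, subtracting them leaves `μ{k} z^k` up to `z^(k+1)`; dividing
by `z^k` with `z` small isolates the next mass. -/
theorem tendsto_singleton_of_tendsto_pgf {μs : ℕ → Measure ℕ} [∀ n, IsProbabilityMeasure (μs n)]
    {μ : Measure ℕ} [IsProbabilityMeasure μ]
    (h : ∀ z ∈ Set.Ioo (0 : ℝ) 1,
      Tendsto (fun n => ∫ j, z ^ j ∂(μs n)) atTop (𝓝 (∫ j, z ^ j ∂μ))) (k : ℕ) :
    Tendsto (fun n => (μs n).real {k}) atTop (𝓝 (μ.real {k})) := by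
  induction k using Nat.strong_induction_on with
  | _ k ih =>
    rw [Metric.tendsto_atTop']
    intro ε hε
    -- The limit and the Taylor remainders contribute at most `2 z^(k+1)` to the difference, that is
    -- `2 z ≤ ε / 2` after division by `z^k`.
    set z := min (ε / 4) (1 / 2) with hz
    have hz0 : 0 < z := lt_min (by linarith) (by norm_num)
    have hz1 : z ≤ 1 / 2 := min_le_right _ _
    have hzε : z ≤ ε / 4 := min_le_left _ _
    have hzI : z ∈ Set.Icc (0 : ℝ) 1 := ⟨hz0.le, by linarith⟩
    have hlim : Tendsto (fun n => (∫ j, z ^ j ∂(μs n)) -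
        ∑ i ∈ Finset.range k, (μs n).real {i} * z ^ i) atTop
        (𝓝 ((∫ j, z ^ j ∂μ) - ∑ i ∈ Finset.range k, μ.real {i} * z ^ i)) :=
      (h z ⟨hz0, by linarith⟩).sub (tendsto_finsetSum _ fun i hi =>
        (ih i (Finset.mem_range.1 hi)).mul_const _)
    obtain ⟨N, hN⟩ := (Metric.tendsto_atTop.1 hlim) (z ^ (k + 1)) (pow_pos hz0 _)
    refine ⟨N, fun n hn => ?_⟩
    have h1 := hN n hn.le
    obtain ⟨a1, a2⟩ := pgf_taylor_bounds (μs n) hzI k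
    obtain ⟨b1, b2⟩ := pgf_taylor_bounds μ hzI k
    rw [Finset.sum_range_succ] at a1 a2 b1 b2
    rw [Real.dist_eq, abs_lt] at h1
    have hzk : 0 < z ^ k := pow_pos hz0 k
    rw [pow_succ] at h1 a2 b2
    rw [Real.dist_eq, abs_lt]
    constructor
    · by_contra hc
      nlinarith
    · by_contra hc
      nlinarith

/-- Finite partial sums of the masses give the lower semicontinuity in the portmanteau theorem. No
tightness is needed, as the limit is a probability measure. -/
theorem tendsto_probabilityMeasure_of_tendsto_pgf {μs : ℕ → ProbabilityMeasure ℕ}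
    {μ : ProbabilityMeasure ℕ}
    (h : ∀ z ∈ Set.Ioo (0 : ℝ) 1,
      Tendsto (fun n => ∫ j, z ^ j ∂(μs n : Measure ℕ)) atTop
        (𝓝 (∫ j, z ^ j ∂(μ : Measure ℕ)))) :
    Tendsto μs atTop (𝓝 μ) := by
  refine tendsto_of_forall_isOpen_le_liminf' fun G _ => ?_
  have hs : ∀ k, Tendsto (fun n => (μs n : Measure ℕ) {k}) atTop (𝓝 ((μ : Measure ℕ) {k})) := by
    intro k
    have := tendsto_singleton_of_tendsto_pgf (μs := fun n => (μs n : Measure ℕ)) h k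
    exact (ENNReal.tendsto_toReal_iff (fun n => measure_ne_top _ _) (measure_ne_top _ _)).1 this
  have hsum : (μ : Measure ℕ) G = ∑' k, G.indicator (fun k => (μ : Measure ℕ) {k}) k :=
    ((μ : Measure ℕ).tsum_indicator_apply_singleton G (Set.to_countable G).measurableSet).symm
  rw [hsum, ENNReal.tsum_eq_iSup_sum]
  refine iSup_le fun s => ?_
  have hlim : Tendsto (fun n => ∑ k ∈ s, G.indicator (fun k => (μs n : Measure ℕ) {k}) k) atTop
      (𝓝 (∑ k ∈ s, G.indicator (fun k => (μ : Measure ℕ) {k}) k)) := by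
    refine tendsto_finsetSum _ fun k _ => ?_
    by_cases hk : k ∈ G
    · simpa [hk] using hs k
    · simp [hk]
  rw [← hlim.liminf_eq]
  refine liminf_le_liminf (Eventually.of_forall fun n => ?_)
  rw [← (μs n : Measure ℕ).tsum_indicator_apply_singleton G (Set.to_countable G).measurableSet]
  exact ENNReal.sum_le_tsum s

end GeneratingFunctions

/-! ### The generating function of the Pólya–Aeppli distribution -/

section PolyaAeppliGeneratingFunction

/-- Exponential tilting stays in the family: `p` becomes `p z`, and `s` becomes `s'` with `s'(1 - p
z) = s(1 - p) z`. The generating function is then the prefactor, since the tilted weights sum to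
one. -/
theorem polyaAeppliWeight_mul_pow {s p z : ℝ} (hz : z ∈ Set.Ioo (0 : ℝ) 1)
    (hp : p ∈ Set.Ico (0 : ℝ) 1) (k : ℕ) :
    polyaAeppliWeight s p k * z ^ k =
      Real.exp (s * (1 - p) * z / (1 - p * z) - s) *
        polyaAeppliWeight (s * (1 - p) * z / (1 - p * z)) (p * z) k := by
  obtain ⟨z0, z1⟩ := hz
  obtain ⟨p0, p1⟩ := hp
  have hpos : 0 < 1 - p * z := by nlinarith
  set s' := s * (1 - p) * z / (1 - p * z) with hs'
  have hss : s' * (1 - p * z) = s * (1 - p) * z := by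
    rw [hs']
    field_simp
  have hexp : Real.exp (s' - s) * Real.exp (-s') = Real.exp (-s) := by
    rw [← Real.exp_add]
    congr 1
    ring
  unfold polyaAeppliWeight
  split_ifs with hk
  · rw [hk, pow_zero, mul_one, hexp]
  · rw [← mul_assoc, hexp, mul_assoc, Finset.sum_mul]
    congr 1
    refine Finset.sum_congr rfl fun j hj => ?_
    have hjk : k - j + j = k := Nat.sub_add_cancel (Finset.mem_Icc.1 hj).2
    have hzk : z ^ k = z ^ (k - j) * z ^ j := by rw [← pow_add, hjk]
    have hj' : s' ^ j * (1 - p * z) ^ j = s ^ j * (1 - p) ^ j * z ^ j := by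
      rw [← mul_pow, hss, mul_pow, mul_pow]
    rw [hzk, mul_pow]
    calc _ = ((k - 1).choose (j - 1) : ℝ) / (j.factorial : ℝ) * p ^ (k - j) * z ^ (k - j) *
          (s ^ j * (1 - p) ^ j * z ^ j) := by ring
      _ = ((k - 1).choose (j - 1) : ℝ) / (j.factorial : ℝ) * p ^ (k - j) * z ^ (k - j) *
          (s' ^ j * (1 - p * z) ^ j) := by rw [hj']
      _ = _ := by ring

theorem integral_pow_polyaAeppli {s p z : ℝ} (hs : 0 < s) (hp : p ∈ Set.Ico (0 : ℝ) 1)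
    (hz : z ∈ Set.Ioo (0 : ℝ) 1) :
    ∫ j, z ^ j ∂(polyaAeppli s p hs hp).toMeasure =
      Real.exp (-(s * (1 - z) / (1 - p * z))) := by
  have hzI : z ∈ Set.Icc (0 : ℝ) 1 := ⟨hz.1.le, hz.2.le⟩
  rw [integral_countable (integrable_pow_nat _ hzI)]
  have hw : ∀ j, (polyaAeppli s p hs hp).toMeasure.real {j} = polyaAeppliWeight s p j := by
    intro j
    rw [measureReal_def, PMF.toMeasure_apply_singleton _ _ (measurableSet_singleton j)]
    exact ENNReal.toReal_ofReal (polyaAeppliWeight_nonneg hs hp j)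
  simp only [hw, smul_eq_mul]
  have hpos : 0 < 1 - p * z := by nlinarith [hz.1, hz.2, hp.1, hp.2]
  have hs' : 0 < s * (1 - p) * z / (1 - p * z) := by
    have h1 : 0 < 1 - p := by linarith [hp.2]
    have h2 := hz.1
    positivity
  have hp' : p * z ∈ Set.Ico (0 : ℝ) 1 := ⟨mul_nonneg hp.1 hz.1.le, by linarith⟩
  simp only [polyaAeppliWeight_mul_pow hz hp]
  rw [((hasSum_polyaAeppliWeight hs' hp').mul_left _).tsum_eq, mul_one]
  congr 1
  field_simp
  ring

end PolyaAeppliGeneratingFunction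

/-! ### The approximate differential equation and derivatives of generating functions -/

section GeneratingFunctionODE

theorem one_sub_mul_pos {ρ z : ℝ} (hρ : ρ ∈ Set.Ico (0 : ℝ) 1) (hz : z ∈ Set.Icc (0 : ℝ) 1) :
    0 < 1 - ρ * z := by nlinarith [hρ.1, hρ.2, hz.1, hz.2]

/-- A generating function which almost satisfies the differential equation of the generating
function of a Pólya–Aeppli distribution is close to it. -/
theorem abs_sub_exp_le_of_approx_ode {t ρ ε : ℝ} (ht : 0 < t) (hρ : ρ ∈ Set.Ico (0 : ℝ) 1)
    {F F' : ℝ → ℝ} (hF : ∀ z, HasDerivAt F (F' z) z) (hF1 : F 1 = 1)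
    (happ : ∀ z ∈ Set.Icc (0 : ℝ) 1, |F' z - t * ((1 - ρ) / (1 - ρ * z)) ^ 2 * F z| ≤ ε)
    {z : ℝ} (hz : z ∈ Set.Icc (0 : ℝ) 1) :
    |F z - Real.exp (-(t * (1 - ρ) * (1 - z) / (1 - ρ * z)))| ≤ Real.exp t * ε := by
  set u : ℝ → ℝ := fun z => t * (1 - ρ) * (1 - z) / (1 - ρ * z) with hu
  have hu' : ∀ z ∈ Set.Icc (0 : ℝ) 1,
      HasDerivAt u (-(t * ((1 - ρ) / (1 - ρ * z)) ^ 2)) z := by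
    intro z hz
    have hpos := one_sub_mul_pos hρ hz
    have h1 : HasDerivAt (fun z : ℝ => t * (1 - ρ) * (1 - z)) (t * (1 - ρ) * -1) z :=
      ((hasDerivAt_id z).const_sub 1).const_mul _
    have h2 : HasDerivAt (fun z : ℝ => 1 - ρ * z) (-(ρ * 1)) z :=
      ((hasDerivAt_id z).const_mul ρ).const_sub 1
    convert! h1.div h2 hpos.ne' using 1
    field_simp
    ring
  have hu0 : ∀ z ∈ Set.Icc (0 : ℝ) 1, 0 ≤ u z ∧ u z ≤ t := by
    intro z hz
    have hpos := one_sub_mul_pos hρ hz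
    have h1 : 0 ≤ 1 - ρ := by linarith [hρ.2]
    have h2 : 0 ≤ 1 - z := by linarith [hz.2]
    refine ⟨by positivity, ?_⟩
    rw [hu, div_le_iff₀ hpos]
    have h3 : (1 - ρ) * (1 - z) ≤ 1 - ρ * z := by nlinarith [hρ.1, hz.1, hz.2]
    nlinarith
  have hε : 0 ≤ ε := (abs_nonneg _).trans (happ z hz)
  -- `exp u` is the integrating factor: the product equals one at `z = 1` and has derivative at most
  -- `ε * exp t`.
  have hW : ∀ z ∈ Set.Icc (0 : ℝ) 1, HasDerivWithinAt (fun z => F z * Real.exp (u z))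
      ((F' z - t * ((1 - ρ) / (1 - ρ * z)) ^ 2 * F z) * Real.exp (u z)) (Set.Icc 0 1) z := by
    intro z hz
    refine HasDerivAt.hasDerivWithinAt ?_
    convert! (hF z).mul (hu' z hz).exp using 1
    ring
  have hbound : ∀ z ∈ Set.Icc (0 : ℝ) 1,
      ‖(F' z - t * ((1 - ρ) / (1 - ρ * z)) ^ 2 * F z) * Real.exp (u z)‖ ≤ ε * Real.exp t := by
    intro z hz
    rw [norm_mul, Real.norm_eq_abs, Real.norm_of_nonneg (Real.exp_pos _).le]
    exact mul_le_mul (happ z hz) (Real.exp_le_exp.2 (hu0 z hz).2) (Real.exp_pos _).le hε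
  have hmv := (convex_Icc (0 : ℝ) 1).norm_image_sub_le_of_norm_hasDerivWithin_le hW hbound
    (x := 1) (y := z) (by simp) hz
  have hu1 : u 1 = 0 := by simp [hu]
  rw [hF1, hu1, Real.exp_zero, mul_one, Real.norm_eq_abs, Real.norm_eq_abs] at hmv
  have hz1 : |z - 1| ≤ 1 := by
    rw [abs_le]
    constructor <;> linarith [hz.1, hz.2]
  have hfin : F z - Real.exp (-(u z)) = (F z * Real.exp (u z) - 1) * Real.exp (-(u z)) := by
    rw [sub_mul, mul_assoc, ← Real.exp_add]
    simp
  change |F z - Real.exp (-(u z))| ≤ _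
  rw [hfin, abs_mul, abs_of_pos (Real.exp_pos _)]
  have he1 : Real.exp (-(u z)) ≤ 1 := Real.exp_le_one_iff.2 (by linarith [(hu0 z hz).1])
  calc |F z * Real.exp (u z) - 1| * Real.exp (-(u z)) ≤ |F z * Real.exp (u z) - 1| * 1 := by
        gcongr
    _ ≤ ε * Real.exp t * |z - 1| := by simpa using hmv
    _ ≤ ε * Real.exp t * 1 := by gcongr
    _ = _ := by ring

variable {Ω : Type*} [MeasurableSpace Ω] {P : Measure Ω} [IsProbabilityMeasure P]

theorem integral_comp_nat_eq_sum {f : Ω → ℕ} (hf : Measurable f) {N : ℕ} (hN : ∀ y, f y ≤ N)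
    (φ : ℕ → ℝ) :
    ∫ y, φ (f y) ∂P = ∑ j ∈ Finset.range (N + 1), P.real (f ⁻¹' {j}) * φ j := by
  have hm : ∀ j, MeasurableSet (f ⁻¹' {j}) := fun j => hf (measurableSet_singleton j)
  have hpt : ∀ y, φ (f y) =
      ∑ j ∈ Finset.range (N + 1), ((f ⁻¹' {j}).indicator 1 y : ℝ) * φ j := by
    intro y
    rw [Finset.sum_eq_single (f y)]
    · simp
    · intro j _ hj
      simp [hj.symm]
    · intro h
      exact absurd (Finset.mem_range.2 (Nat.lt_succ_of_le (hN y))) h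
  have hi : ∀ j ∈ Finset.range (N + 1),
      Integrable (fun y => ((f ⁻¹' {j}).indicator 1 y : ℝ) * φ j) P := fun j _ =>
    ((integrable_const (1 : ℝ)).indicator (hm j)).mul_const _
  simp only [hpt]
  rw [integral_finsetSum _ hi]
  refine Finset.sum_congr rfl fun j _ => ?_
  rw [integral_mul_const, integral_indicator_one (hm j)]

/-- As `f` is bounded, its generating function is a polynomial. The truncated exponent at `f y = 0`
is harmless because the coefficient vanishes. -/
theorem hasDerivAt_integral_pow {f : Ω → ℕ} (hf : Measurable f) {N : ℕ} (hN : ∀ y, f y ≤ N)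
    (z : ℝ) :
    HasDerivAt (fun z => ∫ y, z ^ f y ∂P) (∫ y, (f y : ℝ) * z ^ (f y - 1) ∂P) z := by
  have h1 : (fun z : ℝ => ∫ y, z ^ f y ∂P) = fun z =>
      ∑ j ∈ Finset.range (N + 1), P.real (f ⁻¹' {j}) * z ^ j :=
    funext fun z => integral_comp_nat_eq_sum hf hN fun j => z ^ j
  rw [h1, integral_comp_nat_eq_sum hf hN fun j => (j : ℝ) * z ^ (j - 1)]
  exact HasDerivAt.fun_sum fun j _ => (hasDerivAt_pow j z).const_mul _

end GeneratingFunctionODE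

/-! ### The limit of the generating functions and the main theorem -/

section

variable {𝒜 : Type*} [MeasurableSpace 𝒜] [DiscreteMeasurableSpace 𝒜] [Countable 𝒜]
  {P : Measure (ℕ → 𝒜)} [IsProbabilityMeasure P] {ℓ : ℕ} {d : Fin ℓ → ℕ} {x : ℕ → 𝒜}

theorem hitCount_le_card (n : ℕ) (s : Finset ℕ) (y : ℕ → 𝒜) : hitCount d x n s y ≤ s.card := by
  refine (Finset.sum_le_card_nsmul s _ 1 fun k _ => ?_).trans (by simp)
  rcases recurrence_eq_zero_or_one (d := d) (x := x) n k y with h | h <;> simp [h]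

theorem integral_hitCount_mul_pow {z : ℝ} (hz : z ∈ Set.Icc (0 : ℝ) 1) (n : ℕ) (s : Finset ℕ) :
    ∫ y, (hitCount d x n s y : ℝ) * z ^ (hitCount d x n s y - 1) ∂P =
      ∑ k ∈ s, ∫ y, (recurrence d (PiNat.cylinder x n) k y : ℝ) *
        z ^ (hitCount d x n s y - 1) ∂P := by
  have hm : Measurable fun y => hitCount d x n s y - 1 :=
    (measurable_of_countable fun j : ℕ => j - 1).comp (measurable_hitCount n s)
  rw [← integral_finsetSum _ fun k _ => integrable_recurrence_mul_pow hz n k hm]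
  refine integral_congr_ae (Eventually.of_forall fun y => ?_)
  simp only
  rw [← Finset.sum_mul, hitCount, Nat.cast_sum]

namespace PeriodicHitting

variable {ψ : ℕ → ℝ} {r κ D : ℕ} {e : Fin ℓ → ℕ} {θ : ℝ}

theorem tendsto_relative_error (H : PeriodicHitting P d x ψ r κ D e θ) :
    Tendsto (fun n : ℕ =>
      ((ℓ * ℓ * (2 * ((D + 2) * n)) : ℕ) * (1 + ψ 0) ^ (ℓ + 1) * P.real (PiNat.cylinder x n) +
      (((1 + ψ n) / (1 - ψ n)) ^ (2 * ℓ) - 1) * (1 + ψ 0) ^ (ℓ + 1) +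
      (1 + ψ 0) ^ (ℓ + 1) * ((ℓ * ℓ * (2 * ((D + 2) * n)) : ℕ) * (1 + ψ 0) ^ (ℓ + 1) *
        P.real (PiNat.cylinder x n)))) atTop (𝓝 0) := by
  set K := (1 + ψ 0) ^ (ℓ + 1)
  have h1 : Tendsto (fun n : ℕ => ((ℓ * ℓ * (2 * ((D + 2) * n)) : ℕ) : ℝ) * K *
      P.real (PiNat.cylinder x n)) atTop (𝓝 0) := by
    have := H.decay.const_mul ((ℓ * ℓ * (2 * (D + 2)) : ℝ) * K)
    rw [mul_zero] at this
    refine this.congr fun n => ?_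
    push_cast
    ring
  have h2 : Tendsto (fun n : ℕ => (((1 + ψ n) / (1 - ψ n)) ^ (2 * ℓ) - 1) * K) atTop (𝓝 0) := by
    have := ((((H.psi_tendsto.const_add 1).div (H.psi_tendsto.const_sub 1)
      (by norm_num)).pow (2 * ℓ)).sub_const 1).mul_const K
    simpa using this
  simpa using (h1.add h2).add (h1.const_mul K)

/-- Each interior index contributes about `p^ℓ g F`, and there are `t p^(-ℓ) + O(n)` of them.
Indices within `n` of an end are estimated trivially, and every boundary error is `O(n p)`. -/
theorem eventually_approx_ode (H : PeriodicHitting P d x ψ r κ D e θ) {t : ℝ} (ht : 0 < t)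
    {ε : ℝ} (hε : 0 < ε) :
    ∀ᶠ n : ℕ in atTop, ∀ z ∈ Set.Icc (0 : ℝ) 1,
      |∫ y, (hitCount d x n (Finset.Icc ((2 * D + 5) * n) (timeScale P t ℓ x n)) y : ℝ) *
          z ^ (hitCount d x n (Finset.Icc ((2 * D + 5) * n) (timeScale P t ℓ x n)) y - 1) ∂P -
        t * ((1 - θ ^ ∑ j, e j) / (1 - θ ^ (∑ j, e j) * z)) ^ 2 *
          ∫ y, z ^ hitCount d x n (Finset.Icc ((2 * D + 5) * n) (timeScale P t ℓ x n)) y ∂P| ≤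
      ε := by
  classical
  have hρ := H.rho_mem
  set ρ := θ ^ ∑ j, e j with hρdef
  set K := (1 + ψ 0) ^ (ℓ + 1) with hK
  have hK0 : 0 ≤ K := pow_nonneg (by linarith [H.psi_nonneg 0]) _
  have hrel := H.tendsto_relative_error.eventually_le_const
    (show 0 < ε / (4 * t) by positivity)
  -- The `1` comes from the integer part in `N`, `2D + 7` counts the omitted initial segment and the
  -- two edges, and `2K` bounds the contribution of the edges.
  have hedge : Tendsto (fun n : ℕ => (1 + (2 * D + 7 + 2 * K) * (n : ℝ)) *
      P.real (PiNat.cylinder x n)) atTop (𝓝 0) := by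
    have := H.tendsto_cylinder.add (H.decay.const_mul (2 * D + 7 + 2 * K))
    rw [mul_zero, add_zero] at this
    refine this.congr fun n => ?_
    ring
  filter_upwards [hrel, hedge.eventually_le_const (show 0 < ε / 2 by linarith),
    H.eventually_abs_integral_neighbour_sub_le (show 0 < ε / (4 * t) by positivity),
    H.psi_tendsto.eventually_lt_const (show (0 : ℝ) < 1 by norm_num), eventually_ge_atTop 1]
    with n hrel hedge hnear hψn hn1 z hz
  set a := (2 * D + 5) * n with ha
  set N := timeScale P t ℓ x n with hN
  set p := P.real (PiNat.cylinder x n) with hp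
  have hppos : 0 < p := H.cylinder_pos n
  have hp1 : p ≤ 1 := measureReal_le_one
  have hpℓ0 : 0 < p ^ ℓ := pow_pos hppos ℓ
  have hpℓ : p ^ ℓ ≤ p := by
    simpa using pow_le_pow_of_le_one hppos.le hp1 (show 1 ≤ ℓ from H.card_pos)
  have hna : n ≤ a := Nat.le_mul_of_pos_left n (by omega)
  have hNle : (N : ℝ) * p ^ ℓ ≤ t := by
    have h : (N : ℝ) ≤ t * (p ^ ℓ)⁻¹ := Nat.floor_le (by positivity)
    rw [← div_eq_mul_inv, le_div_iff₀ hpℓ0] at h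
    exact h
  have hNge : t ≤ ((N : ℝ) + 1) * p ^ ℓ := by
    have h : t * (p ^ ℓ)⁻¹ < (N : ℝ) + 1 := Nat.lt_floor_add_one _
    rw [← div_eq_mul_inv, div_lt_iff₀ hpℓ0] at h
    exact h.le
  set g := ((1 - ρ) / (1 - ρ * z)) ^ 2 with hg
  have hpos := one_sub_mul_pos hρ hz
  have hg0 : 0 ≤ g := sq_nonneg _
  have hg1 : g ≤ 1 := by
    refine pow_le_one₀ (div_nonneg (by linarith [hρ.2]) hpos.le) ((div_le_one hpos).2 ?_)
    nlinarith [hρ.1, hz.2]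
  set s := Finset.Icc a N with hs
  set inner := Finset.Icc (a + n) (N - n) with hinner
  have hsub : inner ⊆ s := Finset.Icc_subset_Icc (by omega) (by omega)
  have hcard_inner : (N : ℝ) - a - 2 * n ≤ inner.card ∧ (inner.card : ℝ) ≤ N := by
    rw [hinner, Nat.card_Icc]
    constructor
    · have : N ≤ (N - n + 1 - (a + n)) + a + 2 * n := by omega
      have h : (N : ℝ) ≤ ((N - n + 1 - (a + n) : ℕ) : ℝ) + a + 2 * n := by exact_mod_cast this
      linarith
    · have : N - n + 1 - (a + n) ≤ N := by omega
      exact_mod_cast this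
  have hcard_edge : ((s \ inner).card : ℝ) ≤ 2 * n := by
    have : (s \ inner).card ≤ 2 * n := by
      rw [Finset.card_sdiff_of_subset hsub, hs, hinner, Nat.card_Icc, Nat.card_Icc]
      omega
    exact_mod_cast this
  set F := ∫ y, z ^ hitCount d x n s y ∂P with hF
  have hFmem : F ∈ Set.Icc (0 : ℝ) 1 := integral_pow_hitCount_mem hz n s
  set I : ℕ → ℝ := fun k => ∫ y, (recurrence d (PiNat.cylinder x n) k y : ℝ) *
    z ^ (hitCount d x n s y - 1) ∂P with hI
  have hsplit : ∫ y, (hitCount d x n s y : ℝ) * z ^ (hitCount d x n s y - 1) ∂P =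
      ∑ k ∈ inner, I k + ∑ k ∈ s \ inner, I k := by
    rw [integral_hitCount_mul_pow hz, add_comm, Finset.sum_sdiff hsub]
  have hm : Measurable fun y => hitCount d x n s y - 1 :=
    (measurable_of_countable fun j : ℕ => j - 1).comp (measurable_hitCount n s)
  have hedge1 : |∑ k ∈ s \ inner, I k| ≤ 2 * n * (K * p) := by
    have hterm : ∀ k ∈ s \ inner, |I k| ≤ K * p := by
      intro k hk
      have hka := (Finset.mem_Icc.1 (Finset.mem_sdiff.1 hk).1).1
      have h := integral_recurrence_mul_pow_mem (P := P) (d := d) (x := x) hz n k hm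
      rw [abs_of_nonneg h.1]
      exact h.2.trans ((H.measureReal_hitEvent_le (by omega)).trans
        (mul_le_mul_of_nonneg_left hpℓ hK0))
    calc _ ≤ ∑ k ∈ s \ inner, |I k| := Finset.abs_sum_le_sum_abs _ _
      _ ≤ ((s \ inner).card : ℝ) * (K * p) := by
          simpa using Finset.sum_le_card_nsmul _ _ _ hterm
      _ ≤ _ := by gcongr
  have hinner1 : |∑ k ∈ inner, I k - inner.card * (p ^ ℓ * g * F)| ≤ ε / 2 := by
    have hterm : ∀ k ∈ inner, |I k - p ^ ℓ * g * F| ≤ (ε / (4 * t) + ε / (4 * t)) * p ^ ℓ := by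
      intro k hk
      rw [hinner, Finset.mem_Icc] at hk
      have hkD : (D + 4) * n ≤ k := by
        have : (D + 4) * n ≤ a := Nat.mul_le_mul_right n (by omega)
        omega
      refine (H.abs_integral_recurrence_mul_pow_sub_le hn1 hψn (by omega) (N := N) (by omega) hz
        (hnear k hkD z hz)).trans ?_
      exact mul_le_mul_of_nonneg_right (add_le_add_left hrel _) hpℓ0.le
    have : ∑ k ∈ inner, I k - inner.card * (p ^ ℓ * g * F) =
        ∑ k ∈ inner, (I k - p ^ ℓ * g * F) := by
      rw [Finset.sum_sub_distrib, Finset.sum_const, nsmul_eq_mul]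
    rw [this]
    calc _ ≤ ∑ k ∈ inner, |I k - p ^ ℓ * g * F| := Finset.abs_sum_le_sum_abs _ _
      _ ≤ (inner.card : ℝ) * ((ε / (4 * t) + ε / (4 * t)) * p ^ ℓ) := by
          simpa using Finset.sum_le_card_nsmul _ _ _ hterm
      _ ≤ N * ((ε / (4 * t) + ε / (4 * t)) * p ^ ℓ) := by
          gcongr
          exact_mod_cast hcard_inner.2
      _ = (N * p ^ ℓ) * (ε / (2 * t)) := by ring
      _ ≤ t * (ε / (2 * t)) := by gcongr
      _ = ε / 2 := by field_simp
  have hmain : |inner.card * (p ^ ℓ * g * F) - t * g * F| ≤ (1 + (2 * D + 7) * n) * p := by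
    have haR : (a : ℝ) = (2 * D + 5) * n := by
      rw [ha]
      push_cast
      ring
    have h1 : |(inner.card : ℝ) * p ^ ℓ - t| ≤ (1 + (2 * D + 7) * n) * p ^ ℓ := by
      rw [abs_le]
      constructor
      · have := mul_le_mul_of_nonneg_right hcard_inner.1 hpℓ0.le
        rw [haR] at this
        nlinarith
      · have := mul_le_mul_of_nonneg_right hcard_inner.2 hpℓ0.le
        have h0 : 0 ≤ (1 + (2 * (D : ℝ) + 7) * n) * p ^ ℓ := by positivity
        linarith
    rw [show inner.card * (p ^ ℓ * g * F) - t * g * F = (inner.card * p ^ ℓ - t) * (g * F) by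
      ring, abs_mul, abs_of_nonneg (mul_nonneg hg0 hFmem.1)]
    refine (mul_le_of_le_one_right (abs_nonneg _) (mul_le_one₀ hg1 hFmem.1 hFmem.2)).trans
      (h1.trans ?_)
    gcongr
  rw [hsplit]
  have hdecomp : ∑ k ∈ inner, I k + ∑ k ∈ s \ inner, I k - t * g * F =
      (∑ k ∈ inner, I k - inner.card * (p ^ ℓ * g * F)) +
        (inner.card * (p ^ ℓ * g * F) - t * g * F) + ∑ k ∈ s \ inner, I k := by ring
  rw [hdecomp]
  refine (abs_add_le _ _).trans ((add_le_add ((abs_add_le _ _).trans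
    (add_le_add hinner1 hmain)) hedge1).trans ?_)
  have : (1 + (2 * D + 7) * (n : ℝ)) * p + 2 * n * (K * p) =
      (1 + (2 * D + 7 + 2 * K) * (n : ℝ)) * p := by ring
  linarith

theorem tendsto_pgf (H : PeriodicHitting P d x ψ r κ D e θ) {t : ℝ} (ht : 0 < t)
    {z : ℝ} (hz : z ∈ Set.Icc (0 : ℝ) 1) :
    Tendsto (fun n => ∫ y, z ^ hitCount d x n (Finset.Icc 1 (timeScale P t ℓ x n)) y ∂P) atTop
      (𝓝 (Real.exp (-(t * (1 - θ ^ ∑ j, e j) * (1 - z) / (1 - θ ^ (∑ j, e j) * z))))) := by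
  classical
  rw [Metric.tendsto_nhds]
  intro ε hε
  have hinit : Tendsto (fun n : ℕ => (2 * D + 5) * ((n : ℝ) * P.real (PiNat.cylinder x n))) atTop
      (𝓝 0) := by
    simpa using H.decay.const_mul (2 * (D : ℝ) + 5)
  filter_upwards [H.eventually_approx_ode ht (show 0 < ε / (2 * Real.exp t) by positivity),
    hinit.eventually_lt_const (show 0 < ε / 2 by linarith), eventually_ge_atTop 1]
    with n hode hinit hn1
  set a := (2 * D + 5) * n with ha
  set N := timeScale P t ℓ x n
  have ha1 : 1 ≤ a := Nat.mul_pos (by omega) hn1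
  set s := Finset.Icc a N with hs
  have h1 := abs_sub_exp_le_of_approx_ode ht H.rho_mem
    (fun z => hasDerivAt_integral_pow (P := P) (measurable_hitCount (d := d) (x := x) n s)
      (hitCount_le_card n s) z) (by simp) hode hz
  have he : Real.exp t * (ε / (2 * Real.exp t)) = ε / 2 := by
    field_simp
  rw [he] at h1
  have hsub : s ⊆ Finset.Icc 1 N := Finset.Icc_subset_Icc ha1 le_rfl
  -- For small `k` the blocks may overlap, so only one of them is used; `O(n)` indices of
  -- probability at most `p` are negligible.
  have hhit : ∀ k ∈ Finset.Icc 1 N \ s, P.real (hitEvent d x n k) ≤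
      P.real (PiNat.cylinder x n) := fun k _ => by
    let j₀ : Fin ℓ := ⟨0, H.card_pos⟩
    rw [← measureReal_preimage_shift_iterate H.measurePreserving (d j₀ * k)
      (measurableSet_cylinder x n)]
    exact measureReal_mono fun y hy => hy j₀
  have h2 := abs_integral_pow_hitCount_union_sub_le (P := P) (d := d) (x := x) hz n
    Finset.disjoint_sdiff hhit
  rw [Finset.union_sdiff_of_subset hsub] at h2
  have hcard : ((Finset.Icc 1 N \ s).card : ℝ) ≤ a := by
    have : (Finset.Icc 1 N \ s).card ≤ a := by
      have hsub' : Finset.Icc 1 N \ s ⊆ Finset.range a := fun k hk => by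
        rw [hs, Finset.mem_sdiff, Finset.mem_Icc, Finset.mem_Icc] at hk
        rw [Finset.mem_range]
        omega
      simpa using Finset.card_le_card hsub'
    exact_mod_cast this
  have h3 : ((Finset.Icc 1 N \ s).card : ℝ) * P.real (PiNat.cylinder x n) < ε / 2 := by
    refine lt_of_le_of_lt ?_ hinit
    rw [← mul_assoc]
    refine mul_le_mul_of_nonneg_right (hcard.trans (le_of_eq ?_)) measureReal_nonneg
    rw [ha]
    push_cast
    ring
  rw [Real.dist_eq]
  rw [abs_sub_comm] at h2
  have := abs_sub_le (∫ y, z ^ hitCount d x n (Finset.Icc 1 N) y ∂P)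
    (∫ y, z ^ hitCount d x n s y ∂P)
    (Real.exp (-(t * (1 - θ ^ ∑ j, e j) * (1 - z) / (1 - θ ^ (∑ j, e j) * z))))
  linarith

end PeriodicHitting

variable [TopologicalSpace 𝒜] [DiscreteTopology 𝒜]

/-- Since `r ∣ d j * κ`, the exponent `a` is the natural number `∑ e j`, so the real power defining
`ρ` is an ordinary power of the ratio limit `θ`. -/
theorem exists_periodicHitting (hT : MeasurePreserving shift P P) (hψ : IsPsiMixing P)
    (hP : ∀ a : 𝒜, P {ω | ω 0 = a} < 1) {S : Matrix 𝒜 𝒜 ℕ} (hPS : P (markovShift S) = 1)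
    (hℓ : 0 < ℓ) (hd : ∀ j, 1 ≤ d j) (hd' : StrictMono d)
    {J : (ℕ → 𝒜) → ℝ} (hJ : inverseJacobian S P =ᵐ[compShift S P] J)
    (hJc : ContinuousOn J (markovShift S)) (hx : x ∈ P.support)
    {r : ℕ} (hr : 0 < r) (hxr : Function.minimalPeriod shift x = r) :
    ∃ (ψ : ℕ → ℝ) (κ D : ℕ) (e : Fin ℓ → ℕ) (θ : ℝ), PeriodicHitting P d x ψ r κ D e θ ∧
      θ ^ ∑ j, e j = clusterParameter d J x r := by
  obtain ⟨ψ, ψ0, ψlim, hmix⟩ := hψ.exists_mixesAt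
  have hper : shift^[r] x = x := hxr ▸ Function.iterate_minimalPeriod
  set θ := ∏ j ∈ Finset.range r, J (shift^[j] x) with hθdef
  have hθ : Tendsto (fun n => P.real (PiNat.cylinder x (n + r)) / P.real (PiNat.cylinder x n))
      atTop (𝓝 θ) := by
    have := tendsto_cylinder_ratio_prod hT hPS hJ hJc hx r
    rwa [hper] at this
  have hθmem := cylinder_ratio_limit_mem_Ico hψ hP hx hr hper hθ
  have hκdvd : ∀ j, r ∣ d j * kappa d r := (dvd_kappa_mul_iff hr _).1 dvd_rfl
  choose e he using hκdvd
  have hκpos : 0 < kappa d r := kappa_pos hr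
  have hepos : ∀ j, 0 < e j := fun j => by
    refine Nat.pos_of_ne_zero fun h => ?_
    have h1 := he j
    rw [h, mul_zero] at h1
    have h2 := Nat.mul_pos (hd j) hκpos
    omega
  have hsum : ∑ j, e j ≠ 0 := by
    have h1 := Finset.single_le_sum (f := e) (fun j _ => Nat.zero_le _)
      (Finset.mem_univ (⟨0, hℓ⟩ : Fin ℓ))
    have h2 := hepos ⟨0, hℓ⟩
    omega
  refine ⟨ψ, kappa d r, Finset.univ.sup d, e, θ, ?_, ?_⟩
  · exact
      { measurePreserving := hT
        psi_nonneg := ψ0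
        psi_tendsto := ψlim
        mixesAt := hmix
        card_pos := hℓ
        one_le := hd
        strictMono := hd'
        le_bound := fun j => Finset.le_sup (Finset.mem_univ j)
        cylinder_pos := measureReal_cylinder_pos hx
        ratio_tendsto := tendsto_cylinder_ratio_pow hx hθ
        mul_period := he
        minimalPeriod_eq := hxr
        period_pos := hr
        dvd_iff := dvd_kappa_mul_iff hr
        lag_pos := hκpos
        decay := tendsto_mul_measureReal_cylinder hψ hP hr hper
        rho_mem := ⟨pow_nonneg hθmem.1 _, pow_lt_one₀ hθmem.1 hθmem.2 hsum⟩ }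
  · have hexp : recurrenceExponent d r = ((∑ j, e j : ℕ) : ℝ) := by
      have hr' : (r : ℝ) ≠ 0 := by exact_mod_cast hr.ne'
      rw [recurrenceExponent, div_mul_eq_mul_div, div_eq_iff hr']
      have h : ∑ j, d j * kappa d r = r * ∑ j, e j := by
        rw [Finset.mul_sum]
        exact Finset.sum_congr rfl fun j _ => he j
      rw [← Finset.sum_mul] at h
      have h' : (∑ j, (d j : ℝ)) * kappa d r = r * ((∑ j, e j : ℕ) : ℝ) := by exact_mod_cast h
      linarith
    rw [clusterParameter, hexp, Real.rpow_natCast]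

end

end ShiftRecurrence

open ShiftRecurrence in
theorem corollary3p4 {𝒜 : Type*} [Countable 𝒜] [Nontrivial 𝒜]
    [TopologicalSpace 𝒜] [DiscreteTopology 𝒜] [MeasurableSpace 𝒜] [DiscreteMeasurableSpace 𝒜]
    (P : Measure (ℕ → 𝒜)) [IsProbabilityMeasure P]
    (hT : MeasurePreserving shift P P) (hψ : IsPsiMixing P)
    (hP : ∀ a : 𝒜, P {ω | ω 0 = a} < 1)
    (S : Matrix 𝒜 𝒜 ℕ) (hS : IsTransitionMatrix S) (hPS : P (markovShift S) = 1)
    (hmix : IsTopologicallyMixingOn (markovShift S))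
    {ℓ : ℕ} (hℓ : 0 < ℓ) (d : Fin ℓ → ℕ) (hd : ∀ j, 1 ≤ d j) (hd' : StrictMono d)
    (t : ℝ) (ht : 0 < t)
    (J : (ℕ → 𝒜) → ℝ) (hJ : inverseJacobian S P =ᵐ[compShift S P] J)
    (hJc : ContinuousOn J (markovShift S))
    (ω : ℕ → 𝒜) (hω : ω ∈ P.support)
    (r : ℕ) (hr : 0 < r) (hωr : Function.minimalPeriod shift ω = r) :
    ∃ (hρ : clusterParameter d J ω r ∈ Set.Ico (0 : ℝ) 1)
      (hs : 0 < t * (1 - clusterParameter d J ω r)),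
      TendstoInDistribution
        (fun n => recurrenceCount d (PiNat.cylinder ω n) (timeScale P t ℓ ω n)) atTop
        (id : ℕ → ℕ) (fun _ => P)
        (polyaAeppli (t * (1 - clusterParameter d J ω r)) (clusterParameter d J ω r)
          hs hρ).toMeasure := by
  obtain ⟨ψ, κ, D, e, θ, H, hθ⟩ := exists_periodicHitting hT hψ hP hPS hℓ hd hd' hJ hJc hω hr hωr
  have hρ : clusterParameter d J ω r ∈ Set.Ico (0 : ℝ) 1 := hθ ▸ H.rho_mem
  have hs : 0 < t * (1 - clusterParameter d J ω r) := mul_pos ht (by linarith [hρ.2])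
  have hmeas : ∀ n, Measurable
      (recurrenceCount d (PiNat.cylinder ω n) (timeScale P t ℓ ω n)) := fun n =>
    measurable_hitCount (d := d) (x := ω) n (Finset.Icc 1 (timeScale P t ℓ ω n))
  refine ⟨hρ, hs, ⟨fun n => (hmeas n).aemeasurable, measurable_id.aemeasurable, ?_⟩⟩
  refine tendsto_probabilityMeasure_of_tendsto_pgf fun z hz => ?_
  simp only [ProbabilityMeasure.coe_mk, Measure.map_id]
  rw [integral_pow_polyaAeppli hs hρ hz]
  have hlim := H.tendsto_pgf ht (z := z) ⟨hz.1.le, hz.2.le⟩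
  rw [hθ] at hlim
  refine hlim.congr fun n => ?_
  rw [integral_map (hmeas n).aemeasurable (measurable_of_countable _).aestronglyMeasurable]
  rfl
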